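/- Let $\mathbb K$ be an algebraically closed field of characteristic $0$. **Crossed pointed categories.** A *fusion category* over $\mathbb K$ is a rigid semisimple $\mathbb K$-linear abelian monoidal category with bilinear tensor product, finite dimensional spaces of morphisms, finitely many isomorphism classes of simple objects and simple unit object; it is *pointed* if every simple object is invertible. A *crossed pointed category* is a tuple $(\mathcal C,G,T,\gamma,\iota,\mu,\nu,c)$ in which $\mathcal C$ is a pointed fusion category, $G$ is a finite group, $\mathcal C=\bigoplus_{g\in G}\mathcal C_g$ is a (not necessarily faithful) $G$-grading (with $\mathcal C_g\otimes\mathcal C_h\subseteq\mathcal C_{gh}$ and duals of objects of $\mathcal C_g$ in $\mathcal C_{g^{-1}}$), $g\mapsto T_g$ is an action of $G$ on $\mathcal C$ by $\mathbb K$-linear tensor autoequivalences with $T_g(\mathcal C_h)\subseteq\mathcal C_{ghg^{-1}}$, with tensor structure $\gamma_{g,h}:T_{gh}\xrightarrow{\sim}T_gT_h$ and unit-preserving structure $\iota:T_e\xrightarrow{\sim}\mathrm{id}$, where each $T_g$ has tensor structure $\mu_g$ and unit-preserving structure $\nu_g$, and $c(X,Y):X\otimes Y\xrightarrow{\sim}T_g(Y)\otimes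 X$ ($X\in\mathcal C_g$, $Y\in\mathcal C$) are natural isomorphisms such that $$(\gamma_{g,h}(Y)\otimes\mathrm{id})(\gamma_{ghg^{-1},g}(Y)^{-1}\otimes\mathrm{id})\,c(T_g(X),T_g(Y))\,\mu_g(X,Y)=\mu_g(T_h(Y),X)\,T_g(c(X,Y))\quad(X\in\mathcal C_h,\,Y\in\mathcal C),$$ $$\alpha^{-1}_{T_gT_h(Z),X,Y}(\gamma_{g,h}(Z)\otimes\mathrm{id})\,c(X\otimes Y,Z)\,\alpha^{-1}_{X,Y,Z}=(c(X,T_h(Z))\otimes\mathrm{id})\,\alpha^{-1}_{X,T_h(Z),Y}(\mathrm{id}\otimes c(Y,Z))\quad(X\in\mathcal C_g,\,Y\in\mathcal C_h,\,Z\in\mathcal C),$$ $$\alpha_{T_g(Y),T_g(Z),X}(\mu_g(Y,Z)\otimes\mathrm{id})\,c(X,Y\otimes Z)\,\alpha_{X,Y,Z}=(\mathrm{id}\otimes c(X,Z))\,\alpha_{T_g(Y),X,Z}(c(X,Y)\otimes\mathrm{id})\quad(X\in\mathcal C_g,\,Y,Z\in\mathcal C),$$ where $\alpha$ is the associativity constraint.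 A *crossed tensor functor* to $(\mathcal C',G',T',\gamma',\iota',\mu',\nu',c')$ consists of a group homomorphism $f:G\to G'$, a $\mathbb K$-linear tensor functor $F:\mathcal C\to\mathcal C'$ with tensor structure $\eta$ and unit-preserving structure $\eta_0$, and isomorphisms of tensor functors $\beta_g:FT_g\xrightarrow{\sim}T'_{f(g)}F$, with $F(\mathcal C_g)\subseteq\mathcal C'_{f(g)}$, $(\beta_g(Y)\otimes\mathrm{id})\,\eta(T_g(Y),X)\,F(c(X,Y))=c'(F(X),F(Y))\,\eta(X,Y)$ for $X\in\mathcal C_g$, $Y\in\mathcal C$, and $T'_{f(g)}(\beta_h(X))\,\beta_g(T_h(X))\,F(\gamma_{g,h}(X))=\gamma'_{f(g),f(h)}(F(X))\,\beta_{gh}(X)$ for $g,h\in G$, $X\in\mathcal C$. It is an *equivalence* if $f$ is an isomorphism and $F$ is an equivalence; two crossed pointed categories are equivalent if there is such an equivalence. **Crossed modules and cohomology.** A *finite crossed module* $\mathcal X=(G,X,\partial)$ consists of finite groups $G,X$, an action $(g,x)\mapsto{}^gx$ of $G$ on $X$ by automorphisms and a homomorphism $\partial:X\to G$ with ${}^{\partial(x)}x'=xx'x^{-1}$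 and $\partial({}^gx)=g\,\partial(x)g^{-1}$. An isomorphism of crossed modules $(f,F)$ is a pair of group isomorphisms $f:G\to G'$, $F:X\to X'$ with $\partial'F=f\partial$ and $F({}^gx)={}^{f(g)}F(x)$; $\mathrm{Aut}(\mathcal X)$ is the group of isomorphisms $\mathcal X\to\mathcal X$. The group $Z^3_{qa}(\mathcal X,\mathbb K^\times)$, under pointwise multiplication, consists of the quadruples $\xi=(\omega,\gamma,\mu,c)$ of functions $\omega:X^3\to\mathbb K^\times$, $\gamma:G^2\times X\to\mathbb K^\times$, $\mu:G\times X^2\to\mathbb K^\times$, $c:X^2\to\mathbb K^\times$ such that, for all $g,h,k\in G$ and $x,y,z,t\in X$, $$\omega(x,y,z)\,\omega(t,xy,z)\,\omega(t,x,y)=\omega(t,x,yz)\,\omega(tx,y,z),\qquad \gamma_{h,k}(x)\,\gamma_{g,hk}(x)=\gamma_{g,h}({}^kx)\,\gamma_{gh,k}(x),$$ $$\frac{\mu_g(y,z)\,\mu_g(x,yz)}{\mu_g(xy,z)\,\mu_g(x,y)}=\frac{\omega({}^gx,{}^gy,{}^gz)}{\omega(x,y,z)},\qquad \frac{\gamma_{g,h}(x)\,\gamma_{g,h}(y)}{\gamma_{g,h}(xy)}=\frac{\mu_g({}^hx,{}^hy)\,\mu_h(x,y)}{\mu_{gh}(x,y)},$$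 $$\frac{c({}^gx,{}^gy)}{c(x,y)}=\frac{\mu_g(xyx^{-1},x)}{\mu_g(x,y)}\cdot\frac{\gamma_{g\partial(x)g^{-1},g}(y)}{\gamma_{g,\partial(x)}(y)},$$ $$c(xy,z)=\frac{\omega(x,y,z)\,\omega((xy)z(xy)^{-1},x,y)}{\omega(x,yzy^{-1},y)\,\gamma_{\partial(x),\partial(y)}(z)}\,c(x,yzy^{-1})\,c(y,z),$$ $$c(x,yz)=\frac{\omega(xyx^{-1},x,z)}{\omega(x,y,z)\,\omega(xyx^{-1},xzx^{-1},x)\,\mu_{\partial(x)}(y,z)}\,c(x,y)\,c(x,z).$$ The subgroup $B^3_{qa}(\mathcal X,\mathbb K^\times)$ consists of the quadruples $$\omega(x,y,z)=\frac{\eta(y,z)\eta(x,yz)}{\eta(xy,z)\eta(x,y)},\quad \gamma_{g,h}(x)=\frac{\beta_h(x)\beta_g({}^hx)}{\beta_{gh}(x)},\quad \mu_g(x,y)=\frac{\beta_g(x)\beta_g(y)}{\beta_g(xy)}\cdot\frac{\eta({}^gx,{}^gy)}{\eta(x,y)},\quad c(x,y)=\beta_{\partial(x)}(y)\frac{\eta(xyx^{-1},x)}{\eta(x,y)}$$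 with $\eta:X^2\to\mathbb K^\times$ and $\beta:G\times X\to\mathbb K^\times$ arbitrary, and $H^3_{qa}(\mathcal X,\mathbb K^\times)=Z^3_{qa}/B^3_{qa}$. The group $\mathrm{Aut}(\mathcal X)$ acts on $H^3_{qa}(\mathcal X,\mathbb K^\times)$ by pull-back of cocycles (along inverses, so that the action is a left action). **The category $\mathcal C(\xi)$.** For $\xi=(\omega,\gamma,\mu,c)\in Z^3_{qa}(\mathcal X,\mathbb K^\times)$ let $\mathcal C(\xi)$ be the following crossed pointed category with group $G$. The underlying fusion category is $\mathrm{Vec}_X^\omega$: finite dimensional $X$-graded $\mathbb K$-vector spaces with the usual graded tensor product, associator $(u\otimes v)\otimes w\mapsto\omega(x,y,z)\,u\otimes(v\otimes w)$ and unit constraints $1\otimes v\mapsto\omega(e,e,x)^{-1}v$ and $v\otimes 1\mapsto\omega(x,e,e)v$. Its component of degree $g$ consists of the objects supported on $\partial^{-1}(g)$; $T_g(V)=V$ with degrees changed by $x\mapsto{}^gx$; and the remaining structure is, on homogeneous objects of degrees $x,y$: multiplication by $\gamma_{g,h}(x)$ for $T_{gh}\to T_gT_h$, by $\gamma_{e,e}(x)^{-1}$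 for $T_e\to\mathrm{id}$, by $\mu_g(x,y)$ for $T_g(V\otimes W)\to T_g(V)\otimes T_g(W)$, by $\mu_g(e,e)^{-1}$ for $T_g(\mathbb K)\to\mathbb K$, and the $G$-braiding $v\otimes w\mapsto c(x,y)\,w\otimes v$. **Theorem.** Equivalence of crossed pointed categories over $\mathbb K$ is an equivalence relation, and $(\mathcal X,[\xi])\mapsto\mathcal C(\xi)$ induces a bijection from - the set of pairs $(\mathcal X,O)$, where $\mathcal X$ is a finite crossed module and $O$ is an $\mathrm{Aut}(\mathcal X)$-orbit in $H^3_{qa}(\mathcal X,\mathbb K^\times)$, two pairs being identified if an isomorphism of crossed modules carries one orbit to the other, onto - the set of equivalence classes of crossed pointed categories over $\mathbb K$. In particular, for cocycles $\xi,\xi'$ on the same $\mathcal X$, $\mathcal C(\xi)$ and $\mathcal C(\xi')$ are equivalent if and only if the classes of $\xi$ and $\xi'$ lie in the same $\mathrm{Aut}(\mathcal X)$-orbit; and every crossed pointed category over $\mathbb K$ is equivalent to $\mathcal C(\xi)$ for some finite crossed module $\mathcal X$ and some $\xi\in Z^3_{qa}(\mathcal X,\mathbb K^\times)$. -/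

import Mathlib

open CategoryTheory MonoidalCategory Limits TensorProduct

universe a b w v u v' u'

namespace CrossedPointed

noncomputable section

/-! ### Gradings of vector spaces by finite sets -/

/-- A grading `M = ⨁ i, M_i` of a vector space by a finite set `I`, recorded by the projections
onto the homogeneous components. -/
@[ext]
structure Grading (K : Type w) [Field K] (I : Type a) [Fintype I] [DecidableEq I]
    (M : Type v) [AddCommGroup M] [Module K M] where
  proj : I → M →ₗ[K] M
  proj_proj : ∀ i j m, proj i (proj j m) = if i = j then proj j m else 0
  sum_proj : ∀ m, ∑ i, proj i m = m

namespace Grading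

variable {K : Type w} [Field K] {I : Type a} [Fintype I] [DecidableEq I]
  {J : Type b} [Fintype J] [DecidableEq J]
  {M : Type v} [AddCommGroup M] [Module K M] {N : Type u} [AddCommGroup N] [Module K N]

/-- `m` is homogeneous of degree `i`. -/
def IsHom (d : Grading K I M) (i : I) (m : M) : Prop := d.proj i m = m

theorem isHom_proj (d : Grading K I M) (i : I) (m : M) : d.IsHom i (d.proj i m) := by
  simp [IsHom, d.proj_proj]

theorem IsHom.proj_eq {d : Grading K I M} {i : I} {m : M} (h : d.IsHom i m) (j : I) :
    d.proj j m = if j = i then m else 0 := by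
  rw [← h, d.proj_proj]

theorem IsHom.zero (d : Grading K I M) (i : I) : d.IsHom i 0 := by simp [IsHom]

theorem IsHom.smul {d : Grading K I M} {i : I} {m : M} (h : d.IsHom i m) (r : K) :
    d.IsHom i (r • m) := by
  have : d.proj i m = m := h
  simp [IsHom, this]

theorem induction (d : Grading K I M) {P : M → Prop} (h0 : P 0)
    (hadd : ∀ x y, P x → P y → P (x + y)) (hh : ∀ i m, d.IsHom i m → P m) (m : M) : P m := by
  rw [← d.sum_proj m]
  exact Finset.sum_induction _ P hadd h0 (fun i _ => hh i _ (d.isHom_proj i m))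

theorem hom_ext (d : Grading K I M) {f g : M →ₗ[K] N} (h : ∀ i m, d.IsHom i m → f m = g m) :
    f = g := by
  ext m
  refine d.induction (P := fun m => f m = g m) (by simp) (fun x y hx hy => by simp [hx, hy]) h m

/-- A family of maps which acts on every homogeneous vector for `d` as the projections of a grading
with degrees shifted along `f` is a grading. -/
def ofHom (d : Grading K I M) (f : I → J) (p : J → M →ₗ[K] M)
    (hp : ∀ i m, d.IsHom i m → ∀ j, p j m = if j = f i then m else 0) : Grading K J M where
  proj := p
  proj_proj i j m := by
    refine d.induction (P := fun m => p i (p j m) = if i = j then p j m else 0) (by simp)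
      (fun x y hx hy => ?_) (fun k m hk => ?_) m
    · simp only [map_add, hx, hy]; split_ifs <;> simp
    · rw [hp k m hk j]
      by_cases h : j = f k
      · subst h; simp [hp k m hk]
      · simp [h]
  sum_proj m := by
    refine d.induction (P := fun m => ∑ i, p i m = m) (by simp)
      (fun x y hx hy => by simp [Finset.sum_add_distrib, hx, hy]) (fun k m hk => ?_) m
    simp [hp k m hk]

/-- The grading by `J` obtained by relabelling the degrees along `f : I → J`. -/
def map (d : Grading K I M) (f : I → J) : Grading K J M :=
  d.ofHom f (fun j => ∑ i, if f i = j then d.proj i else 0) (fun i m hm j => by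
    have : ∀ k, (if f k = j then d.proj k else 0) m = if k = i then (if j = f i then m else 0)
        else 0 := by
      intro k
      by_cases hk : k = i
      · subst hk
        by_cases hj : f k = j
        · subst hj; simp [hm.proj_eq]
        · simp [hj, Ne.symm hj]
      · by_cases hj : f k = j <;> simp [hj, hk, hm.proj_eq]
    simp [LinearMap.sum_apply, this])

theorem IsHom.map {d : Grading K I M} {i : I} {m : M} (h : d.IsHom i m) (f : I → J) :
    (d.map f).IsHom (f i) m := by
  have : ∀ k, (if f k = f i then d.proj k else 0) m = if k = i then m else 0 := by
    intro k
    by_cases hk : k = i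
    · subst hk; simp [h.proj_eq]
    · by_cases hj : f k = f i <;> simp [hj, hk, h.proj_eq]
  simp [IsHom, Grading.map, ofHom, LinearMap.sum_apply, this]

/-- The grading of `M ⊗ N` by pairs of degrees. -/
def tensor (d : Grading K I M) (e : Grading K J N) : Grading K (I × J) (M ⊗[K] N) where
  proj q := TensorProduct.map (d.proj q.1) (e.proj q.2)
  proj_proj p q t := by
    induction t with
    | zero => simp
    | add x y hx hy => simp only [map_add, hx, hy]; split_ifs <;> simp
    | tmul m n =>
      simp only [TensorProduct.map_tmul, d.proj_proj, e.proj_proj, Prod.ext_iff]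
      split_ifs <;> simp_all
  sum_proj t := by
    induction t with
    | zero => simp
    | add x y hx hy => simp only [map_add, Finset.sum_add_distrib, hx, hy]
    | tmul m n =>
      simp only [TensorProduct.map_tmul, Fintype.sum_prod_type]
      simp only [← TensorProduct.tmul_sum, ← TensorProduct.sum_tmul, d.sum_proj, e.sum_proj]

theorem IsHom.tmul {d : Grading K I M} {e : Grading K J N} {i : I} {j : J} {m : M} {n : N}
    (hm : d.IsHom i m) (hn : e.IsHom j n) : (d.tensor e).IsHom (i, j) (m ⊗ₜ n) := by
  have h1 : d.proj i m = m := hm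
  have h2 : e.proj j n = n := hn
  simp [IsHom, tensor, h1, h2]

theorem hom_ext₂ {P : Type*} [AddCommGroup P] [Module K P] (d : Grading K I M) (e : Grading K J N)
    {f g : M ⊗[K] N →ₗ[K] P}
    (h : ∀ i m j n, d.IsHom i m → e.IsHom j n → f (m ⊗ₜ n) = g (m ⊗ₜ n)) : f = g := by
  refine TensorProduct.ext (d.hom_ext fun i m hm => e.hom_ext fun j n hn => ?_)
  exact h i m j n hm hn

/-- The one-dimensional space `K` placed in degree `i`. -/
def single (K : Type w) [Field K] (i : I) : Grading K I K where
  proj j := if j = i then LinearMap.id else 0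
  proj_proj j k m := by
    by_cases h : k = i
    · subst h; by_cases h' : j = k <;> simp [h']
    · by_cases h' : j = i <;> simp [h, h']
  sum_proj m := by
    have : ∀ j, (if j = i then (LinearMap.id : K →ₗ[K] K) else 0) m = if j = i then m else 0 := by
      intro j; split_ifs <;> simp
    simp [this]

theorem isHom_single (i : I) (m : K) : (single K i).IsHom i m := by simp [IsHom, single]

/-- Multiplication by the scalar `s i` on the component of degree `i`. -/
def scal (d : Grading K I M) (s : I → Kˣ) : M →ₗ[K] M := ∑ i, (s i : K) • d.proj i

theorem IsHom.scal {d : Grading K I M} {i : I} {m : M} (h : d.IsHom i m) (s : I → Kˣ) :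
    d.scal s m = (s i : K) • m := by
  simp [Grading.scal, LinearMap.sum_apply, h.proj_eq]

/-- `scal` as a linear automorphism. -/
def scalEquiv (d : Grading K I M) (s : I → Kˣ) : M ≃ₗ[K] M :=
  LinearEquiv.ofLinearMap (d.scal s) (d.scal s⁻¹)
    (d.hom_ext fun i m h => by simp [h.scal]) (d.hom_ext fun i m h => by simp [h.scal])

theorem IsHom.scalEquiv {d : Grading K I M} {i : I} {m : M} (h : d.IsHom i m) (s : I → Kˣ) :
    d.scalEquiv s m = (s i : K) • m := h.scal s

theorem IsHom.scalEquiv_symm {d : Grading K I M} {i : I} {m : M} (h : d.IsHom i m) (s : I → Kˣ) :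
    (d.scalEquiv s).symm m = (((s i)⁻¹ : Kˣ) : K) • m := h.scal s⁻¹

end Grading
/-! ### Finite crossed modules -/

/-- A finite crossed module `(G, X, ∂)`. The action of `G` on `X` is written `g • x`. -/
structure FinCrossedModule : Type (a + 1) where
  G : Type a
  X : Type a
  [groupG : Group G]
  [groupX : Group X]
  [finiteG : Finite G]
  [finiteX : Finite X]
  [action : MulDistribMulAction G X]
  bd : X →* G
  bd_smul : ∀ x x' : X, bd x • x' = x * x' * x⁻¹
  smul_bd : ∀ (g : G) (x : X), bd (g • x) = g * bd x * g⁻¹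

attribute [instance] FinCrossedModule.groupG FinCrossedModule.groupX FinCrossedModule.finiteG
  FinCrossedModule.finiteX FinCrossedModule.action

namespace FinCrossedModule

/-- An isomorphism `(f, F)` of crossed modules. -/
@[ext]
structure Iso (𝒳 𝒴 : FinCrossedModule.{a}) where
  f : 𝒳.G ≃* 𝒴.G
  F : 𝒳.X ≃* 𝒴.X
  bd_F : ∀ x, 𝒴.bd (F x) = f (𝒳.bd x)
  F_smul : ∀ g x, F (g • x) = f g • F x

namespace Iso

variable {𝒳 𝒴 𝒵 : FinCrossedModule.{a}}

def refl (𝒳 : FinCrossedModule.{a}) : Iso 𝒳 𝒳 := ⟨.refl _, .refl _, fun _ => rfl, fun _ _ => rfl⟩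

def trans (φ : Iso 𝒳 𝒴) (ψ : Iso 𝒴 𝒵) : Iso 𝒳 𝒵 :=
  ⟨φ.f.trans ψ.f, φ.F.trans ψ.F, fun x => by simp [ψ.bd_F, φ.bd_F],
    fun g x => by simp [φ.F_smul, ψ.F_smul]⟩

def symm (φ : Iso 𝒳 𝒴) : Iso 𝒴 𝒳 :=
  ⟨φ.f.symm, φ.F.symm, fun x => by
      obtain ⟨y, rfl⟩ := φ.F.surjective x
      simp [φ.bd_F],
    fun g x => by
      obtain ⟨y, rfl⟩ := φ.F.surjective x
      obtain ⟨h, rfl⟩ := φ.f.surjective g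
      simp [← φ.F_smul]⟩

end Iso

/-- The group `Aut 𝒳`, under composition: `(φ * ψ) x = φ (ψ x)`. -/
abbrev Aut (𝒳 : FinCrossedModule.{a}) : Type a := Iso 𝒳 𝒳

instance (𝒳 : FinCrossedModule.{a}) : Group (Aut 𝒳) where
  mul φ ψ := ψ.trans φ
  one := Iso.refl 𝒳
  inv φ := φ.symm
  mul_assoc _ _ _ := rfl
  one_mul _ := rfl
  mul_one _ := rfl
  inv_mul_cancel φ := Iso.ext (by ext x; exact φ.f.symm_apply_apply x)
    (by ext x; exact φ.F.symm_apply_apply x)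

end FinCrossedModule

/-! ### Quasi-abelian third cohomology -/

/-- The group of 3-cocycles on a group `X` with values in `Kˣ`. -/
def Z3 (X : Type a) [Group X] (K : Type w) [Field K] : Subgroup (X → X → X → Kˣ) where
  carrier := {ω | ∀ t x y z, ω x y z * ω t (x * y) z * ω t x y = ω t x (y * z) * ω (t * x) y z}
  one_mem' := by simp
  mul_mem' {ω ω'} h h' t x y z := by
    have := congrArg₂ (· * ·) (h t x y z) (h' t x y z)
    simpa [mul_comm, mul_assoc, mul_left_comm] using this
  inv_mem' {ω} h t x y z := by
    have := congrArg (·⁻¹) (h t x y z)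
    simpa [mul_comm, mul_assoc, mul_left_comm] using this

section Cohomology

variable (𝒳 : FinCrossedModule.{a}) (K : Type w) [Field K]

/-- Quadruples `(ω, γ, μ, c)` of cochains on a crossed module, with
`ω ∈ C³(X, Kˣ)`, `γ ∈ C²(G, C¹(X, Kˣ))`, `μ ∈ C¹(G, C²(X, Kˣ))`, `c ∈ C²(X, Kˣ)`. -/
abbrev Cochain : Type (max a w) :=
  (𝒳.X → 𝒳.X → 𝒳.X → Kˣ) × (𝒳.G → 𝒳.G → 𝒳.X → Kˣ) × (𝒳.G → 𝒳.X → 𝒳.X → Kˣ) ×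
    (𝒳.X → 𝒳.X → Kˣ)

variable {𝒳 K}

def Cochain.ω (ξ : Cochain 𝒳 K) : 𝒳.X → 𝒳.X → 𝒳.X → Kˣ := ξ.1
def Cochain.γ (ξ : Cochain 𝒳 K) : 𝒳.G → 𝒳.G → 𝒳.X → Kˣ := ξ.2.1
def Cochain.μ (ξ : Cochain 𝒳 K) : 𝒳.G → 𝒳.X → 𝒳.X → Kˣ := ξ.2.2.1
def Cochain.c (ξ : Cochain 𝒳 K) : 𝒳.X → 𝒳.X → Kˣ := ξ.2.2.2

namespace Cochain

variable (ξ ξ' : Cochain 𝒳 K)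

@[simp] theorem ω_one : (1 : Cochain 𝒳 K).ω = 1 := rfl
@[simp] theorem γ_one : (1 : Cochain 𝒳 K).γ = 1 := rfl
@[simp] theorem μ_one : (1 : Cochain 𝒳 K).μ = 1 := rfl
@[simp] theorem c_one : (1 : Cochain 𝒳 K).c = 1 := rfl
@[simp] theorem ω_mul : (ξ * ξ').ω = ξ.ω * ξ'.ω := rfl
@[simp] theorem γ_mul : (ξ * ξ').γ = ξ.γ * ξ'.γ := rfl
@[simp] theorem μ_mul : (ξ * ξ').μ = ξ.μ * ξ'.μ := rfl
@[simp] theorem c_mul : (ξ * ξ').c = ξ.c * ξ'.c := rfl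
@[simp] theorem ω_inv : (ξ⁻¹).ω = (ξ.ω)⁻¹ := rfl
@[simp] theorem γ_inv : (ξ⁻¹).γ = (ξ.γ)⁻¹ := rfl
@[simp] theorem μ_inv : (ξ⁻¹).μ = (ξ.μ)⁻¹ := rfl
@[simp] theorem c_inv : (ξ⁻¹).c = (ξ.c)⁻¹ := rfl

end Cochain

/-- The conditions defining quasi-abelian 3-cocycles. -/
structure IsQuasiAbelian (ξ : Cochain 𝒳 K) : Prop where
  ω_cocycle : ξ.ω ∈ Z3 𝒳.X K
  /-- `γ` is a 2-cocycle on `G` with values in the right `G`-module `C¹(X, Kˣ)`. -/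
  γ_cocycle : ∀ g h k x, ξ.γ h k x * ξ.γ g (h * k) x = ξ.γ g h (k • x) * ξ.γ (g * h) k x
  μ_ω : ∀ g x y z, ξ.μ g y z * ξ.μ g x (y * z) / (ξ.μ g (x * y) z * ξ.μ g x y) =
    ξ.ω (g • x) (g • y) (g • z) / ξ.ω x y z
  γ_μ : ∀ g h x y, ξ.γ g h x * ξ.γ g h y / ξ.γ g h (x * y) =
    ξ.μ g (h • x) (h • y) * ξ.μ h x y / ξ.μ (g * h) x y
  c_smul : ∀ g x y, ξ.c (g • x) (g • y) / ξ.c x y =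
    ξ.μ g (x * y * x⁻¹) x / ξ.μ g x y * (ξ.γ (g * 𝒳.bd x * g⁻¹) g y / ξ.γ g (𝒳.bd x) y)
  c_mul_left : ∀ x y z, ξ.c (x * y) z =
    ξ.ω x y z * ξ.ω (x * y * z * (x * y)⁻¹) x y /
      (ξ.ω x (y * z * y⁻¹) y * ξ.γ (𝒳.bd x) (𝒳.bd y) z) * ξ.c x (y * z * y⁻¹) * ξ.c y z
  c_mul_right : ∀ x y z, ξ.c x (y * z) =
    ξ.ω (x * y * x⁻¹) x z /
      (ξ.ω x y z * ξ.ω (x * y * x⁻¹) (x * z * x⁻¹) x * ξ.μ (𝒳.bd x) y z) * ξ.c x y * ξ.c x z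

variable (𝒳 K)

/-- The group of quasi-abelian 3-cocycles, under pointwise multiplication. -/
def Zqa : Subgroup (Cochain 𝒳 K) where
  carrier := {ξ | IsQuasiAbelian ξ}
  one_mem' := by constructor <;> simp [one_mem]
  mul_mem' {ξ ξ'} h h' :=
    { ω_cocycle := mul_mem h.ω_cocycle h'.ω_cocycle
      γ_cocycle := fun g h₁ k x => by
        have := congrArg₂ (· * ·) (h.γ_cocycle g h₁ k x) (h'.γ_cocycle g h₁ k x)
        simpa [mul_comm, mul_assoc, mul_left_comm] using this
      μ_ω := fun g x y z => by
        have := congrArg₂ (· * ·) (h.μ_ω g x y z) (h'.μ_ω g x y z)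
        simpa [div_eq_mul_inv, mul_comm, mul_assoc, mul_left_comm] using this
      γ_μ := fun g h₁ x y => by
        have := congrArg₂ (· * ·) (h.γ_μ g h₁ x y) (h'.γ_μ g h₁ x y)
        simpa [div_eq_mul_inv, mul_comm, mul_assoc, mul_left_comm] using this
      c_smul := fun g x y => by
        have := congrArg₂ (· * ·) (h.c_smul g x y) (h'.c_smul g x y)
        simp only [Cochain.ω_mul, Cochain.γ_mul, Cochain.μ_mul, Cochain.c_mul, Pi.mul_apply,
          div_eq_mul_inv, mul_inv] at this ⊢
        convert this using 1 <;> ac_rfl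
      c_mul_left := fun x y z => by
        have := congrArg₂ (· * ·) (h.c_mul_left x y z) (h'.c_mul_left x y z)
        simp only [Cochain.ω_mul, Cochain.γ_mul, Cochain.μ_mul, Cochain.c_mul, Pi.mul_apply,
          div_eq_mul_inv, mul_inv] at this ⊢
        convert this using 1; ac_rfl
      c_mul_right := fun x y z => by
        have := congrArg₂ (· * ·) (h.c_mul_right x y z) (h'.c_mul_right x y z)
        simp only [Cochain.ω_mul, Cochain.γ_mul, Cochain.μ_mul, Cochain.c_mul, Pi.mul_apply,
          div_eq_mul_inv, mul_inv] at this ⊢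
        convert this using 1; ac_rfl }
  inv_mem' {ξ} h :=
    { ω_cocycle := inv_mem h.ω_cocycle
      γ_cocycle := fun g h₁ k x => by
        have := congrArg (·⁻¹) (h.γ_cocycle g h₁ k x)
        simpa [mul_comm, mul_assoc, mul_left_comm] using this
      μ_ω := fun g x y z => by
        have := congrArg (·⁻¹) (h.μ_ω g x y z)
        simpa [div_eq_mul_inv, mul_comm, mul_assoc, mul_left_comm] using this
      γ_μ := fun g h₁ x y => by
        have := congrArg (·⁻¹) (h.γ_μ g h₁ x y)
        simpa [div_eq_mul_inv, mul_comm, mul_assoc, mul_left_comm] using this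
      c_smul := fun g x y => by
        have := congrArg (·⁻¹) (h.c_smul g x y)
        simp only [Cochain.ω_inv, Cochain.γ_inv, Cochain.μ_inv, Cochain.c_inv, Pi.inv_apply,
          div_eq_mul_inv, mul_inv] at this ⊢
        convert this using 1
      c_mul_left := fun x y z => by
        have := congrArg (·⁻¹) (h.c_mul_left x y z)
        simp only [Cochain.ω_inv, Cochain.γ_inv, Cochain.μ_inv, Cochain.c_inv, Pi.inv_apply,
          div_eq_mul_inv, mul_inv] at this ⊢
        convert this using 1
      c_mul_right := fun x y z => by
        have := congrArg (·⁻¹) (h.c_mul_right x y z)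
        simp only [Cochain.ω_inv, Cochain.γ_inv, Cochain.μ_inv, Cochain.c_inv, Pi.inv_apply,
          div_eq_mul_inv, mul_inv] at this ⊢
        convert this using 1 }

/-- The coboundary of `η ∈ C²(X, Kˣ)` and `β ∈ C¹(G, C¹(X, Kˣ))`. -/
def coboundary : (𝒳.X → 𝒳.X → Kˣ) × (𝒳.G → 𝒳.X → Kˣ) →* Cochain 𝒳 K where
  toFun p :=
    (fun x y z => p.1 y z * p.1 x (y * z) / (p.1 (x * y) z * p.1 x y),
      fun g h x => p.2 h x * p.2 g (h • x) / p.2 (g * h) x,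
      fun g x y => p.2 g x * p.2 g y / p.2 g (x * y) * (p.1 (g • x) (g • y) / p.1 x y),
      fun x y => p.2 (𝒳.bd x) y * (p.1 (x * y * x⁻¹) x / p.1 x y))
  map_one' := by ext <;> simp
  map_mul' p q := by
    refine Prod.ext ?_ (Prod.ext ?_ (Prod.ext ?_ ?_)) <;>
    · funext
      simp only [Prod.snd_mul, Prod.fst_mul, Pi.mul_apply, div_eq_mul_inv, mul_inv]
      ac_rfl

/-- The group of coboundaries. -/
def Bqa : Subgroup (Cochain 𝒳 K) := (coboundary 𝒳 K).range

theorem Bqa_le_Zqa : Bqa 𝒳 K ≤ Zqa 𝒳 K := by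
  rintro _ ⟨⟨η, β⟩, rfl⟩
  refine ⟨?_, ?_, ?_, ?_, ?_, ?_, ?_⟩
  · intro t x y z
    simp only [coboundary, MonoidHom.coe_mk, OneHom.coe_mk, Cochain.ω, ← Units.val_inj]
    push_cast
    simp only [mul_assoc]
    field_simp
  · intro g h k x
    simp only [coboundary, MonoidHom.coe_mk, OneHom.coe_mk, Cochain.γ, ← Units.val_inj]
    push_cast
    simp only [mul_assoc, mul_smul]
    field_simp
  · intro g x y z
    simp only [coboundary, MonoidHom.coe_mk, OneHom.coe_mk, Cochain.ω, Cochain.μ, ← Units.val_inj]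
    push_cast
    simp only [mul_assoc, smul_mul']
    field_simp
  · intro g h x y
    simp only [coboundary, MonoidHom.coe_mk, OneHom.coe_mk, Cochain.γ, Cochain.μ, ← Units.val_inj]
    push_cast
    simp only [mul_assoc, smul_mul', mul_smul]
    field_simp
  · intro g x y
    simp only [coboundary, MonoidHom.coe_mk, OneHom.coe_mk, Cochain.γ, Cochain.μ, Cochain.c,
      ← Units.val_inj]
    push_cast
    simp only [mul_assoc, smul_mul', mul_smul, 𝒳.smul_bd, 𝒳.bd_smul, smul_inv', inv_mul_cancel,
      mul_one]
    field_simp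
  · intro x y z
    simp only [coboundary, MonoidHom.coe_mk, OneHom.coe_mk, Cochain.γ, Cochain.ω, Cochain.c,
      ← Units.val_inj]
    push_cast
    simp only [mul_assoc, smul_mul', mul_smul, map_mul, 𝒳.bd_smul, mul_inv_rev, inv_mul_cancel,
      mul_one]
    field_simp
  · intro x y z
    simp only [coboundary, MonoidHom.coe_mk, OneHom.coe_mk, Cochain.μ, Cochain.ω, Cochain.c,
      ← Units.val_inj]
    push_cast
    simp only [mul_assoc, smul_mul', mul_smul, map_mul, 𝒳.bd_smul, mul_inv_rev, inv_mul_cancel,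
      mul_one, inv_mul_cancel_left]
    field_simp

/-- The quasi-abelian third cohomology group. -/
abbrev Hqa : Type (max a w) := Zqa 𝒳 K ⧸ (Bqa 𝒳 K).subgroupOf (Zqa 𝒳 K)

variable {𝒳} {𝒴 𝒵 : FinCrossedModule.{a}}

/-- Pull-back of cochains along an isomorphism of crossed modules. -/
def pullCochain (φ : 𝒳.Iso 𝒴) : Cochain 𝒴 K →* Cochain 𝒳 K where
  toFun ξ := (fun x y z => ξ.ω (φ.F x) (φ.F y) (φ.F z), fun g h x => ξ.γ (φ.f g) (φ.f h) (φ.F x),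
    fun g x y => ξ.μ (φ.f g) (φ.F x) (φ.F y), fun x y => ξ.c (φ.F x) (φ.F y))
  map_one' := rfl
  map_mul' _ _ := rfl

section

variable (φ : 𝒳.Iso 𝒴) (ξ : Cochain 𝒴 K)

@[simp] theorem pullCochain_ω (x y z) :
    (pullCochain K φ ξ).ω x y z = ξ.ω (φ.F x) (φ.F y) (φ.F z) := rfl
@[simp] theorem pullCochain_γ (g h x) :
    (pullCochain K φ ξ).γ g h x = ξ.γ (φ.f g) (φ.f h) (φ.F x) := rfl
@[simp] theorem pullCochain_μ (g x y) :
    (pullCochain K φ ξ).μ g x y = ξ.μ (φ.f g) (φ.F x) (φ.F y) := rfl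
@[simp] theorem pullCochain_c (x y) : (pullCochain K φ ξ).c x y = ξ.c (φ.F x) (φ.F y) := rfl

end

/-- Pull-back of quasi-abelian 3-cocycles. -/
def pullZ (φ : 𝒳.Iso 𝒴) : Zqa 𝒴 K →* Zqa 𝒳 K :=
  ((pullCochain K φ).comp (Zqa 𝒴 K).subtype).codRestrict (Zqa 𝒳 K) fun ξ =>
    { ω_cocycle := fun t x y z => by
        simpa using ξ.2.ω_cocycle (φ.F t) (φ.F x) (φ.F y) (φ.F z)
      γ_cocycle := fun g h k x => by
        simpa [φ.F_smul] using ξ.2.γ_cocycle (φ.f g) (φ.f h) (φ.f k) (φ.F x)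
      μ_ω := fun g x y z => by
        simpa [φ.F_smul] using ξ.2.μ_ω (φ.f g) (φ.F x) (φ.F y) (φ.F z)
      γ_μ := fun g h x y => by
        simpa [φ.F_smul] using ξ.2.γ_μ (φ.f g) (φ.f h) (φ.F x) (φ.F y)
      c_smul := fun g x y => by
        simpa [φ.F_smul, φ.bd_F] using ξ.2.c_smul (φ.f g) (φ.F x) (φ.F y)
      c_mul_left := fun x y z => by
        simpa [φ.F_smul, φ.bd_F] using ξ.2.c_mul_left (φ.F x) (φ.F y) (φ.F z)
      c_mul_right := fun x y z => by
        simpa [φ.F_smul, φ.bd_F] using ξ.2.c_mul_right (φ.F x) (φ.F y) (φ.F z) }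

/-- Pull-back of quasi-abelian cohomology classes. -/
def pullH (φ : 𝒳.Iso 𝒴) : Hqa 𝒴 K →* Hqa 𝒳 K :=
  QuotientGroup.map _ _ (pullZ K φ) fun ξ hξ => by
    obtain ⟨⟨η, β⟩, h⟩ := hξ
    refine ⟨(fun x y => η (φ.F x) (φ.F y), fun g x => β (φ.f g) (φ.F x)), ?_⟩
    change _ = pullCochain K φ ξ.1
    rw [← show _ = ξ.1 from h]
    simp only [coboundary, MonoidHom.coe_mk, OneHom.coe_mk, map_mul, map_inv, φ.F_smul, ← φ.bd_F]
    rfl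

theorem pullH_refl (h : Hqa 𝒳 K) : pullH K (.refl 𝒳) h = h := by
  induction h using QuotientGroup.induction_on with | H ξ => rfl

theorem pullH_trans (φ : 𝒳.Iso 𝒴) (ψ : 𝒴.Iso 𝒵) (h : Hqa 𝒵 K) :
    pullH K (φ.trans ψ) h = pullH K φ (pullH K ψ h) := by
  induction h using QuotientGroup.induction_on with | H ξ => rfl

/-- The natural action of `Aut 𝒳` on cohomology. -/
instance : MulAction 𝒳.Aut (Hqa 𝒳 K) where
  smul φ h := pullH K φ.symm h
  one_smul h := pullH_refl K h
  mul_smul φ ψ h := pullH_trans K φ.symm ψ.symm h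

variable (𝒳) in
/-- The set of orbits of `Aut 𝒳` on `Hqa 𝒳 K`. -/
abbrev Orbits : Type (max a w) := MulAction.orbitRel.Quotient 𝒳.Aut (Hqa 𝒳 K)

variable {K} in
/-- The orbit of the class of a cocycle. -/
def orbitOf (ξ : Zqa 𝒳 K) : Orbits 𝒳 K := Quotient.mk _ (QuotientGroup.mk ξ : Hqa 𝒳 K)

/-- The bijection on orbits induced by an isomorphism of crossed modules. -/
def pullOrbits (φ : 𝒳.Iso 𝒴) : Orbits 𝒴 K → Orbits 𝒳 K :=
  Quotient.map (pullH K φ) fun h h' => by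
    rintro ⟨ψ, rfl⟩
    refine ⟨(φ.trans ψ).trans φ.symm, ?_⟩
    change pullH K ((φ.trans ψ).trans φ.symm).symm (pullH K φ h') = pullH K φ (pullH K ψ.symm h')
    rw [← pullH_trans, ← pullH_trans]
    congr 1
    exact congrArg _ (FinCrossedModule.Iso.ext (by ext; simp [FinCrossedModule.Iso.trans, FinCrossedModule.Iso.symm])
      (by ext; simp [FinCrossedModule.Iso.trans, FinCrossedModule.Iso.symm]))

theorem pullOrbits_refl (o : Orbits 𝒳 K) : pullOrbits K (.refl 𝒳) o = o := by
  induction o using Quotient.inductionOn with | h h => exact congrArg _ (pullH_refl K h)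

theorem pullOrbits_trans (φ : 𝒳.Iso 𝒴) (ψ : 𝒴.Iso 𝒵) (o : Orbits 𝒵 K) :
    pullOrbits K (φ.trans ψ) o = pullOrbits K φ (pullOrbits K ψ o) := by
  induction o using Quotient.inductionOn with | h h => exact congrArg _ (pullH_trans K φ ψ h)

/-- Pairs of a finite crossed module `𝒳` and an `Aut 𝒳`-orbit in `Hqa 𝒳 K`; two such pairs are
identified when an isomorphism of crossed modules carries one orbit to the other. -/
instance pairSetoid : Setoid (Σ 𝒳 : FinCrossedModule.{a}, Orbits 𝒳 K) where
  r p q := ∃ φ : p.1.Iso q.1, pullOrbits K φ q.2 = p.2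
  iseqv :=
    { refl := fun p => ⟨.refl _, pullOrbits_refl K p.2⟩
      symm := fun {p q} ⟨φ, h⟩ => ⟨φ.symm, by
        rw [← h, ← pullOrbits_trans]
        convert pullOrbits_refl K q.2
        exact FinCrossedModule.Iso.ext (by ext; simp [FinCrossedModule.Iso.trans,
          FinCrossedModule.Iso.symm, FinCrossedModule.Iso.refl]) (by ext; simp
            [FinCrossedModule.Iso.trans, FinCrossedModule.Iso.symm, FinCrossedModule.Iso.refl])⟩
      trans := fun {p q r} ⟨φ, h⟩ ⟨ψ, h'⟩ => ⟨φ.trans ψ, by rw [pullOrbits_trans, h', h]⟩ }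

end Cohomology
/-! ### Pointed fusion categories -/

section Fusion

variable (K : Type w) [Field K] (C : Type u) [Category.{v} C]

variable {C} in
/-- `X` is the direct sum of the finite family `Y`. -/
def IsDirectSum [Preadditive C] {J : Type a} (X : C) (Y : J → C) : Prop :=
  ∃ b : Bicone Y, Nonempty b.IsBilimit ∧ Nonempty (X ≅ b.pt)

/-- The preadditive category `C` is abelian. -/
class IsAbelian [Preadditive C] : Prop extends
    HasFiniteProducts C, HasKernels C, HasCokernels C, IsNormalMonoCategory C, IsNormalEpiCategory C

/-- `C` is a fusion category over `K`: a rigid semisimple `K`-linear abelian monoidal category with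
bilinear tensor product, finite dimensional spaces of morphisms, finitely many isomorphism classes
of simple objects, and simple unit object. -/
class IsFusion [Preadditive C] [Linear K C] [MonoidalCategory C] : Prop extends IsAbelian C where
  monoidalPreadditive : MonoidalPreadditive C
  monoidalLinear : MonoidalLinear K C
  finite_hom : ∀ X Y : C, Module.Finite K (X ⟶ Y)
  semisimple : ∀ X : C, ∃ (n : ℕ) (Y : Fin n → C), (∀ i, Simple (Y i)) ∧ IsDirectSum X Y
  finite_simple : ∃ (n : ℕ) (Y : Fin n → C), ∀ X : C, Simple X → ∃ i, Nonempty (X ≅ Y i)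
  simple_unit : Simple (𝟙_ C)
  rigid : Nonempty (RigidCategory C)

/-- All simple objects are invertible. -/
def IsPointed [Preadditive C] [MonoidalCategory C] : Prop :=
  ∀ X : C, Simple X → ∃ Y : C, Nonempty (X ⊗ Y ≅ 𝟙_ C) ∧ Nonempty (Y ⊗ X ≅ 𝟙_ C)

end Fusion

/-! ### Crossed categories -/

/-- A (not necessarily faithful) grading `C = ⨁ C_g` of a monoidal category by a group. -/
structure GroupGrading (C : Type u) [Category.{v} C] [Preadditive C] [MonoidalCategory C]
    (G : Type a) [Group G] where
  /-- The full subcategory `C_g`. -/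
  comp : G → ObjectProperty C
  comp_iso : ∀ g {X Y : C}, (X ≅ Y) → comp g X → comp g Y
  hom_eq_zero : ∀ {g h} {X Y : C}, comp g X → comp h Y → g ≠ h → ∀ f : X ⟶ Y, f = 0
  exists_decomp : ∀ X : C, ∃ Y : G → C, (∀ g, comp g (Y g)) ∧ IsDirectSum X Y
  comp_tensor : ∀ {g h} {X Y : C}, comp g X → comp h Y → comp (g * h) (X ⊗ Y)
  comp_dual : ∀ {g} {X Y : C}, ExactPairing X Y → comp g X → comp g⁻¹ Y

open Functor.OplaxMonoidal in
/-- The structure of a crossed category (braided `G`-crossed category) on a `K`-linear monoidal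
category `C`: a `G`-grading, an action of `G` by monoidal autoequivalences and a `G`-braiding.
The tensor structure `μ_g` and the unit-preserving structure `ν_g` of `T g` are
`δ (T g)` and `η (T g)`. -/
structure CrossedStructure (K : Type w) [Field K] (C : Type u) [Category.{v} C] [Preadditive C]
    [Linear K C] [MonoidalCategory C] (G : Type a) [Group G] extends GroupGrading C G where
  T : G → C ⥤ C
  [T_additive : ∀ g, (T g).Additive]
  [T_linear : ∀ g, (T g).Linear K]
  [T_equivalence : ∀ g, (T g).IsEquivalence]
  [T_monoidal : ∀ g, (T g).Monoidal]
  T_comp : ∀ {g h} {X : C}, comp h X → comp (g * h * g⁻¹) ((T g).obj X)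
  /-- The tensor structure of `g ↦ T g`. -/
  γ : ∀ g h, T (g * h) ≅ T h ⋙ T g
  [γ_monoidal : ∀ g h, NatTrans.IsMonoidal (γ g h).hom]
  /-- The unit-preserving structure of `g ↦ T g`. -/
  ι : T 1 ≅ 𝟭 C
  [ι_monoidal : NatTrans.IsMonoidal ι.hom]
  γ_assoc : ∀ g h k X,
    (γ (g * h) k).hom.app X ≫ (γ g h).hom.app ((T k).obj X) =
      eqToHom (congrArg (fun l => (T l).obj X) (mul_assoc g h k)) ≫
        (γ g (h * k)).hom.app X ≫ (T g).map ((γ h k).hom.app X)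
  γ_one_left : ∀ g X, (γ 1 g).hom.app X ≫ ι.hom.app ((T g).obj X) =
    eqToHom (congrArg (fun l => (T l).obj X) (one_mul g))
  γ_one_right : ∀ g X, (γ g 1).hom.app X ≫ (T g).map (ι.hom.app X) =
    eqToHom (congrArg (fun l => (T l).obj X) (mul_one g))
  /-- The `G`-braiding, for `X` in `C_g`. -/
  c : ∀ g (X : C), comp g X → ∀ Y : C, X ⊗ Y ≅ (T g).obj Y ⊗ X
  c_natural_left : ∀ {g} {X X' : C} (hX : comp g X) (hX' : comp g X') (f : X ⟶ X') (Y : C),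
    f ▷ Y ≫ (c g X' hX' Y).hom = (c g X hX Y).hom ≫ (T g).obj Y ◁ f
  c_natural_right : ∀ {g} {X : C} (hX : comp g X) {Y Y' : C} (f : Y ⟶ Y'),
    X ◁ f ≫ (c g X hX Y').hom = (c g X hX Y).hom ≫ (T g).map f ▷ X
  T_c : ∀ {g h} {X : C} (hX : comp h X) (Y : C),
    δ (T g) X Y ≫ (c (g * h * g⁻¹) ((T g).obj X) (T_comp hX) ((T g).obj Y)).hom ≫
        (γ (g * h * g⁻¹) g).inv.app Y ▷ (T g).obj X ≫
        eqToHom (congrArg (fun l => (T l).obj Y) (inv_mul_cancel_right (g * h) g)) ▷ (T g).obj X ≫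
        (γ g h).hom.app Y ▷ (T g).obj X =
      (T g).map (c h X hX Y).hom ≫ δ (T g) ((T h).obj Y) X
  c_tensor_left : ∀ {g h} {X Y : C} (hX : comp g X) (hY : comp h Y) (Z : C),
    (α_ X Y Z).inv ≫ (c (g * h) (X ⊗ Y) (comp_tensor hX hY) Z).hom ≫
        (γ g h).hom.app Z ▷ (X ⊗ Y) ≫ (α_ ((T g).obj ((T h).obj Z)) X Y).inv =
      X ◁ (c h Y hY Z).hom ≫ (α_ X ((T h).obj Z) Y).inv ≫ (c g X hX ((T h).obj Z)).hom ▷ Y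
  c_tensor_right : ∀ {g} {X : C} (hX : comp g X) (Y Z : C),
    (α_ X Y Z).hom ≫ (c g X hX (Y ⊗ Z)).hom ≫ δ (T g) Y Z ▷ X ≫
        (α_ ((T g).obj Y) ((T g).obj Z) X).hom =
      (c g X hX Y).hom ▷ Z ≫ (α_ ((T g).obj Y) X Z).hom ≫ (T g).obj Y ◁ (c g X hX Z).hom

attribute [instance] CrossedStructure.T_additive CrossedStructure.T_linear
  CrossedStructure.T_equivalence CrossedStructure.T_monoidal CrossedStructure.γ_monoidal
  CrossedStructure.ι_monoidal

open Functor.OplaxMonoidal in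
/-- A crossed tensor functor. The tensor structure and the unit-preserving structure of `F` are
`δ F` and `η F`. -/
structure CrossedFunctor {K : Type w} [Field K] {C : Type u} [Category.{v} C] [Preadditive C]
    [Linear K C] [MonoidalCategory C] {G : Type a} [Group G] (S : CrossedStructure K C G)
    {D : Type u'} [Category.{v'} D] [Preadditive D] [Linear K D] [MonoidalCategory D]
    {H : Type b} [Group H] (S' : CrossedStructure K D H) where
  f : G →* H
  F : C ⥤ D
  [F_additive : F.Additive]
  [F_linear : F.Linear K]
  [F_monoidal : F.Monoidal]
  β : ∀ g, S.T g ⋙ F ≅ F ⋙ S'.T (f g)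
  [β_monoidal : ∀ g, NatTrans.IsMonoidal (β g).hom]
  F_comp : ∀ {g} {X : C}, S.comp g X → S'.comp (f g) (F.obj X)
  F_c : ∀ {g} {X : C} (hX : S.comp g X) (Y : C),
    F.map (S.c g X hX Y).hom ≫ δ F ((S.T g).obj Y) X ≫ (β g).hom.app Y ▷ F.obj X =
      δ F X Y ≫ (S'.c (f g) (F.obj X) (F_comp hX) (F.obj Y)).hom
  β_γ : ∀ g h X,
    F.map ((S.γ g h).hom.app X) ≫ (β g).hom.app ((S.T h).obj X) ≫
        (S'.T (f g)).map ((β h).hom.app X) =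
      (β (g * h)).hom.app X ≫
        eqToHom (congrArg (fun l => (S'.T l).obj (F.obj X)) (map_mul f g h)) ≫
        (S'.γ (f g) (f h)).hom.app (F.obj X)

/-- A crossed tensor functor `(f, F, η, η₀, β)` is an equivalence if `f` is an isomorphism and `F`
is an equivalence. -/
def CrossedFunctor.IsEquivalence {K : Type w} [Field K] {C : Type u} [Category.{v} C]
    [Preadditive C] [Linear K C] [MonoidalCategory C] {G : Type a} [Group G]
    {S : CrossedStructure K C G} {D : Type u'} [Category.{v'} D] [Preadditive D] [Linear K D]
    [MonoidalCategory D] {H : Type b} [Group H] {S' : CrossedStructure K D H}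
    (Φ : CrossedFunctor S S') : Prop :=
  Function.Bijective Φ.f ∧ Φ.F.IsEquivalence

/-- A crossed pointed (fusion) category over `K`. -/
structure CrossedPointedCategory (K : Type w) [Field K] where
  C : Type u
  [category : Category.{v} C]
  [preadditive : Preadditive C]
  [linear : Linear K C]
  [monoidal : MonoidalCategory C]
  fusion : IsFusion K C
  pointed : IsPointed C
  G : Type a
  [group : Group G]
  [finite : Finite G]
  crossed : CrossedStructure K C G

attribute [instance] CrossedPointedCategory.category CrossedPointedCategory.preadditive
  CrossedPointedCategory.linear CrossedPointedCategory.monoidal CrossedPointedCategory.group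
  CrossedPointedCategory.finite

/-- Equivalence of crossed pointed categories. -/
def CrossedEquivalent {K : Type w} [Field K] (𝒞 : CrossedPointedCategory.{a, w, v, u} K)
    (𝒟 : CrossedPointedCategory.{b, w, v', u'} K) : Prop :=
  ∃ Φ : CrossedFunctor 𝒞.crossed 𝒟.crossed, Φ.IsEquivalence

/-! ### The category of `X`-graded vector spaces with associator twisted by a 3-cocycle -/

/-- Finite dimensional `X`-graded vector spaces. The 3-cocycle `ω` only enters through the monoidal
structure below. -/
structure TwVec {K : Type w} [Field K] {X : Type a} [Group X] [Fintype X] [DecidableEq X]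
    (ω : Z3 X K) where
  V : Type w
  [addCommGroup : AddCommGroup V]
  [module : Module K V]
  [finite : Module.Finite K V]
  gr : Grading K X V

namespace TwVec

attribute [instance] TwVec.addCommGroup TwVec.module TwVec.finite

variable {K : Type w} [Field K] {X : Type a} [Group X] [Fintype X] [DecidableEq X]
  {ω : Z3 X K}

/-- Linear maps preserving the grading. -/
@[ext]
structure Hom (A B : TwVec ω) where
  lin : A.V →ₗ[K] B.V
  isHom : ∀ x v, A.gr.IsHom x v → B.gr.IsHom x (lin v)

instance : Category.{w} (TwVec ω) where
  Hom A B := Hom A B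
  id A := ⟨LinearMap.id, fun _ _ h => h⟩
  comp f g := ⟨g.lin ∘ₗ f.lin, fun x v h => g.isHom x _ (f.isHom x v h)⟩

@[ext]
theorem hom_ext {A B : TwVec ω} {f g : A ⟶ B} (h : ∀ x v, A.gr.IsHom x v → f.lin v = g.lin v) :
    f = g := Hom.ext (A.gr.hom_ext h)

@[simp] theorem id_lin (A : TwVec ω) : (𝟙 A : A ⟶ A).lin = LinearMap.id := rfl
@[simp] theorem comp_lin {A B D : TwVec ω} (f : A ⟶ B) (g : B ⟶ D) :
    (f ≫ g).lin = g.lin ∘ₗ f.lin := rfl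

theorem lin_proj {A B : TwVec ω} (f : A ⟶ B) (x : X) (v : A.V) :
    f.lin (A.gr.proj x v) = B.gr.proj x (f.lin v) := by
  refine A.gr.induction (P := fun v => f.lin (A.gr.proj x v) = B.gr.proj x (f.lin v)) (by simp)
    (fun v v' h h' => by simp [h, h']) (fun y v h => ?_) v
  rw [h.proj_eq, (f.isHom y v h).proj_eq]
  split_ifs <;> simp

section Linear

theorem _root_.CrossedPointed.Grading.IsHom.add {I : Type*} [Fintype I] [DecidableEq I] {M : Type*}
    [AddCommGroup M] [Module K M] {d : Grading K I M} {i : I} {m n : M} (h : d.IsHom i m)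
    (h' : d.IsHom i n) : d.IsHom i (m + n) := by
  have h1 : d.proj i m = m := h
  have h2 : d.proj i n = n := h'
  simp [Grading.IsHom, h1, h2]

variable (A B : TwVec ω)

/-- The space of morphisms, as a subspace of the space of linear maps. -/
def homSubmodule : Submodule K (A.V →ₗ[K] B.V) where
  carrier := {f | ∀ x v, A.gr.IsHom x v → B.gr.IsHom x (f v)}
  add_mem' h h' x v hv := (h x v hv).add (h' x v hv)
  zero_mem' x _ _ := .zero _ _
  smul_mem' r _ h x v hv := (h x v hv).smul r

/-- Morphisms as elements of `homSubmodule`. -/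
def homEquiv : (A ⟶ B) ≃ homSubmodule A B where
  toFun f := ⟨f.lin, f.isHom⟩
  invFun f := ⟨f.1, f.2⟩

instance : AddCommGroup (A ⟶ B) := (homEquiv A B).addCommGroup
instance : Module K (A ⟶ B) := (homEquiv A B).module K

variable {A B}

@[simp] theorem zero_lin : (0 : A ⟶ B).lin = 0 := rfl
@[simp] theorem add_lin (f g : A ⟶ B) : (f + g).lin = f.lin + g.lin := rfl
@[simp] theorem neg_lin (f : A ⟶ B) : (-f).lin = -f.lin := rfl
@[simp] theorem sub_lin (f g : A ⟶ B) : (f - g).lin = f.lin - g.lin := rfl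
@[simp] theorem smul_lin (r : K) (f : A ⟶ B) : (r • f).lin = r • f.lin := rfl

end Linear

instance : Preadditive (TwVec ω) where
  add_comp _ _ _ _ _ _ := by ext; simp
  comp_add _ _ _ _ _ _ := by ext; simp

instance : Linear K (TwVec ω) where
  smul_comp _ _ _ _ _ _ := by ext; simp
  comp_smul _ _ _ _ _ _ := by ext; simp

/-- An isomorphism from a linear equivalence preserving degrees. -/
@[simps]
def isoMk {A B : TwVec ω} (e : A.V ≃ₗ[K] B.V)
    (h : ∀ x v, A.gr.IsHom x v → B.gr.IsHom x (e v)) : A ≅ B where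
  hom := ⟨e, h⟩
  inv := ⟨e.symm, fun x v hv => by
    have key : e (A.gr.proj x (e.symm v)) = B.gr.proj x (e (e.symm v)) :=
      lin_proj (⟨e, h⟩ : A ⟶ B) x (e.symm v)
    have hv' : B.gr.proj x v = v := hv
    rw [e.apply_symm_apply, hv'] at key
    exact e.injective (by simpa using key)⟩
  hom_inv_id := by ext; simp
  inv_hom_id := by ext; simp

/-! The monoidal structure. -/

/-- The tensor product: `V ⊗ W` with `deg (v ⊗ w) = deg v * deg w`. -/
def tens (A B : TwVec ω) : TwVec ω where
  V := A.V ⊗[K] B.V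
  gr := (A.gr.tensor B.gr).map fun p => p.1 * p.2

/-- Pure tensors. -/
def tm {A B : TwVec ω} : A.V →ₗ[K] B.V →ₗ[K] (tens A B).V := TensorProduct.mk K A.V B.V

/-- The one dimensional space `K` of degree `x`. -/
def line (ω : Z3 X K) (x : X) : TwVec ω where
  V := K
  gr := .single K x

/-- The basis vector `1 ∈ K` of `line ω x`. -/
def e (ω : Z3 X K) (x : X) : (line ω x).V := (1 : K)

theorem e_isHom (x : X) : (line ω x).gr.IsHom x (e ω x) := Grading.isHom_single x 1

section Ext

variable {A B D E : TwVec ω} {P : Type*} [AddCommGroup P] [Module K P]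

theorem line_ext {x : X} {f g : (line ω x).V →ₗ[K] P} (h : f (e ω x) = g (e ω x)) : f = g :=
  LinearMap.ext_ring (R := K) (f := f) (g := g) h

theorem tm_isHom {x y : X} {v : A.V} {w : B.V} (hv : A.gr.IsHom x v) (hw : B.gr.IsHom y w) :
    (tens A B).gr.IsHom (x * y) (tm v w) :=
  (hv.tmul hw).map fun p => p.1 * p.2

theorem tm_ext {f g : (tens A B).V →ₗ[K] P} (h : ∀ v w, f (tm v w) = g (tm v w)) : f = g :=
  TensorProduct.ext' (R := K) (M := A.V) (N := B.V) h

theorem lin_ext₂ {f g : (tens A B).V →ₗ[K] P}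
    (h : ∀ x v y w, A.gr.IsHom x v → B.gr.IsHom y w → f (tm v w) = g (tm v w)) : f = g :=
  A.gr.hom_ext₂ B.gr h

theorem lin_ext₃ {f g : (tens (tens A B) D).V →ₗ[K] P}
    (h : ∀ x v y w z u, A.gr.IsHom x v → B.gr.IsHom y w → D.gr.IsHom z u →
      f (tm (tm v w) u) = g (tm (tm v w) u)) : f = g := by
  refine tm_ext fun t u => ?_
  revert t
  refine D.gr.induction (P := fun u => ∀ t, f (tm t u) = g (tm t u)) (by simp)
    (fun u u' h h' t => by simp [h, h']) (fun z u hu => ?_) u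
  refine LinearMap.congr_fun (f := f ∘ₗ tm.flip u) (g := g ∘ₗ tm.flip u) ?_
  exact lin_ext₂ fun x v y w hv hw => h x v y w z u hv hw hu

theorem lin_ext₃' {f g : (tens A (tens B D)).V →ₗ[K] P}
    (h : ∀ x v y w z u, A.gr.IsHom x v → B.gr.IsHom y w → D.gr.IsHom z u →
      f (tm v (tm w u)) = g (tm v (tm w u))) : f = g := by
  refine tm_ext fun v => ?_
  refine A.gr.induction (P := fun v => ∀ t, f (tm v t) = g (tm v t)) (by simp)
    (fun u u' h h' t => by simp [h, h']) (fun x v hv => ?_) v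
  refine LinearMap.congr_fun (f := f ∘ₗ tm v) (g := g ∘ₗ tm v) ?_
  exact lin_ext₂ fun y w z u hw hu => h x v y w z u hv hw hu

theorem lin_ext₄ {f g : (tens (tens (tens A B) D) E).V →ₗ[K] P}
    (h : ∀ x v y w z u t s, A.gr.IsHom x v → B.gr.IsHom y w → D.gr.IsHom z u → E.gr.IsHom t s →
      f (tm (tm (tm v w) u) s) = g (tm (tm (tm v w) u) s)) : f = g := by
  refine tm_ext fun t u => ?_
  revert t
  refine E.gr.induction (P := fun u => ∀ t, f (tm t u) = g (tm t u)) (by simp)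
    (fun u u' h h' t => by simp [h, h']) (fun t s hs => ?_) u
  refine LinearMap.congr_fun (f := f ∘ₗ tm.flip s) (g := g ∘ₗ tm.flip s) ?_
  exact lin_ext₃ fun x v y w z u hv hw hu => h x v y w z u t s hv hw hu hs

/-- A linear map on a tensor product preserves degrees if it does so on homogeneous pure
tensors. -/
theorem isHom_of_tm (f : (tens A B).V →ₗ[K] E.V)
    (h : ∀ x v y w, A.gr.IsHom x v → B.gr.IsHom y w → E.gr.IsHom (x * y) (f (tm v w))) :
    ∀ z t, (tens A B).gr.IsHom z t → E.gr.IsHom z (f t) := by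
  intro z t ht
  have key : f ∘ₗ (tens A B).gr.proj z = E.gr.proj z ∘ₗ f := by
    refine lin_ext₂ fun x v y w hv hw => ?_
    simp only [LinearMap.comp_apply]
    rw [(tm_isHom hv hw).proj_eq, (h x v y w hv hw).proj_eq]
    split_ifs <;> simp
  have := LinearMap.congr_fun key t
  have ht' : (tens A B).gr.proj z t = t := ht
  simp only [LinearMap.comp_apply, ht'] at this
  exact this.symm

theorem isHom_of_tm₃ (f : (tens (tens A B) D).V →ₗ[K] E.V)
    (h : ∀ x v y w z u, A.gr.IsHom x v → B.gr.IsHom y w → D.gr.IsHom z u →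
      E.gr.IsHom (x * y * z) (f (tm (tm v w) u))) :
    ∀ z t, (tens (tens A B) D).gr.IsHom z t → E.gr.IsHom z (f t) := by
  intro z t ht
  have key : f ∘ₗ (tens (tens A B) D).gr.proj z = E.gr.proj z ∘ₗ f := by
    refine lin_ext₃ fun x v y w z' u hv hw hu => ?_
    simp only [LinearMap.comp_apply]
    rw [(tm_isHom (tm_isHom hv hw) hu).proj_eq, (h x v y w z' u hv hw hu).proj_eq]
    split_ifs <;> simp
  have := LinearMap.congr_fun key t
  have ht' : (tens (tens A B) D).gr.proj z t = t := ht
  simp only [LinearMap.comp_apply, ht'] at this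
  exact this.symm

end Ext

section Constraints

variable {A B D A' B' : TwVec ω}

/-- The tensor product of morphisms. -/
def tensHom (f : A ⟶ A') (g : B ⟶ B') : tens A B ⟶ tens A' B' :=
  ⟨TensorProduct.map f.lin g.lin, isHom_of_tm (E := tens A' B') _ fun _ _ _ _ hv hw =>
    tm_isHom (f.isHom _ _ hv) (g.isHom _ _ hw)⟩

variable (A B D) in
/-- The linear isomorphism `(u ⊗ v) ⊗ w ↦ ω(x, y, z) u ⊗ (v ⊗ w)` for `u, v, w` homogeneous of
degrees `x, y, z`. -/
def assocEquiv : (tens (tens A B) D).V ≃ₗ[K] (tens A (tens B D)).V :=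
  (((A.gr.tensor B.gr).tensor D.gr).scalEquiv fun q => ω.1 q.1.1 q.1.2 q.2).trans
    (TensorProduct.assoc K A.V B.V D.V)

theorem assocEquiv_tm {x y z v w u} (hv : A.gr.IsHom x v) (hw : B.gr.IsHom y w)
    (hu : D.gr.IsHom z u) :
    assocEquiv A B D (tm (tm v w) u) = (ω.1 x y z : K) • tm v (tm w u) := by
  have : TensorProduct.assoc K A.V B.V D.V
      ((((A.gr.tensor B.gr).tensor D.gr).scalEquiv fun q => ω.1 q.1.1 q.1.2 q.2)
        ((v ⊗ₜ[K] w) ⊗ₜ[K] u)) = (ω.1 x y z : K) • v ⊗ₜ[K] (w ⊗ₜ[K] u) := by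
    rw [((hv.tmul hw).tmul hu).scalEquiv, map_smul, TensorProduct.assoc_tmul]
  exact this

variable (A) in
/-- The linear isomorphism `1 ⊗ v ↦ ω(e, e, x)⁻¹ v`. -/
def lidEquiv : (tens (line ω 1) A).V ≃ₗ[K] A.V :=
  (TensorProduct.lid K A.V).trans (A.gr.scalEquiv fun x => (ω.1 1 1 x)⁻¹)

theorem lidEquiv_tm {x v} (hv : A.gr.IsHom x v) :
    lidEquiv A (tm (e ω 1) v) = (((ω.1 1 1 x)⁻¹ : Kˣ) : K) • v := by
  have : (A.gr.scalEquiv fun x => (ω.1 1 1 x)⁻¹) (TensorProduct.lid K A.V ((1 : K) ⊗ₜ[K] v)) =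
      (((ω.1 1 1 x)⁻¹ : Kˣ) : K) • v := by
    rw [TensorProduct.lid_tmul, one_smul, hv.scalEquiv]
  exact this

variable (A) in
/-- The linear isomorphism `v ⊗ 1 ↦ ω(x, e, e) v`. -/
def ridEquiv : (tens A (line ω 1)).V ≃ₗ[K] A.V :=
  (TensorProduct.rid K A.V).trans (A.gr.scalEquiv fun x => ω.1 x 1 1)

theorem ridEquiv_tm {x v} (hv : A.gr.IsHom x v) :
    ridEquiv A (tm v (e ω 1)) = (ω.1 x 1 1 : K) • v := by
  have : (A.gr.scalEquiv fun x => ω.1 x 1 1) (TensorProduct.rid K A.V (v ⊗ₜ[K] (1 : K))) =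
      (ω.1 x 1 1 : K) • v := by
    rw [TensorProduct.rid_tmul, one_smul, hv.scalEquiv]
  exact this

theorem line_eq_smul {x : X} (v : (line ω x).V) : ∃ r : K, v = r • e ω x :=
  ⟨v, (mul_one (M := K) v).symm⟩

theorem line_isHom {x y : X} {v : (line ω x).V} (h : (line ω x).gr.IsHom y v) : y = x ∨ v = 0 := by
  by_cases hy : y = x
  · exact Or.inl hy
  · refine Or.inr ?_
    obtain ⟨r, rfl⟩ := line_eq_smul v
    have := ((e_isHom (ω := ω) x).smul r).proj_eq y
    rw [if_neg hy] at this
    rw [← this]; exact h.symm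

instance : MonoidalCategoryStruct (TwVec ω) where
  tensorObj := tens
  tensorHom := tensHom
  whiskerLeft A _ _ f := tensHom (𝟙 A) f
  whiskerRight f B := tensHom f (𝟙 B)
  tensorUnit := line ω 1
  associator A B D := isoMk (assocEquiv A B D)
    (isHom_of_tm₃ (E := tens A (tens B D)) (assocEquiv A B D).toLinearMap
      fun x v y w z u hv hw hu => by
        rw [LinearEquiv.coe_coe, assocEquiv_tm hv hw hu, mul_assoc]
        exact (tm_isHom hv (tm_isHom hw hu)).smul _)
  leftUnitor A := isoMk (lidEquiv A)
    (isHom_of_tm (lidEquiv A).toLinearMap fun x v y w hv hw => by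
      rcases line_isHom hv with rfl | rfl
      · obtain ⟨r, rfl⟩ := line_eq_smul v
        rw [LinearEquiv.coe_coe, map_smul, LinearMap.smul_apply, map_smul, lidEquiv_tm hw, one_mul]
        exact (hw.smul _).smul _
      · simp [Grading.IsHom.zero])
  rightUnitor A := isoMk (ridEquiv A)
    (isHom_of_tm (ridEquiv A).toLinearMap fun x v y w hv hw => by
      rcases line_isHom hw with rfl | rfl
      · obtain ⟨r, rfl⟩ := line_eq_smul w
        rw [LinearEquiv.coe_coe, map_smul, map_smul, ridEquiv_tm hv, mul_one]
        exact (hv.smul _).smul _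
      · simp [Grading.IsHom.zero])

theorem tmul_isHom {x y : X} {v : A.V} {w : B.V} (hv : A.gr.IsHom x v) (hw : B.gr.IsHom y w) :
    (A ⊗ B).gr.IsHom (x * y) (tm v w) := tm_isHom hv hw

variable (ω) in
theorem unit_isHom : (𝟙_ (TwVec ω)).gr.IsHom 1 (e ω 1) := e_isHom 1

theorem tensorHom_tm (f : A ⟶ A') (g : B ⟶ B') (v : A.V) (w : B.V) :
    (f ⊗ₘ g).lin (tm v w) = tm (f.lin v) (g.lin w) := rfl
theorem whiskerLeft_tm (g : B ⟶ B') (v : A.V) (w : B.V) :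
    (A ◁ g).lin (tm v w) = tm v (g.lin w) := rfl
theorem whiskerRight_tm (f : A ⟶ A') (v : A.V) (w : B.V) :
    (f ▷ B).lin (tm v w) = tm (f.lin v) w := rfl

theorem associator_tm {x y z v w u} (hv : A.gr.IsHom x v) (hw : B.gr.IsHom y w)
    (hu : D.gr.IsHom z u) :
    (α_ A B D).hom.lin (tm (tm v w) u) = (ω.1 x y z : K) • tm v (tm w u) :=
  assocEquiv_tm hv hw hu

theorem associator_inv_tm {x y z v w u} (hv : A.gr.IsHom x v) (hw : B.gr.IsHom y w)
    (hu : D.gr.IsHom z u) :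
    (α_ A B D).inv.lin (tm v (tm w u)) = (((ω.1 x y z)⁻¹ : Kˣ) : K) • tm (tm v w) u := by
  refine (assocEquiv A B D).symm_apply_eq.2 ?_
  rw [map_smul, assocEquiv_tm hv hw hu, smul_smul, Units.inv_mul, one_smul]

theorem leftUnitor_tm {x v} (hv : A.gr.IsHom x v) :
    (λ_ A).hom.lin (tm (e ω 1) v) = (((ω.1 1 1 x)⁻¹ : Kˣ) : K) • v :=
  lidEquiv_tm hv

theorem rightUnitor_tm {x v} (hv : A.gr.IsHom x v) :
    (ρ_ A).hom.lin (tm v (e ω 1)) = (ω.1 x 1 1 : K) • v :=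
  ridEquiv_tm hv

end Constraints

section HomExt

variable {A B D F E : TwVec ω}

theorem tensor_hom_ext {f g : A ⊗ B ⟶ E}
    (h : ∀ x v y w, A.gr.IsHom x v → B.gr.IsHom y w → f.lin (tm v w) = g.lin (tm v w)) : f = g :=
  Hom.ext (lin_ext₂ h)

theorem unit_tensor_hom_ext {f g : 𝟙_ (TwVec ω) ⊗ B ⟶ E}
    (h : ∀ y w, B.gr.IsHom y w → f.lin (tm (e ω 1) w) = g.lin (tm (e ω 1) w)) : f = g :=
  tensor_hom_ext fun x v y w hv hw => by
    obtain ⟨r, rfl⟩ := line_eq_smul v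
    simp only [map_smul, LinearMap.smul_apply, h y w hw]

theorem tensor_unit_hom_ext {f g : A ⊗ 𝟙_ (TwVec ω) ⟶ E}
    (h : ∀ x v, A.gr.IsHom x v → f.lin (tm v (e ω 1)) = g.lin (tm v (e ω 1))) : f = g :=
  tensor_hom_ext fun x v y w hv hw => by
    obtain ⟨r, rfl⟩ := line_eq_smul w
    simp only [map_smul, h x v hv]

theorem tensor_hom_ext₃ {f g : (A ⊗ B) ⊗ D ⟶ E}
    (h : ∀ x v y w z u, A.gr.IsHom x v → B.gr.IsHom y w → D.gr.IsHom z u →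
      f.lin (tm (tm v w) u) = g.lin (tm (tm v w) u)) : f = g :=
  Hom.ext (lin_ext₃ h)

theorem tensor_hom_ext₃' {f g : A ⊗ B ⊗ D ⟶ E}
    (h : ∀ x v y w z u, A.gr.IsHom x v → B.gr.IsHom y w → D.gr.IsHom z u →
      f.lin (tm v (tm w u)) = g.lin (tm v (tm w u))) : f = g :=
  Hom.ext (lin_ext₃' h)

theorem tensor_hom_ext₄ {f g : ((A ⊗ B) ⊗ D) ⊗ F ⟶ E}
    (h : ∀ x v y w z u t s, A.gr.IsHom x v → B.gr.IsHom y w → D.gr.IsHom z u → F.gr.IsHom t s →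
      f.lin (tm (tm (tm v w) u) s) = g.lin (tm (tm (tm v w) u) s)) : f = g :=
  Hom.ext (lin_ext₄ h)

end HomExt

theorem ω_triangle (ω : Z3 X K) (x y : X) : ω.1 1 1 y * ω.1 x 1 1 = ω.1 x 1 y := by
  have := ω.2 x 1 1 y
  simp only [one_mul, mul_one] at this
  rw [mul_right_comm, mul_comm (ω.1 x 1 y)] at this
  exact mul_right_cancel (b := ω.1 x 1 y) this

theorem comp_lin_apply {A B D : TwVec ω} (f : A ⟶ B) (g : B ⟶ D) (v : A.V) :
    (f ≫ g).lin v = g.lin (f.lin v) := rfl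

theorem id_lin_apply {A : TwVec ω} (v : A.V) : (𝟙 A : A ⟶ A).lin v = v := rfl

instance : MonoidalCategory (TwVec ω) where
  tensorHom_def f g := tensor_hom_ext fun x v y w hv hw => rfl
  id_tensorHom_id A B := tensor_hom_ext fun x v y w hv hw => rfl
  tensorHom_comp_tensorHom f g f' g' := tensor_hom_ext fun x v y w hv hw => rfl
  whiskerLeft_id A B := tensor_hom_ext fun x v y w hv hw => rfl
  id_whiskerRight A B := tensor_hom_ext fun x v y w hv hw => rfl
  associator_naturality f g h := tensor_hom_ext₃ fun x v y w z u hv hw hu => by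
    rw [comp_lin_apply, comp_lin_apply, associator_tm hv hw hu, map_smul, tensorHom_tm, tensorHom_tm,
      tensorHom_tm, tensorHom_tm, associator_tm (f.isHom _ _ hv) (g.isHom _ _ hw) (h.isHom _ _ hu)]
  leftUnitor_naturality f := unit_tensor_hom_ext fun y w hw => by
    rw [comp_lin_apply, comp_lin_apply, leftUnitor_tm hw, whiskerLeft_tm, leftUnitor_tm (f.isHom _ _ hw),
      map_smul]
  rightUnitor_naturality f := tensor_unit_hom_ext fun x v hv => by
    rw [comp_lin_apply, comp_lin_apply, rightUnitor_tm hv, whiskerRight_tm,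
      rightUnitor_tm (f.isHom _ _ hv), map_smul]
  pentagon A B D E := tensor_hom_ext₄ fun x v y w z u t s hv hw hu hs => by
    simp only [comp_lin_apply]
    rw [whiskerRight_tm, associator_tm hv hw hu, map_smul, LinearMap.smul_apply, map_smul,
      associator_tm hv (tmul_isHom hw hu) hs, map_smul, map_smul, whiskerLeft_tm,
      associator_tm hw hu hs, map_smul, associator_tm (tmul_isHom hv hw) hu hs, map_smul,
      associator_tm hv hw (tmul_isHom hu hs), smul_smul, smul_smul, smul_smul]
    congr 1
    have := congrArg Units.val (ω.2 x y z t)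
    push_cast at this
    linear_combination this
  triangle A B := tensor_hom_ext₃ fun x v y w z u hv hw hu => by
    rcases line_isHom hw with rfl | rfl
    · obtain ⟨r, rfl⟩ := line_eq_smul w
      simp only [comp_lin_apply, map_smul, LinearMap.smul_apply]
      rw [associator_tm hv (unit_isHom ω) hu, map_smul, whiskerLeft_tm, leftUnitor_tm hu,
        whiskerRight_tm, rightUnitor_tm hv, map_smul, map_smul, LinearMap.smul_apply,
        ← ω_triangle]
      simp only [smul_smul]
      congr 1
      push_cast
      field_simp
    · simp

instance : MonoidalPreadditive (TwVec ω) where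
  whiskerLeft_zero := tensor_hom_ext fun x v y w hv hw => by simp [whiskerLeft_tm]
  zero_whiskerRight := tensor_hom_ext fun x v y w hv hw => by simp [whiskerRight_tm]
  whiskerLeft_add f g := tensor_hom_ext fun x v y w hv hw => by simp [whiskerLeft_tm]
  add_whiskerRight f g := tensor_hom_ext fun x v y w hv hw => by simp [whiskerRight_tm]

instance : MonoidalLinear K (TwVec ω) where
  whiskerLeft_smul A _ _ r f := tensor_hom_ext fun x v y w hv hw => by simp [whiskerLeft_tm]
  smul_whiskerRight r _ _ f A := tensor_hom_ext fun x v y w hv hw => by simp [whiskerRight_tm]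

end TwVec

theorem isDirectSum_of {C : Type u} [Category.{v} C] [Preadditive C] {J : Type a} [Finite J] {A : C}
    {Y : J → C} (i : ∀ j, Y j ⟶ A) (p : ∀ j, A ⟶ Y j) (h1 : ∀ j, i j ≫ p j = 𝟙 _)
    (h2 : ∀ j k, j ≠ k → i j ≫ p k = 0)
    (h3 : ∀ _ : Fintype J, ∑ j, p j ≫ i j = 𝟙 A) : IsDirectSum A Y := by
  have := Fintype.ofFinite J
  let b : Bicone Y :=
    { pt := A, π := p, ι := i
      ι_π := fun j k => by
        split_ifs with h
        · subst h; simp [h1]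
        · exact h2 j k h }
  exact ⟨b, ⟨isBilimitOfTotal b (h3 _)⟩, ⟨Iso.refl _⟩⟩

namespace TwVec

variable {K : Type w} [Field K] {X : Type a} [Group X] [Fintype X] [DecidableEq X]
  {ω : Z3 X K}

/-- The image of an endomorphism, as a graded subspace. -/
def image {A : TwVec ω} (p : A ⟶ A) : TwVec ω where
  V := LinearMap.range p.lin
  gr :=
    { proj := fun x => (A.gr.proj x).restrict (by
        rintro _ ⟨v, rfl⟩
        exact ⟨A.gr.proj x v, lin_proj p x v⟩)
      proj_proj := fun x y v => Subtype.ext <| by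
        have := A.gr.proj_proj x y v
        split_ifs with h
        · rw [if_pos h] at this; exact this
        · rw [if_neg h] at this; exact this
      sum_proj := fun v => Subtype.ext <| by
        simp [A.gr.sum_proj] }

/-- The inclusion of the image. -/
def image.ι {A : TwVec ω} (p : A ⟶ A) : image p ⟶ A :=
  ⟨(LinearMap.range p.lin).subtype, fun _ _ h => congrArg Subtype.val h⟩

/-- The corestriction to the image. -/
def image.π {A : TwVec ω} (p : A ⟶ A) : A ⟶ image p :=
  ⟨p.lin.rangeRestrict, fun x v h => Subtype.ext (p.isHom x v h)⟩

theorem image.π_ι {A : TwVec ω} (p : A ⟶ A) : image.π p ≫ image.ι p = p := rfl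

theorem image.ι_π {A : TwVec ω} {p : A ⟶ A} (hp : p ≫ p = p) :
    image.ι p ≫ image.π p = 𝟙 (image p) := by
  refine Hom.ext (LinearMap.ext fun v => Subtype.ext ?_)
  obtain ⟨_, v, rfl⟩ := v
  exact LinearMap.congr_fun (congrArg Hom.lin hp) v

/-- The projection onto the components with degree in a set, as a morphism. -/
def prSet (A : TwVec ω) (S : X → Prop) [DecidablePred S] : A ⟶ A where
  lin := ∑ x, if S x then A.gr.proj x else 0
  isHom x v hv := by
    have : (∑ x, if S x then A.gr.proj x else 0) v = if S x then v else 0 := by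
      rw [LinearMap.sum_apply, Finset.sum_eq_single x]
      · have : A.gr.proj x v = v := hv
        split_ifs <;> simp [this]
      · intro y _ hy
        split_ifs <;> simp [hv.proj_eq, hy]
      · simp
    rw [this]
    split_ifs
    · exact hv
    · exact .zero _ _

theorem prSet_apply {A : TwVec ω} (S : X → Prop) [DecidablePred S] {x : X} {v : A.V}
    (hv : A.gr.IsHom x v) : (prSet A S).lin v = if S x then v else 0 := by
  change (∑ x, if S x then A.gr.proj x else 0) v = _
  rw [LinearMap.sum_apply, Finset.sum_eq_single x]
  · have : A.gr.proj x v = v := hv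
    split_ifs <;> simp [this]
  · intro y _ hy
    split_ifs <;> simp [hv.proj_eq, hy]
  · simp

end TwVec
/-! ### `TwVec ω` is a pointed fusion category -/

/-- A preadditive category in which idempotents split and every morphism has a pseudo-inverse is
abelian as soon as it has finite products. -/
theorem isAbelian_of {C : Type u} [Category.{v} C] [Preadditive C] [HasFiniteProducts C]
    [IsIdempotentComplete C]
    (hs : ∀ {A B : C} (f : A ⟶ B), ∃ s : B ⟶ A, f ≫ s ≫ f = f) : IsAbelian C := by
  have hK : HasKernels C := ⟨fun {A B} f => by
    obtain ⟨s, hs⟩ := hs f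
    obtain ⟨Y, i, p, h1, h2⟩ := IsIdempotentComplete.idempotents_split A (𝟙 A - f ≫ s) (by
      simp [reassoc_of% hs])
    have hi : i ≫ f = 0 := by
      have h3 : i = i ≫ (𝟙 A - f ≫ s) := by rw [← h2, reassoc_of% h1]
      rw [h3]
      simp [hs]
    exact ⟨⟨⟨KernelFork.ofι i hi, KernelFork.IsLimit.ofι _ _ (fun k _ => k ≫ p)
      (fun k hk => by simp [h2, reassoc_of% hk])
      (fun k _ m hm => by rw [← hm, Category.assoc, h1, Category.comp_id])⟩⟩⟩⟩
  have hC : HasCokernels C := ⟨fun {A B} f => by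
    obtain ⟨s, hs⟩ := hs f
    obtain ⟨Y, i, p, h1, h2⟩ := IsIdempotentComplete.idempotents_split B (𝟙 B - s ≫ f) (by
      simp [hs])
    have hi : f ≫ p = 0 := by
      have h3 : p = (𝟙 B - s ≫ f) ≫ p := by rw [← h2, Category.assoc, h1, Category.comp_id]
      rw [h3]
      simp [reassoc_of% hs]
    exact ⟨⟨⟨CokernelCofork.ofπ p hi, CokernelCofork.IsColimit.ofπ _ _ (fun k _ => i ≫ k)
      (fun k hk => by simp [reassoc_of% h2, hk])
      (fun k _ m hm => by rw [← hm, reassoc_of% h1])⟩⟩⟩⟩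
  have hM : IsNormalMonoCategory C := ⟨fun {A B} f _ => by
    obtain ⟨s, hs⟩ := hs f
    have h1 : f ≫ s = 𝟙 A := by
      rw [← cancel_mono f, Category.assoc, hs, Category.id_comp]
    exact ⟨{ Z := B, g := 𝟙 B - s ≫ f
             w := by simp [reassoc_of% h1]
             isLimit := KernelFork.IsLimit.ofι _ _ (fun k _ => k ≫ s)
              (fun k hk => by
                rw [Preadditive.comp_sub, Category.comp_id, sub_eq_zero] at hk
                rw [Category.assoc, ← hk])
              (fun k _ m hm => by rw [← hm, Category.assoc, h1, Category.comp_id]) }⟩⟩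
  have hE : IsNormalEpiCategory C := ⟨fun {A B} f _ => by
    obtain ⟨s, hs⟩ := hs f
    have h1 : s ≫ f = 𝟙 B := by
      rw [← cancel_epi f, hs, Category.comp_id]
    exact ⟨{ W := A, g := 𝟙 A - f ≫ s
             w := by simp [h1]
             isColimit := CokernelCofork.IsColimit.ofπ _ _ (fun k _ => s ≫ k)
              (fun k hk => by
                rw [Preadditive.sub_comp, Category.id_comp, sub_eq_zero, Category.assoc] at hk
                rw [← hk])
              (fun k _ m hm => by rw [← hm, reassoc_of% h1]) }⟩⟩
  exact {}

/-- The dual of a finite direct sum of dualizable objects. -/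
abbrev exactPairingSum {C : Type u} [Category.{v} C] [Preadditive C] [MonoidalCategory C]
    [MonoidalPreadditive C] {J : Type} [Fintype J] [DecidableEq J] {A B : C} {Y Z : J → C}
    (i : ∀ j, Y j ⟶ A) (p : ∀ j, A ⟶ Y j) (i' : ∀ j, Z j ⟶ B) (p' : ∀ j, B ⟶ Z j)
    (h1 : ∀ j, i j ≫ p j = 𝟙 _) (h2 : ∀ j k, j ≠ k → i j ≫ p k = 0) (h3 : ∑ j, p j ≫ i j = 𝟙 A)
    (h1' : ∀ j, i' j ≫ p' j = 𝟙 _) (h2' : ∀ j k, j ≠ k → i' j ≫ p' k = 0)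
    (h3' : ∑ j, p' j ≫ i' j = 𝟙 B) (P : ∀ j, ExactPairing (Y j) (Z j)) : ExactPairing A B where
  coevaluation' := ∑ j, η_ (Y j) (Z j) ≫ (i j ⊗ₘ i' j)
  evaluation' := ∑ j, (p' j ⊗ₘ p j) ≫ ε_ (Y j) (Z j)
  coevaluation_evaluation' := by
    have hT : ∀ l j k, (i' l ▷ 𝟙_ C) ≫ (B ◁ (η_ (Y j) (Z j) ≫ (i j ⊗ₘ i' j))) ≫ (α_ B A B).inv ≫
        (((p' k ⊗ₘ p k) ≫ ε_ (Y k) (Z k)) ▷ B) = (Z l ◁ η_ (Y j) (Z j)) ≫ (α_ _ _ _).inv ≫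
          ((((i' l ≫ p' k) ⊗ₘ (i j ≫ p k)) ≫ ε_ (Y k) (Z k)) ⊗ₘ i' j) := by
      intro l j k
      rw [← whisker_exchange_assoc, MonoidalCategory.whiskerLeft_comp, Category.assoc,
        ← tensorHom_def'_assoc, associator_inv_naturality_assoc, ← tensorHom_id,
        tensorHom_comp_tensorHom, tensorHom_comp_tensorHom_assoc, Category.comp_id]
    have key : ∀ l, (i' l ▷ 𝟙_ C) ≫ (B ◁ (∑ j, η_ (Y j) (Z j) ≫ (i j ⊗ₘ i' j))) ≫
        (α_ B A B).inv ≫ ((∑ k, (p' k ⊗ₘ p k) ≫ ε_ (Y k) (Z k)) ▷ B) =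
        (i' l ▷ 𝟙_ C) ≫ (ρ_ B).hom ≫ (λ_ B).inv := by
      intro l
      rw [whiskerLeft_sum, sum_whiskerRight]
      simp only [Preadditive.comp_sum, Preadditive.sum_comp, hT]
      rw [Finset.sum_eq_single l, Finset.sum_eq_single l]
      · rw [h1, h1', id_tensorHom_id, Category.id_comp, MonoidalCategory.tensorHom_def,
          ExactPairing.coevaluation_evaluation_assoc, rightUnitor_naturality_assoc,
          leftUnitor_inv_naturality]
      · intro j _ hj
        simp [h2 j l hj]
      · simp
      · intro k _ hk
        refine Finset.sum_eq_zero fun j _ => ?_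
        simp [h2' l k hk.symm]
      · simp
    have h4 : ∑ l, (p' l ▷ 𝟙_ C) ≫ (i' l ▷ 𝟙_ C) = 𝟙 _ := by
      simp only [← comp_whiskerRight, ← sum_whiskerRight, h3', id_whiskerRight]
    rw [← Category.id_comp (B ◁ _ ≫ _), ← Category.id_comp ((ρ_ B).hom ≫ _), ← h4]
    simp only [Preadditive.sum_comp, Category.assoc, key]
  evaluation_coevaluation' := by
    have hT : ∀ l j k, (𝟙_ C ◁ i l) ≫ ((η_ (Y j) (Z j) ≫ (i j ⊗ₘ i' j)) ▷ A) ≫ (α_ A B A).hom ≫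
        (A ◁ ((p' k ⊗ₘ p k) ≫ ε_ (Y k) (Z k))) = (η_ (Y j) (Z j) ▷ Y l) ≫ (α_ _ _ _).hom ≫
          (i j ⊗ₘ (((i' j ≫ p' k) ⊗ₘ (i l ≫ p k)) ≫ ε_ (Y k) (Z k))) := by
      intro l j k
      rw [whisker_exchange_assoc, comp_whiskerRight, Category.assoc,
        ← tensorHom_def_assoc, associator_naturality_assoc, ← id_tensorHom,
        tensorHom_comp_tensorHom, tensorHom_comp_tensorHom_assoc, Category.comp_id]
    have key : ∀ l, (𝟙_ C ◁ i l) ≫ ((∑ j, η_ (Y j) (Z j) ≫ (i j ⊗ₘ i' j)) ▷ A) ≫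
        (α_ A B A).hom ≫ (A ◁ (∑ k, (p' k ⊗ₘ p k) ≫ ε_ (Y k) (Z k))) =
        (𝟙_ C ◁ i l) ≫ (λ_ A).hom ≫ (ρ_ A).inv := by
      intro l
      rw [whiskerLeft_sum, sum_whiskerRight]
      simp only [Preadditive.comp_sum, Preadditive.sum_comp, hT]
      rw [Finset.sum_eq_single l, Finset.sum_eq_single l]
      · rw [h1, h1', id_tensorHom_id, Category.id_comp, tensorHom_def',
          ExactPairing.evaluation_coevaluation_assoc, leftUnitor_naturality_assoc,
          rightUnitor_inv_naturality]
      · intro j _ hj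
        simp [h2' j l hj]
      · simp
      · intro k _ hk
        refine Finset.sum_eq_zero fun j _ => ?_
        simp [h2 l k hk.symm]
      · simp
    have h4 : ∑ l, (𝟙_ C ◁ p l) ≫ (𝟙_ C ◁ i l) = 𝟙 _ := by
      simp only [← MonoidalCategory.whiskerLeft_comp, ← whiskerLeft_sum, h3,
        MonoidalCategory.whiskerLeft_id]
    rw [← Category.id_comp (_ ▷ A ≫ _), ← Category.id_comp ((λ_ A).hom ≫ _), ← h4]
    simp only [Preadditive.sum_comp, Category.assoc, key]

namespace TwVec

section Structure

variable {K : Type w} [Field K] {X : Type a} [Group X] [Fintype X] [DecidableEq X]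
  {ω : Z3 X K}

/-- Finite direct sums. -/
def pi {J : Type} [Fintype J] (F : J → TwVec ω) : TwVec ω where
  V := ∀ j, (F j).V
  gr :=
    { proj := fun x => LinearMap.pi fun j => (F j).gr.proj x ∘ₗ LinearMap.proj j
      proj_proj := fun x y v => by
        ext j
        have := (F j).gr.proj_proj x y (v j)
        split_ifs with h
        · rw [if_pos h] at this; exact this
        · rw [if_neg h] at this; exact this
      sum_proj := fun v => by
        ext j
        simpa using (F j).gr.sum_proj (v j) }

open Classical in
instance : HasFiniteBiproducts (TwVec ω) := ⟨fun n => ⟨fun F => by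
  let b : Bicone F :=
    { pt := pi F
      π := fun j => ⟨LinearMap.proj j, fun x v h => congrFun h j⟩
      ι := fun j => ⟨LinearMap.single K (fun j => (F j).V) j, fun x v h => by
        have h' : (F j).gr.proj x v = v := h
        funext k
        change (F k).gr.proj x (Pi.single (M := fun j => (F j).V) j v k) = Pi.single (M := fun j => (F j).V) j v k
        by_cases hk : k = j
        · subst hk; simpa using h'
        · simp [hk]⟩
      ι_π := fun j k => by
        split_ifs with h
        · subst h
          exact Hom.ext (LinearMap.ext fun v => Pi.single_eq_same (M := fun j => (F j).V) j v)
        · refine Hom.ext (LinearMap.ext fun v => ?_)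
          exact Pi.single_eq_of_ne (M := fun j => (F j).V) (Ne.symm h) v }
  refine HasBiproduct.mk ⟨b, isBilimitOfTotal b ?_⟩
  refine Hom.ext (LinearMap.ext fun v => ?_)
  have hs : ∀ s : Finset (Fin n), (∑ j ∈ s, b.π j ≫ b.ι j).lin v =
      ∑ j ∈ s, Pi.single (M := fun j => (F j).V) j (v j) := by
    intro s
    induction s using Finset.induction_on with
    | empty => simp; rfl
    | insert j s hj ih =>
      rw [Finset.sum_insert hj, Finset.sum_insert hj, add_lin, LinearMap.add_apply, ih]
      rfl
  rw [hs]
  exact Finset.univ_sum_single (M := fun j => (F j).V) v⟩⟩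

instance : HasFiniteProducts (TwVec ω) := inferInstance

theorem exists_pinv {A B : TwVec ω} (f : A ⟶ B) : ∃ s : B ⟶ A, f ≫ s ≫ f = f := by
  obtain ⟨r, hr⟩ := f.lin.rangeRestrict.exists_rightInverse_of_surjective f.lin.range_rangeRestrict
  obtain ⟨p, hp⟩ := (LinearMap.range f.lin).subtype.exists_leftInverse_of_injective
    (Submodule.ker_subtype _)
  let g : B.V →ₗ[K] A.V := r ∘ₗ p
  have hg : ∀ v, f.lin (g (f.lin v)) = f.lin v := fun v => by
    have h1 : p (f.lin v) = f.lin.rangeRestrict v := LinearMap.congr_fun hp (f.lin.rangeRestrict v)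
    have h2 := congrArg Subtype.val (LinearMap.congr_fun hr (f.lin.rangeRestrict v))
    change f.lin (r (p (f.lin v))) = _
    rw [h1]
    exact h2
  have hx : ∀ x v, B.gr.IsHom x v →
      (∑ y, A.gr.proj y ∘ₗ g ∘ₗ B.gr.proj y) v = A.gr.proj x (g v) := fun x v hv => by
    rw [LinearMap.sum_apply, Finset.sum_eq_single x]
    · have : B.gr.proj x v = v := hv
      simp [this]
    · intro y _ hy
      simp [hv.proj_eq, hy]
    · simp
  refine ⟨⟨∑ y, A.gr.proj y ∘ₗ g ∘ₗ B.gr.proj y, fun x v hv => ?_⟩, hom_ext fun x v hv => ?_⟩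
  · rw [hx x v hv]
    exact A.gr.isHom_proj _ _
  · rw [comp_lin_apply, comp_lin_apply]
    change f.lin ((∑ y, A.gr.proj y ∘ₗ g ∘ₗ B.gr.proj y) (f.lin v)) = _
    rw [hx x _ (f.isHom x v hv), lin_proj, hg]
    exact f.isHom x v hv

instance : IsIdempotentComplete (TwVec ω) :=
  ⟨fun _ p hp => ⟨image p, image.ι p, image.π p, image.ι_π hp, image.π_ι p⟩⟩

/-- The linear map `K → V` with value `v` at `1`. -/
def vecLin {A : TwVec ω} (x : X) (v : A.V) : (line ω x).V →ₗ[K] A.V :=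
  LinearMap.toSpanSingleton K A.V v

/-- The morphism `line ω x ⟶ A` given by a vector of degree `x`. -/
def ofVec {A : TwVec ω} {x : X} {v : A.V} (hv : A.gr.IsHom x v) : line ω x ⟶ A where
  lin := vecLin x v
  isHom y w hw := by
    rcases line_isHom hw with rfl | rfl
    · exact hv.smul (show K from w)
    · rw [map_zero]; exact .zero _ _

theorem ofVec_e {A : TwVec ω} {x : X} {v : A.V} (hv : A.gr.IsHom x v) :
    (ofVec hv).lin (e ω x) = v := one_smul K v

theorem line_hom_ext {x : X} {A : TwVec ω} {f g : line ω x ⟶ A}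
    (h : f.lin (e ω x) = g.lin (e ω x)) : f = g := Hom.ext (line_ext h)

theorem e_ne_zero (x : X) : e ω x ≠ 0 := one_ne_zero (α := K)

theorem line_end {x : X} (f : line ω x ⟶ line ω x) : ∃ r : K, f = r • 𝟙 _ := by
  obtain ⟨r, hr⟩ := line_eq_smul (f.lin (e ω x))
  exact ⟨r, line_hom_ext hr⟩

theorem id_line_ne_zero (x : X) : 𝟙 (line ω x) ≠ 0 := fun h =>
  e_ne_zero (ω := ω) x (congrArg (fun k => Hom.lin k (e ω x)) h)

instance simple_line (x : X) : Simple (line ω x) where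
  mono_isIso_iff_nonzero {A} f _ := by
    obtain ⟨s, hs⟩ := exists_pinv f
    have h1 : f ≫ s = 𝟙 A := by rw [← cancel_mono f, Category.assoc, hs, Category.id_comp]
    obtain ⟨r, hr⟩ := line_end (s ≫ f)
    constructor
    · rintro h rfl
      exact id_line_ne_zero (ω := ω) x (by rw [← IsIso.inv_hom_id (0 : A ⟶ line ω x), comp_zero])
    · intro h0
      refine ⟨s, h1, ?_⟩
      rw [hr, Linear.comp_smul, Category.comp_id] at hs
      have : (r - 1) • f = 0 := by rw [sub_smul, one_smul, hs, sub_self]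
      rcases smul_eq_zero.1 this with h | h
      · rw [hr, sub_eq_zero.1 h, one_smul]
      · exact absurd h h0

/-- Every object is a direct sum of lines. -/
theorem exists_lines (A : TwVec ω) : ∃ (n : ℕ) (x : Fin n → X) (i : ∀ j, line ω (x j) ⟶ A)
    (p : ∀ j, A ⟶ line ω (x j)), (∀ j, i j ≫ p j = 𝟙 _) ∧ (∀ j k, j ≠ k → i j ≫ p k = 0) ∧
      ∑ j, p j ≫ i j = 𝟙 A := by
  let b := fun x => Module.finBasis K (LinearMap.range (A.gr.proj x))
  let J := Σ x, Fin (Module.finrank K (LinearMap.range (A.gr.proj x)))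
  let q := Fintype.equivFin J
  have hb : ∀ j : J, A.gr.IsHom j.1 (b j.1 j.2 : A.V) := fun j => by
    obtain ⟨v, hv⟩ := (b j.1 j.2).2
    rw [← hv]
    exact A.gr.isHom_proj _ _
  let i : ∀ j : J, line ω j.1 ⟶ A := fun j => ofVec (hb j)
  let p : ∀ j : J, A ⟶ line ω j.1 := fun j =>
    { lin := (b j.1).coord j.2 ∘ₗ (A.gr.proj j.1).rangeRestrict
      isHom := fun x v hv => by
        by_cases h : j.1 = x
        · subst h
          exact Grading.isHom_single _ _
        · have : (A.gr.proj j.1).rangeRestrict v = 0 := Subtype.ext (by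
            change A.gr.proj j.1 v = 0
            rw [hv.proj_eq, if_neg h])
          have h2 : (b j.1).coord j.2 ((A.gr.proj j.1).rangeRestrict v) = 0 := by
            rw [this, map_zero]
          exact (congrArg (fun u : (line ω j.1).V => (line ω j.1).gr.IsHom x u) h2).mpr
            (.zero _ _) }
  have hp : ∀ j v, (p j).lin v = (b j.1).coord j.2 ((A.gr.proj j.1).rangeRestrict v) :=
    fun _ _ => rfl
  have h1 : ∀ j, i j ≫ p j = 𝟙 _ := fun j => line_hom_ext <| by
    rw [comp_lin_apply, ofVec_e, hp]
    have : (A.gr.proj j.1).rangeRestrict (b j.1 j.2 : A.V) = b j.1 j.2 := Subtype.ext (hb j)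
    rw [this, Module.Basis.coord_apply, Module.Basis.repr_self, Finsupp.single_eq_same]
    rfl
  have h2 : ∀ j k, j ≠ k → i j ≫ p k = 0 := fun j k hjk => line_hom_ext <| by
    rw [comp_lin_apply, ofVec_e, hp]
    obtain ⟨x, j⟩ := j
    obtain ⟨y, k⟩ := k
    by_cases hxy : y = x
    · subst hxy
      have : (A.gr.proj y).rangeRestrict (b y j : A.V) = b y j := Subtype.ext (hb ⟨y, j⟩)
      rw [this, Module.Basis.coord_apply, Module.Basis.repr_self, Finsupp.single_eq_of_ne]
      · rfl
      · rintro rfl; exact hjk rfl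
    · have : (A.gr.proj y).rangeRestrict (b x j : A.V) = 0 := Subtype.ext (by
        change A.gr.proj y _ = 0
        rw [(hb ⟨x, j⟩).proj_eq, if_neg hxy])
      rw [this, map_zero]
      rfl
  have h3 : ∑ j, p j ≫ i j = 𝟙 A := by
    refine Hom.ext (LinearMap.ext fun v => ?_)
    have hs : ∀ s : Finset J, (∑ j ∈ s, p j ≫ i j).lin v = ∑ j ∈ s, (i j).lin ((p j).lin v) := by
      intro s
      induction s using Finset.induction_on with
      | empty => simp
      | insert j s hj ih =>
        rw [Finset.sum_insert hj, Finset.sum_insert hj, add_lin, LinearMap.add_apply, ih,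
          comp_lin_apply]
    rw [hs, Fintype.sum_sigma]
    change _ = v
    conv_rhs => rw [← A.gr.sum_proj v]
    refine Finset.sum_congr rfl fun x _ => ?_
    have := congrArg Subtype.val ((b x).sum_repr ((A.gr.proj x).rangeRestrict v))
    rw [AddSubmonoidClass.coe_finsetSum] at this
    exact this
  refine ⟨Fintype.card J, fun k => (q.symm k).1, fun k => i (q.symm k), fun k => p (q.symm k),
    fun k => h1 _, fun k l hkl => h2 _ _ fun h => hkl (q.symm.injective h), ?_⟩
  rw [← h3]
  exact Equiv.sum_comp q.symm fun j => p j ≫ i j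

theorem simple_iso_line {A : TwVec ω} (hA : Simple A) : ∃ x, Nonempty (A ≅ line ω x) := by
  obtain ⟨n, x, i, p, h1, h2, h3⟩ := exists_lines A
  rcases n with _ | n
  · rw [Finset.univ_eq_empty, Finset.sum_empty] at h3
    exact absurd h3.symm (id_nonzero A)
  · have : Mono (i 0) := (SplitMono.mk (p 0) (h1 0)).mono
    have h0 : i 0 ≠ 0 := fun h => id_line_ne_zero (ω := ω) (x 0) (by rw [← h1, h, zero_comp])
    have := isIso_of_mono_of_nonzero h0
    exact ⟨x 0, ⟨(asIso (i 0)).symm⟩⟩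

/-- The multiplication `K ⊗ K → K`. -/
def lineTensEquiv (ω : Z3 X K) (x y z : X) : (line ω x ⊗ line ω y).V ≃ₗ[K] (line ω z).V :=
  TensorProduct.lid K K

/-- The isomorphism `line x ⊗ line y ≅ line (x * y)`. -/
def lineTens (ω : Z3 X K) {x y z : X} (h : x * y = z) : line ω x ⊗ line ω y ≅ line ω z :=
  isoMk (lineTensEquiv ω x y z) (isHom_of_tm (A := line ω x) (B := line ω y) (E := line ω z)
    (lineTensEquiv ω x y z).toLinearMap fun x' v y' w hv hw => by
      rcases line_isHom hv with rfl | rfl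
      · rcases line_isHom hw with rfl | rfl
        · subst h
          exact Grading.isHom_single _ _
        · simp [Grading.IsHom.zero]
      · simp [Grading.IsHom.zero])

theorem lineTens_e {x y z : X} (h : x * y = z) :
    (lineTens ω h).hom.lin (tm (e ω x) (e ω y)) = e ω z := by
  have : TensorProduct.lid K K ((1 : K) ⊗ₜ[K] (1 : K)) = 1 := by simp
  exact this

theorem lineTens_inv_e {x y z : X} (h : x * y = z) :
    (lineTens ω h).inv.lin (e ω z) = tm (e ω x) (e ω y) := by
  rw [← lineTens_e h, ← comp_lin_apply, Iso.hom_inv_id]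
  rfl

theorem leftUnitor_inv_lin {A : TwVec ω} {x v} (hv : A.gr.IsHom x v) :
    (λ_ A).inv.lin v = (ω.1 1 1 x : K) • tm (e ω 1) v := by
  refine (lidEquiv A).symm_apply_eq.2 ?_
  rw [map_smul, lidEquiv_tm hv, smul_smul, Units.mul_inv, one_smul]

theorem rightUnitor_inv_lin {A : TwVec ω} {x v} (hv : A.gr.IsHom x v) :
    (ρ_ A).inv.lin v = (((ω.1 x 1 1)⁻¹ : Kˣ) : K) • tm v (e ω 1) := by
  refine (ridEquiv A).symm_apply_eq.2 ?_
  rw [map_smul, ridEquiv_tm hv, smul_smul, Units.inv_mul, one_smul]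

theorem ω_dual (ω : Z3 X K) {x y : X} (h : x * y = 1) (h' : y * x = 1) :
    (ω.1 x y x * ω.1 1 1 x * ω.1 x 1 1)⁻¹ = ω.1 y x y * ω.1 y 1 1 * ω.1 1 1 y := by
  have h1 := ω.2 y x y x
  have h2 := ω.2 y x 1 1
  have h3 := ω.2 1 1 y x
  have h4 := ω_triangle ω y x
  have h5 := ω.2 1 1 1 1
  simp only [h, h', one_mul, mul_one] at h1 h2 h3 h5
  have h5 : ω.1 1 1 1 = 1 := by simpa using h5
  rw [h5, one_mul] at h3
  rw [h5, mul_one] at h2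
  have h2 : ω.1 x 1 1 * ω.1 y x 1 = 1 := by simpa using h2
  have h3 : ω.1 1 y x * ω.1 1 1 y = 1 := by
    rw [mul_right_comm] at h3
    exact mul_right_cancel (b := ω.1 1 y x) (by rw [h3, one_mul])
  rw [inv_eq_iff_mul_eq_one]
  have h6 : ω.1 x y x * ω.1 1 1 x * ω.1 x 1 1 * (ω.1 y x y * ω.1 y 1 1 * ω.1 1 1 y) =
      (ω.1 x y x * ω.1 y 1 x * ω.1 y x y) * (ω.1 x 1 1 * ω.1 1 1 y) := by
    rw [← h4]; simp only [mul_assoc, mul_left_comm, mul_comm]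
  rw [h6, h1]
  calc _ = (ω.1 x 1 1 * ω.1 y x 1) * (ω.1 1 y x * ω.1 1 1 y) := by
        simp only [mul_assoc, mul_left_comm, mul_comm]
    _ = 1 := by rw [h2, h3, one_mul]

/-- The duality between `line x` and `line x⁻¹`. -/
abbrev linePairing (ω : Z3 X K) {x y : X} (h : x * y = 1) (h' : y * x = 1) :
    ExactPairing (line ω x) (line ω y) where
  coevaluation' := (lineTens ω h).inv
  evaluation' := (((ω.1 x y x * ω.1 1 1 x * ω.1 x 1 1)⁻¹ : Kˣ) : K) • (lineTens ω h').hom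
  coevaluation_evaluation' := tensor_unit_hom_ext fun x' v hv => by
    obtain ⟨r, rfl⟩ := line_eq_smul v
    simp only [map_smul, LinearMap.smul_apply]
    congr 1
    simp only [comp_lin_apply]
    rw [whiskerLeft_tm, lineTens_inv_e, associator_inv_tm (e_isHom y) (e_isHom x) (e_isHom y),
      map_smul, whiskerRight_tm, smul_lin, LinearMap.smul_apply, lineTens_e,
      rightUnitor_tm (e_isHom y), map_smul, map_smul, leftUnitor_inv_lin (e_isHom y), LinearMap.smul_apply, ω_dual ω h h']
    simp only [smul_smul]
    congr 1
    push_cast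
    field_simp
  evaluation_coevaluation' := unit_tensor_hom_ext fun x' v hv => by
    obtain ⟨r, rfl⟩ := line_eq_smul v
    simp only [map_smul]
    congr 1
    simp only [comp_lin_apply]
    rw [whiskerRight_tm, lineTens_inv_e, associator_tm (e_isHom x) (e_isHom y) (e_isHom x),
      map_smul, whiskerLeft_tm, smul_lin, LinearMap.smul_apply, lineTens_e,
      leftUnitor_tm (e_isHom x), map_smul, map_smul, rightUnitor_inv_lin (e_isHom x)]
    simp only [smul_smul]
    congr 1
    push_cast
    field_simp

theorem exists_dual (A : TwVec ω) : ∃ B : TwVec ω, Nonempty (ExactPairing A B) ∧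
    Nonempty (ExactPairing B A) := by
  obtain ⟨n, x, i, p, h1, h2, h3⟩ := exists_lines A
  have h1' : ∀ j, biproduct.ι (fun j => line ω (x j)⁻¹) j ≫ biproduct.π _ j = 𝟙 _ := by simp
  have h2' : ∀ j k, j ≠ k → biproduct.ι (fun j => line ω (x j)⁻¹) j ≫ biproduct.π _ k = 0 :=
    fun j k => biproduct.ι_π_ne _
  have h3' := biproduct.total (f := fun j => line ω (x j)⁻¹)
  exact ⟨⨁ fun j => line ω (x j)⁻¹,
    ⟨exactPairingSum i p _ _ h1 h2 h3 h1' h2' h3' fun j =>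
      linePairing ω (mul_inv_cancel _) (inv_mul_cancel _)⟩,
    ⟨exactPairingSum _ _ i p h1' h2' h3' h1 h2 h3 fun j =>
      linePairing ω (inv_mul_cancel _) (mul_inv_cancel _)⟩⟩

theorem isFusion (ω : Z3 X K) : IsFusion K (TwVec ω) where
  toIsAbelian := isAbelian_of exists_pinv
  monoidalPreadditive := inferInstance
  monoidalLinear := inferInstance
  finite_hom A B :=
    let l : (A ⟶ B) →ₗ[K] (A.V →ₗ[K] B.V) :=
      { toFun := fun f => f.lin, map_add' := add_lin, map_smul' := smul_lin }
    Module.Finite.of_injective l fun _ _ h => Hom.ext h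
  semisimple A := by
    obtain ⟨n, x, i, p, h1, h2, h3⟩ := exists_lines A
    exact ⟨n, fun j => line ω (x j), fun j => inferInstance, isDirectSum_of i p h1 h2 fun _ => by
      convert h3⟩
  finite_simple := ⟨Fintype.card X, fun j => line ω ((Fintype.equivFin X).symm j), fun A hA => by
    obtain ⟨x, h⟩ := simple_iso_line hA
    exact ⟨Fintype.equivFin X x, by
      change Nonempty (A ≅ line ω ((Fintype.equivFin X).symm (Fintype.equivFin X x)))
      rwa [Equiv.symm_apply_apply]⟩⟩
  simple_unit := simple_line 1
  rigid := by
    choose B h h' using exists_dual (ω := ω)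
    exact ⟨{ rightDual := fun A => { rightDual := B A, exact := (h A).some }
             leftDual := fun A => { leftDual := B A, exact := (h' A).some } }⟩

theorem isPointed (ω : Z3 X K) : IsPointed (TwVec ω) := fun A hA => by
  obtain ⟨x, ⟨i⟩⟩ := simple_iso_line hA
  exact ⟨line ω x⁻¹, ⟨whiskerRightIso i _ ≪≫ lineTens ω (mul_inv_cancel x)⟩,
    ⟨whiskerLeftIso _ i ≪≫ lineTens ω (inv_mul_cancel x)⟩⟩

end Structure

end TwVec

/-! ### The crossed category of a quasi-abelian 3-cocycle -/

section Construction

variable {K : Type w} [Field K] {𝒳 : FinCrossedModule.{a}}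

instance : Fintype 𝒳.X := Fintype.ofFinite _
instance : DecidableEq 𝒳.X := Classical.decEq _

/-- The component `ω` of a quasi-abelian 3-cocycle, as a 3-cocycle on `X`. -/
def omega (ξ : Zqa 𝒳 K) : Z3 𝒳.X K := ⟨ξ.1.ω, ξ.2.ω_cocycle⟩

namespace TwVec

variable {ξ : Zqa 𝒳 K}

/-- `T_g V` is `V` with degrees shifted by `x ↦ g • x`. -/
def actObj (g : 𝒳.G) (A : TwVec (omega ξ)) : TwVec (omega ξ) where
  V := A.V
  gr :=
    { proj := fun x => A.gr.proj (g⁻¹ • x)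
      proj_proj := fun x y v => by simp [A.gr.proj_proj]
      sum_proj := fun v => by
        rw [← Equiv.sum_comp (MulAction.toPerm g : Equiv.Perm 𝒳.X)]
        simp [A.gr.sum_proj] }

/-- The functor `T_g`. -/
def act (ξ : Zqa 𝒳 K) (g : 𝒳.G) : TwVec (omega ξ) ⥤ TwVec (omega ξ) where
  obj := actObj g
  map f := ⟨f.lin, fun x v hv => f.isHom (g⁻¹ • x) v hv⟩

variable {A B D : TwVec (omega ξ)}

/-- The identity map `V → T_g V`. -/
def toT (g : 𝒳.G) (A : TwVec (omega ξ)) : A.V ≃ₗ[K] ((act ξ g).obj A).V := LinearEquiv.refl K A.V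

theorem T_isHom (g : 𝒳.G) {x : 𝒳.X} {v : A.V} (hv : A.gr.IsHom x v) :
    ((act ξ g).obj A).gr.IsHom (g • x) (toT g A v) := by
  have : A.gr.proj (g⁻¹ • g • x) v = v := by rw [inv_smul_smul]; exact hv
  exact this

theorem act_map (g : 𝒳.G) (f : A ⟶ B) (v : A.V) :
    ((act ξ g).map f).lin (toT g A v) = toT g B (f.lin v) := rfl

instance (g : 𝒳.G) : (act ξ g).Additive where
instance (g : 𝒳.G) : (act ξ g).Linear K where

theorem eqToHom_act {g h : 𝒳.G} (p : g = h) (v : A.V) :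
    (eqToHom (congrArg (fun l => (act ξ l).obj A) p)).lin (toT g A v) = toT h A v := by
  subst p; rfl

/-- The unit constraint of `T_g`, inverse to `ν_g`. -/
def epsEquiv (ξ : Zqa 𝒳 K) (g : 𝒳.G) :
    (𝟙_ (TwVec (omega ξ))).V ≃ₗ[K] ((act ξ g).obj (𝟙_ (TwVec (omega ξ)))).V :=
  ((line (omega ξ) 1).gr.scalEquiv fun _ => ξ.1.μ g 1 1).trans (toT g _)

theorem epsEquiv_e (g : 𝒳.G) :
    epsEquiv ξ g (e _ 1) = (ξ.1.μ g 1 1 : K) • toT g (𝟙_ (TwVec (omega ξ))) (e _ 1) :=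
  (e_isHom (ω := omega ξ) 1).scalEquiv _

variable (A B) in
/-- The tensor constraint of `T_g`, inverse to `μ_g(x, y) id`. -/
def muEquiv (g : 𝒳.G) :
    ((act ξ g).obj A ⊗ (act ξ g).obj B).V ≃ₗ[K] ((act ξ g).obj (A ⊗ B)).V :=
  (A.gr.tensor B.gr).scalEquiv fun p => (ξ.1.μ g p.1 p.2)⁻¹

theorem muEquiv_tm (g : 𝒳.G) {x y v w} (hv : A.gr.IsHom x v) (hw : B.gr.IsHom y w) :
    muEquiv A B g (tm (toT g A v) (toT g B w)) =
      (((ξ.1.μ g x y)⁻¹ : Kˣ) : K) • toT g (A ⊗ B) (tm v w) :=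
  (hv.tmul hw).scalEquiv _

variable (A) in
/-- Multiplication by `γ_{g,h}(x)`, from `T_{gh} V` to `T_g T_h V`. -/
def gammaEquiv (g h : 𝒳.G) :
    ((act ξ (g * h)).obj A).V ≃ₗ[K] ((act ξ g).obj ((act ξ h).obj A)).V :=
  A.gr.scalEquiv fun x => ξ.1.γ g h x

theorem gammaEquiv_toT (g h : 𝒳.G) {x v} (hv : A.gr.IsHom x v) :
    gammaEquiv A g h (toT (g * h) A v) =
      (ξ.1.γ g h x : K) • toT g ((act ξ h).obj A) (toT h A v) :=
  hv.scalEquiv _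

variable (A) in
/-- Multiplication by `γ_{e,e}(x)⁻¹`, from `T_e V` to `V`. -/
def iotaEquiv : ((act ξ 1).obj A).V ≃ₗ[K] A.V := A.gr.scalEquiv fun x => (ξ.1.γ 1 1 x)⁻¹

theorem iotaEquiv_toT {x v} (hv : A.gr.IsHom x v) :
    iotaEquiv A (toT 1 A v) = (((ξ.1.γ 1 1 x)⁻¹ : Kˣ) : K) • v :=
  hv.scalEquiv _

variable (A B) in
/-- The map `v ⊗ w ↦ c(x, y) w ⊗ v`, from `V ⊗ W` to `T_g W ⊗ V`. -/
def braidEquiv (g : 𝒳.G) : (A ⊗ B).V ≃ₗ[K] ((act ξ g).obj B ⊗ A).V :=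
  ((A.gr.tensor B.gr).scalEquiv fun p => ξ.1.c p.1 p.2).trans (TensorProduct.comm K A.V B.V)

theorem braidEquiv_tm (g : 𝒳.G) {x y v w} (hv : A.gr.IsHom x v) (hw : B.gr.IsHom y w) :
    braidEquiv A B g (tm v w) = (ξ.1.c x y : K) • tm (toT g B w) v := by
  have : TensorProduct.comm K A.V B.V
      (((A.gr.tensor B.gr).scalEquiv fun p => ξ.1.c p.1 p.2) (v ⊗ₜ[K] w)) =
      (ξ.1.c x y : K) • w ⊗ₜ[K] v := by
    rw [(hv.tmul hw).scalEquiv, map_smul, TensorProduct.comm_tmul]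
  exact this

theorem exists_of_T_isHom {g : 𝒳.G} {x : 𝒳.X} {v : ((act ξ g).obj A).V}
    (hv : ((act ξ g).obj A).gr.IsHom x v) :
    ∃ x' v', A.gr.IsHom x' v' ∧ x = g • x' ∧ v = toT g A v' :=
  ⟨g⁻¹ • x, v, hv, (smul_inv_smul _ _).symm, rfl⟩

theorem T_tensor_hom_ext {g : 𝒳.G} {f f' : (act ξ g).obj (A ⊗ B) ⟶ D}
    (h : ∀ x v y w, A.gr.IsHom x v → B.gr.IsHom y w →
      f.lin (toT g (A ⊗ B) (tm v w)) = f'.lin (toT g (A ⊗ B) (tm v w))) : f = f' :=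
  Hom.ext (lin_ext₂ (A := A) (B := B) (f := f.lin) (g := f'.lin) h)

attribute [irreducible] toT

theorem T_hom_ext {g : 𝒳.G} {f f' : (act ξ g).obj A ⟶ B}
    (h : ∀ x v, A.gr.IsHom x v → f.lin (toT g A v) = f'.lin (toT g A v)) : f = f' :=
  hom_ext fun x v hv => by
    obtain ⟨x, v, hv', rfl, rfl⟩ := exists_of_T_isHom hv
    exact h x v hv'

/-- The unit isomorphism `1 ≅ T_g 1`. -/
def epsIso (ξ : Zqa 𝒳 K) (g : 𝒳.G) : 𝟙_ (TwVec (omega ξ)) ≅ (act ξ g).obj (𝟙_ _) :=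
  isoMk (epsEquiv ξ g) fun x v hv => by
    rcases line_isHom hv with rfl | rfl
    · obtain ⟨r, rfl⟩ := line_eq_smul v
      rw [map_smul, epsEquiv_e]
      have := T_isHom g (unit_isHom (omega ξ))
      rw [smul_one] at this
      exact (this.smul _).smul _
    · simp [Grading.IsHom.zero]

variable (A B) in
/-- The isomorphism `T_g V ⊗ T_g W ≅ T_g (V ⊗ W)`. -/
def muIso (g : 𝒳.G) : (act ξ g).obj A ⊗ (act ξ g).obj B ≅ (act ξ g).obj (A ⊗ B) :=
  isoMk (muEquiv A B g) (isHom_of_tm (muEquiv A B g).toLinearMap fun x v y w hv hw => by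
    obtain ⟨x, v, hv', rfl, rfl⟩ := exists_of_T_isHom hv
    obtain ⟨y, w, hw', rfl, rfl⟩ := exists_of_T_isHom hw
    rw [LinearEquiv.coe_coe, muEquiv_tm g hv' hw', ← smul_mul']
    exact (T_isHom g (tmul_isHom hv' hw')).smul _)

theorem epsIso_e (g : 𝒳.G) :
    (epsIso ξ g).hom.lin (e _ 1) = (ξ.1.μ g 1 1 : K) • toT g (𝟙_ (TwVec (omega ξ))) (e _ 1) := epsEquiv_e g

theorem epsIso_inv_e (g : 𝒳.G) :
    (epsIso ξ g).inv.lin (toT g (𝟙_ (TwVec (omega ξ))) (e _ 1)) = (((ξ.1.μ g 1 1)⁻¹ : Kˣ) : K) • e _ 1 := by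
  refine (epsEquiv ξ g).symm_apply_eq.2 ?_
  rw [map_smul, epsEquiv_e, smul_smul, Units.inv_mul, one_smul]

theorem muIso_tm (g : 𝒳.G) {x y v w} (hv : A.gr.IsHom x v) (hw : B.gr.IsHom y w) :
    (muIso A B g).hom.lin (tm (toT g A v) (toT g B w)) =
      (((ξ.1.μ g x y)⁻¹ : Kˣ) : K) • toT g (A ⊗ B) (tm v w) := muEquiv_tm g hv hw

theorem muIso_inv_tm (g : 𝒳.G) {x y v w} (hv : A.gr.IsHom x v) (hw : B.gr.IsHom y w) :
    (muIso A B g).inv.lin (toT g (A ⊗ B) (tm v w)) =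
      (ξ.1.μ g x y : K) • tm (toT g A v) (toT g B w) := by
  refine (muEquiv A B g).symm_apply_eq.2 ?_
  rw [map_smul, muEquiv_tm g hv hw, smul_smul, Units.mul_inv, one_smul]

/-- The structure of a monoidal functor on `T_g`. -/
def actCore (ξ : Zqa 𝒳 K) (g : 𝒳.G) : (act ξ g).CoreMonoidal where
  εIso := epsIso ξ g
  μIso A B := muIso A B g
  μIso_hom_natural_left f D := tensor_hom_ext fun x v y w hv hw => by
    obtain ⟨x, v, hv', rfl, rfl⟩ := exists_of_T_isHom hv
    obtain ⟨y, w, hw', rfl, rfl⟩ := exists_of_T_isHom hw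
    rw [comp_lin_apply, comp_lin_apply, whiskerRight_tm, act_map, muIso_tm g (f.isHom _ _ hv') hw',
      muIso_tm g hv' hw', map_smul, act_map, whiskerRight_tm]
  μIso_hom_natural_right D f := tensor_hom_ext fun x v y w hv hw => by
    obtain ⟨x, v, hv', rfl, rfl⟩ := exists_of_T_isHom hv
    obtain ⟨y, w, hw', rfl, rfl⟩ := exists_of_T_isHom hw
    rw [comp_lin_apply, comp_lin_apply, whiskerLeft_tm, act_map, muIso_tm g hv' (f.isHom _ _ hw'),
      muIso_tm g hv' hw', map_smul, act_map, whiskerLeft_tm]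
  associativity A B D := tensor_hom_ext₃ fun x v y w z u hv hw hu => by
    obtain ⟨x, v, hv', rfl, rfl⟩ := exists_of_T_isHom hv
    obtain ⟨y, w, hw', rfl, rfl⟩ := exists_of_T_isHom hw
    obtain ⟨z, u, hu', rfl, rfl⟩ := exists_of_T_isHom hu
    simp only [comp_lin_apply]
    rw [whiskerRight_tm, muIso_tm g hv' hw', map_smul, LinearMap.smul_apply, map_smul,
      muIso_tm g (tmul_isHom hv' hw') hu', map_smul, map_smul, act_map, associator_tm hv' hw' hu',
      associator_tm hv hw hu, map_smul, map_smul, whiskerLeft_tm, muIso_tm g hw' hu', map_smul,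
      map_smul, map_smul, muIso_tm g hv' (tmul_isHom hw' hu')]
    simp only [smul_smul]
    congr 1
    have := congrArg Units.val (ξ.2.μ_ω g x y z)
    push_cast at this ⊢
    simp only [omega]
    field_simp at this ⊢
    linear_combination this
  left_unitality A := unit_tensor_hom_ext fun x v hv => by
    obtain ⟨x, v, hv', rfl, rfl⟩ := exists_of_T_isHom hv
    simp only [comp_lin_apply]
    rw [leftUnitor_tm hv, whiskerRight_tm, epsIso_e, map_smul, LinearMap.smul_apply, map_smul,
      muIso_tm g (unit_isHom _) hv', map_smul, map_smul, act_map, leftUnitor_tm hv', map_smul]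
    simp only [smul_smul]
    congr 1
    have := congrArg Units.val (ξ.2.μ_ω g 1 1 x)
    simp only [one_mul, smul_one] at this
    push_cast at this ⊢
    simp only [omega]
    field_simp at this ⊢
    linear_combination this
  right_unitality A := tensor_unit_hom_ext fun x v hv => by
    obtain ⟨x, v, hv', rfl, rfl⟩ := exists_of_T_isHom hv
    simp only [comp_lin_apply]
    rw [rightUnitor_tm hv, whiskerLeft_tm, epsIso_e, map_smul, map_smul,
      muIso_tm g hv' (unit_isHom _), map_smul, map_smul, act_map, rightUnitor_tm hv', map_smul]
    simp only [smul_smul]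
    congr 1
    have := congrArg Units.val (ξ.2.μ_ω g x 1 1)
    simp only [mul_one, smul_one] at this
    push_cast at this ⊢
    simp only [omega]
    field_simp at this ⊢
    linear_combination -this

instance (g : 𝒳.G) : (act ξ g).Monoidal := (actCore ξ g).toMonoidal

open Functor.OplaxMonoidal Functor.LaxMonoidal

theorem δ_tm (g : 𝒳.G) {x y v w} (hv : A.gr.IsHom x v) (hw : B.gr.IsHom y w) :
    (δ (act ξ g) A B).lin (toT g (A ⊗ B) (tm v w)) =
      (ξ.1.μ g x y : K) • tm (toT g A v) (toT g B w) := muIso_inv_tm g hv hw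

theorem μ_tm (g : 𝒳.G) {x y v w} (hv : A.gr.IsHom x v) (hw : B.gr.IsHom y w) :
    (Functor.LaxMonoidal.μ (act ξ g) A B).lin (tm (toT g A v) (toT g B w)) =
      (((ξ.1.μ g x y)⁻¹ : Kˣ) : K) • toT g (A ⊗ B) (tm v w) := muIso_tm g hv hw

theorem ε_e (g : 𝒳.G) :
    (ε (act ξ g)).lin (e _ 1) = (ξ.1.μ g 1 1 : K) • toT g (𝟙_ (TwVec (omega ξ))) (e _ 1) :=
  epsIso_e g

/-- The tensor structure of `g ↦ T_g`. -/
def gammaIso (ξ : Zqa 𝒳 K) (g h : 𝒳.G) : act ξ (g * h) ≅ act ξ h ⋙ act ξ g :=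
  NatIso.ofComponents (fun A => isoMk (gammaEquiv A g h) fun x v hv => by
      obtain ⟨x, v, hv', rfl, rfl⟩ := exists_of_T_isHom hv
      rw [gammaEquiv_toT g h hv', mul_smul]
      exact (T_isHom g (T_isHom h hv')).smul _)
    fun {A B} f => T_hom_ext fun x v hv => by
      have h1 := gammaEquiv_toT g h (f.isHom _ _ hv)
      have h2 := gammaEquiv_toT g h hv
      rw [comp_lin_apply, comp_lin_apply, act_map]
      refine h1.trans ?_
      change _ = ((act ξ g).map ((act ξ h).map f)).lin (gammaEquiv A g h _)
      rw [h2, map_smul, act_map, act_map]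

theorem gammaIso_toT (g h : 𝒳.G) {x v} (hv : A.gr.IsHom x v) :
    ((gammaIso ξ g h).hom.app A).lin (toT (g * h) A v) =
      (ξ.1.γ g h x : K) • toT g ((act ξ h).obj A) (toT h A v) := gammaEquiv_toT g h hv

theorem gammaIso_inv_toT (g h : 𝒳.G) {x v} (hv : A.gr.IsHom x v) :
    ((gammaIso ξ g h).inv.app A).lin (toT g ((act ξ h).obj A) (toT h A v)) =
      (((ξ.1.γ g h x)⁻¹ : Kˣ) : K) • toT (g * h) A v := by
  refine (gammaEquiv A g h).symm_apply_eq.2 ?_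
  rw [map_smul, gammaEquiv_toT g h hv, smul_smul, Units.inv_mul, one_smul]

/-- The unit-preserving structure of `g ↦ T_g`. -/
def iotaIso (ξ : Zqa 𝒳 K) : act ξ 1 ≅ 𝟭 (TwVec (omega ξ)) :=
  NatIso.ofComponents (fun A => isoMk (iotaEquiv A) fun x v hv => by
      obtain ⟨x, v, hv', rfl, rfl⟩ := exists_of_T_isHom hv
      rw [iotaEquiv_toT hv', one_smul]
      exact hv'.smul _)
    fun {A B} f => T_hom_ext fun x v hv => by
      have h1 := iotaEquiv_toT (f.isHom _ _ hv)
      have h2 := iotaEquiv_toT hv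
      rw [comp_lin_apply, comp_lin_apply, act_map]
      refine h1.trans ?_
      change _ = f.lin (iotaEquiv A _)
      rw [h2, map_smul]

theorem iotaIso_toT {x v} (hv : A.gr.IsHom x v) :
    ((iotaIso ξ).hom.app A).lin (toT 1 A v) = (((ξ.1.γ 1 1 x)⁻¹ : Kˣ) : K) • v :=
  iotaEquiv_toT hv

theorem unit_hom_ext {f f' : 𝟙_ (TwVec (omega ξ)) ⟶ A} (h : f.lin (e _ 1) = f'.lin (e _ 1)) :
    f = f' := Hom.ext (line_ext h)

theorem comp_ε (g h : 𝒳.G) : (ε (act ξ h ⋙ act ξ g)) = ε (act ξ g) ≫ (act ξ g).map (ε (act ξ h)) :=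
  rfl

theorem comp_μ (g h : 𝒳.G) : (μ (act ξ h ⋙ act ξ g) A B) =
    μ (act ξ g) ((act ξ h).obj A) ((act ξ h).obj B) ≫ (act ξ g).map (μ (act ξ h) A B) :=
  rfl

instance (g h : 𝒳.G) : NatTrans.IsMonoidal (gammaIso ξ g h).hom where
  unit := unit_hom_ext <| by
    rw [comp_ε, comp_lin_apply, comp_lin_apply, ε_e, ε_e, map_smul, gammaIso_toT g h (unit_isHom _),
      map_smul, act_map, ε_e, map_smul]
    simp only [smul_smul]
    congr 1
    have := congrArg Units.val (ξ.2.γ_μ g h 1 1)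
    simp only [mul_one, smul_one] at this
    push_cast at this ⊢
    field_simp at this ⊢
    linear_combination this
  tensor A B := tensor_hom_ext fun x v y w hv hw => by
    obtain ⟨x, v, hv', rfl, rfl⟩ := exists_of_T_isHom hv
    obtain ⟨y, w, hw', rfl, rfl⟩ := exists_of_T_isHom hw
    rw [comp_μ, comp_lin_apply, comp_lin_apply, comp_lin_apply, μ_tm _ hv' hw', map_smul,
      gammaIso_toT g h (tmul_isHom hv' hw'), tensorHom_tm, gammaIso_toT g h hv',
      gammaIso_toT g h hw']
    simp only [map_smul, LinearMap.smul_apply]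
    rw [μ_tm g (T_isHom h hv') (T_isHom h hw')]
    simp only [map_smul]
    rw [act_map, μ_tm h hv' hw']
    simp only [map_smul, smul_smul]
    congr 1
    have := congrArg Units.val (ξ.2.γ_μ g h x y)
    push_cast at this ⊢
    field_simp at this ⊢
    linear_combination -this

instance : NatTrans.IsMonoidal (iotaIso ξ).hom where
  unit := unit_hom_ext <| by
    rw [comp_lin_apply, ε_e, map_smul, iotaIso_toT (unit_isHom _)]
    change _ = e (omega ξ) 1
    rw [smul_smul]
    have := congrArg Units.val (ξ.2.γ_μ 1 1 1 1)
    simp only [mul_one, smul_one] at this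
    push_cast at this ⊢
    field_simp at this ⊢
    rw [this, div_self (Units.ne_zero _), one_smul]
  tensor A B := tensor_hom_ext fun x v y w hv hw => by
    obtain ⟨x, v, hv', rfl, rfl⟩ := exists_of_T_isHom hv
    obtain ⟨y, w, hw', rfl, rfl⟩ := exists_of_T_isHom hw
    rw [comp_lin_apply, comp_lin_apply, μ_tm _ hv' hw', map_smul, iotaIso_toT (tmul_isHom hv' hw'),
      tensorHom_tm, iotaIso_toT hv', iotaIso_toT hw']
    change _ = LinearMap.id _
    rw [LinearMap.id_apply]
    simp only [map_smul, LinearMap.smul_apply, smul_smul]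
    congr 1
    have := congrArg Units.val (ξ.2.γ_μ 1 1 x y)
    simp only [mul_one, one_smul] at this
    push_cast at this ⊢
    field_simp at this ⊢
    linear_combination this

instance (g : 𝒳.G) : (act ξ g).IsEquivalence where
  faithful := ⟨fun {A B} f f' h => by
    have := congrArg (fun k : (act ξ g).obj A ⟶ (act ξ g).obj B => Hom.lin k) h
    exact Hom.ext this⟩
  full := ⟨fun {A B} f => ⟨⟨f.lin, fun x v hv => by
    have := f.isHom (g • x) v (show A.gr.proj (g⁻¹ • g • x) v = v by rw [inv_smul_smul]; exact hv)
    have h2 : B.gr.proj (g⁻¹ • g • x) (f.lin v) = f.lin v := this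
    rwa [inv_smul_smul] at h2⟩, rfl⟩⟩
  essSurj := ⟨fun A => ⟨(act ξ g⁻¹).obj A, ⟨(gammaIso ξ g g⁻¹).symm.app A ≪≫
    eqToIso (congrArg (fun l => (act ξ l).obj A) (mul_inv_cancel g)) ≪≫ (iotaIso ξ).app A⟩⟩⟩

/-- The full subcategory of spaces supported on `∂⁻¹(g)`. -/
def supp (ξ : Zqa 𝒳 K) (g : 𝒳.G) : ObjectProperty (TwVec (omega ξ)) :=
  fun A => ∀ x v, A.gr.IsHom x v → v ≠ 0 → 𝒳.bd x = g

/-- The `G`-braiding. -/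
def braid (g : 𝒳.G) (A : TwVec (omega ξ)) (hA : supp ξ g A) (B : TwVec (omega ξ)) :
    A ⊗ B ≅ (act ξ g).obj B ⊗ A :=
  isoMk (braidEquiv A B g) (isHom_of_tm (braidEquiv A B g).toLinearMap fun x v y w hv hw => by
    rcases eq_or_ne v 0 with rfl | h0
    · simp [Grading.IsHom.zero]
    · obtain rfl := hA x v hv h0
      rw [LinearEquiv.coe_coe, braidEquiv_tm _ hv hw]
      have := (tmul_isHom (T_isHom (𝒳.bd x) hw) hv).smul (ξ.1.c x y : K)
      rwa [𝒳.bd_smul, inv_mul_cancel_right] at this)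

theorem braid_tm {g : 𝒳.G} (hA : supp ξ g A) {x y v w} (hv : A.gr.IsHom x v)
    (hw : B.gr.IsHom y w) :
    (braid g A hA B).hom.lin (tm v w) = (ξ.1.c x y : K) • tm (toT g B w) v :=
  braidEquiv_tm g hv hw

end TwVec

open TwVec

section Crossed

variable (ξ : Zqa 𝒳 K)

open Classical in
theorem supp_decomp (A : TwVec (omega ξ)) :
    ∃ Y : 𝒳.G → TwVec (omega ξ), (∀ g, supp ξ g (Y g)) ∧ IsDirectSum A Y := by
  have hpp : ∀ g h, prSet A (fun x => 𝒳.bd x = g) ≫ prSet A (fun x => 𝒳.bd x = h) =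
      if g = h then prSet A (fun x => 𝒳.bd x = g) else 0 := fun g h => hom_ext fun x v hv => by
    rw [comp_lin_apply, prSet_apply _ hv]
    by_cases hg : 𝒳.bd x = g
    · rw [if_pos hg, prSet_apply _ hv]
      subst hg
      split_ifs
      · rw [prSet_apply _ hv, if_pos rfl]
      · rfl
    · rw [if_neg hg, map_zero]
      split_ifs
      · rw [prSet_apply _ hv, if_neg hg]
      · rfl
  refine ⟨fun g => TwVec.image (prSet A fun x => 𝒳.bd x = g), fun g x v hv h0 => ?_,
    isDirectSum_of (fun g => image.ι _) (fun g => image.π _) (fun g => image.ι_π ?_)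
      (fun g h hgh => ?_) (fun _ => ?_)⟩
  · have h1 := (image.ι (prSet A fun x => 𝒳.bd x = g)).isHom x v hv
    have h2 := congrArg (fun k => Hom.lin k v)
      (image.ι_π (p := prSet A fun x => 𝒳.bd x = g) (by rw [hpp, if_pos rfl]))
    have h3 : (image.π (prSet A fun x => 𝒳.bd x = g)).lin
      ((image.ι (prSet A fun x => 𝒳.bd x = g)).lin v) = v := h2
    by_contra hx
    refine h0 ?_
    rw [← h3]
    refine Subtype.ext ?_
    change (prSet A fun x => 𝒳.bd x = g).lin _ = 0
    rw [prSet_apply _ h1, if_neg hx]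
  · rw [hpp, if_pos rfl]
  · have : image.π (prSet A fun x => 𝒳.bd x = g) ≫ image.ι (prSet A fun x => 𝒳.bd x = g) ≫
        image.π (prSet A fun x => 𝒳.bd x = h) ≫ image.ι (prSet A fun x => 𝒳.bd x = h) = 0 := by
      rw [image.π_ι, ← Category.assoc, image.π_ι, hpp, if_neg hgh]
    have h2 := congrArg (fun k => image.ι (prSet A fun x => 𝒳.bd x = g) ≫ k ≫
      image.π (prSet A fun x => 𝒳.bd x = h)) this
    simp only [Category.assoc, zero_comp, comp_zero] at h2
    rw [image.ι_π (by rw [hpp, if_pos rfl]), Category.comp_id, ← Category.assoc,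
      image.ι_π (by rw [hpp, if_pos rfl]), Category.id_comp] at h2
    exact h2
  · simp only [image.π_ι]
    refine hom_ext fun x v hv => ?_
    have hs : ∀ s : Finset 𝒳.G, (∑ g ∈ s, prSet A fun x => 𝒳.bd x = g).lin v =
        ∑ g ∈ s, (prSet A fun x => 𝒳.bd x = g).lin v := by
      intro s
      induction s using Finset.induction_on with
      | empty => simp
      | insert g s hg ih => rw [Finset.sum_insert hg, Finset.sum_insert hg, add_lin,
          LinearMap.add_apply, ih]
    rw [hs]
    simp [prSet_apply _ hv]

theorem supp_dual {g : 𝒳.G} {A B : TwVec (omega ξ)} (P : ExactPairing A B) (hA : supp ξ g A) :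
    supp ξ g⁻¹ B := by
  intro y w hw h0
  by_contra hy
  let q : B ⟶ B := prSet B fun x => x = y
  have h1 : η_ A B ≫ A ◁ q = 0 := by
    have h2 : (A ◁ q).lin ∘ₗ (A ⊗ B).gr.proj 1 = 0 := lin_ext₂ fun x v y' w hv hw => by
      rw [LinearMap.comp_apply, (tmul_isHom hv hw).proj_eq]
      split_ifs with h
      · rw [whiskerLeft_tm, prSet_apply _ hw]
        split_ifs with h'
        · subst h'
          rcases eq_or_ne v 0 with rfl | hv0
          · simp
          · refine absurd ?_ hy
            rw [← hA x v hv hv0, ← map_inv, inv_eq_of_mul_eq_one_right h.symm]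
        · simp
      · simp
    refine unit_hom_ext ?_
    have h3 : (A ⊗ B).gr.proj 1 ((η_ A B).lin (e _ 1)) = (η_ A B).lin (e _ 1) :=
      (η_ A B).isHom 1 _ (unit_isHom _)
    rw [comp_lin_apply, ← h3]
    exact LinearMap.congr_fun h2 _
  have h2 : (ρ_ B).hom ≫ q ≫ (λ_ B).inv = 0 := by
    rw [leftUnitor_inv_naturality, ← Category.assoc,
      ← ExactPairing.coevaluation_evaluation (X := A) (Y := B), Category.assoc, Category.assoc,
      ← whisker_exchange, ← associator_inv_naturality_right_assoc, ← whiskerLeft_comp_assoc, h1]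
    simp
  have h3 : q = 0 := by
    have := congrArg (fun k => (ρ_ B).inv ≫ k ≫ (λ_ B).hom) h2
    simpa using this
  have h4 : q.lin w = w := by rw [prSet_apply _ hw, if_pos rfl]
  rw [h3] at h4
  exact h0 h4.symm

/-- The grading of `Vec_X^ω` by `G`: the component of `g` consists of the spaces supported on
`∂⁻¹(g)`. -/
def suppGrading : GroupGrading (TwVec (omega ξ)) 𝒳.G where
  comp := supp ξ
  comp_iso g A B i hA x v hv h0 := hA x (i.inv.lin v) (i.inv.isHom x v hv) fun h => h0 <| by
    have : i.hom.lin (i.inv.lin v) = v :=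
      LinearMap.congr_fun (congrArg Hom.lin i.inv_hom_id) v
    rw [← this, h, map_zero]
  hom_eq_zero hA hB hgh f := hom_ext fun x v hv => by
    by_contra h
    refine hgh ((hA x v hv ?_).symm.trans (hB x _ (f.isHom x v hv) h))
    rintro rfl
    simp at h
  exists_decomp := supp_decomp ξ
  comp_tensor {g h A B} hA hB := by
    intro z t ht h0
    by_contra hz
    have h2 : (A ⊗ B).gr.proj z = 0 := lin_ext₂ fun x v y w hv hw => by
      rw [(tmul_isHom hv hw).proj_eq]
      split_ifs with h
      · rcases eq_or_ne v 0 with rfl | hv0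
        · simp
        rcases eq_or_ne w 0 with rfl | hw0
        · simp
        rw [h, map_mul, hA x v hv hv0, hB y w hw hw0] at hz
        exact absurd rfl hz
      · simp
    refine h0 ?_
    rw [← show _ = t from ht, h2]
    rfl
  comp_dual P hA := supp_dual ξ P hA

theorem supp_T {g h : 𝒳.G} {A : TwVec (omega ξ)} (hA : supp ξ h A) :
    supp ξ (g * h * g⁻¹) ((act ξ g).obj A) := fun x v hv h0 => by
  obtain ⟨x, v, hv', rfl, rfl⟩ := exists_of_T_isHom hv
  rw [𝒳.smul_bd, hA x v hv' (by rintro rfl; simp at h0)]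

variable {ξ}

open Functor.OplaxMonoidal

theorem γ_one_left (g : 𝒳.G) (A : TwVec (omega ξ)) :
    (gammaIso ξ 1 g).hom.app A ≫ (iotaIso ξ).hom.app ((act ξ g).obj A) =
      eqToHom (congrArg (fun l => (act ξ l).obj A) (one_mul g)) := T_hom_ext fun x v hv => by
  rw [eqToHom_act (one_mul g), comp_lin_apply, gammaIso_toT _ _ hv, map_smul,
    iotaIso_toT (T_isHom g hv), smul_smul]
  have := ξ.2.γ_cocycle 1 1 g x
  simp only [one_mul] at this
  rw [mul_right_cancel this, Units.mul_inv, one_smul]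

theorem γ_one_right (g : 𝒳.G) (A : TwVec (omega ξ)) :
    (gammaIso ξ g 1).hom.app A ≫ (act ξ g).map ((iotaIso ξ).hom.app A) =
      eqToHom (congrArg (fun l => (act ξ l).obj A) (mul_one g)) := T_hom_ext fun x v hv => by
  rw [eqToHom_act (mul_one g), comp_lin_apply, gammaIso_toT _ _ hv, map_smul, act_map,
    iotaIso_toT hv]
  change _ • toT g A _ = _
  rw [map_smul, smul_smul]
  have := ξ.2.γ_cocycle g 1 1 x
  simp only [mul_one, one_smul] at this
  rw [← mul_right_cancel this, Units.mul_inv, one_smul]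

theorem T_braid {g h : 𝒳.G} {A : TwVec (omega ξ)} (hA : supp ξ h A) (B : TwVec (omega ξ)) :
    δ (act ξ g) A B ≫
        (braid (g * h * g⁻¹) ((act ξ g).obj A) (supp_T ξ hA) ((act ξ g).obj B)).hom ≫
        (gammaIso ξ (g * h * g⁻¹) g).inv.app B ▷ (act ξ g).obj A ≫
        eqToHom (congrArg (fun l => (act ξ l).obj B) (inv_mul_cancel_right (g * h) g)) ▷
          (act ξ g).obj A ≫
        (gammaIso ξ g h).hom.app B ▷ (act ξ g).obj A =
      (act ξ g).map (braid h A hA B).hom ≫ δ (act ξ g) ((act ξ h).obj B) A :=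
  T_tensor_hom_ext fun x v y w hv hw => by
    rcases eq_or_ne v 0 with rfl | h0
    · simp only [map_zero, LinearMap.zero_apply]
    obtain rfl := hA x v hv h0
    simp only [comp_lin_apply]
    rw [act_map, braid_tm hA hv hw, map_smul, map_smul, δ_tm g (T_isHom _ hw) hv, δ_tm g hv hw,
      map_smul, braid_tm _ (T_isHom g hv) (T_isHom g hw)]
    simp only [map_smul]
    rw [whiskerRight_tm, gammaIso_inv_toT _ _ hw]
    simp only [map_smul, LinearMap.smul_apply]
    rw [whiskerRight_tm, eqToHom_act (inv_mul_cancel_right (g * 𝒳.bd x) g), whiskerRight_tm,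
      gammaIso_toT _ _ hw]
    simp only [map_smul, LinearMap.smul_apply, smul_smul]
    congr 1
    have := congrArg Units.val (ξ.2.c_smul g x y)
    rw [𝒳.bd_smul]
    push_cast at this ⊢
    field_simp at this ⊢
    linear_combination this

theorem braid_tensor_left {g h : 𝒳.G} {A B : TwVec (omega ξ)} (hA : supp ξ g A) (hB : supp ξ h B)
    (hAB : supp ξ (g * h) (A ⊗ B)) (D : TwVec (omega ξ)) :
    (α_ A B D).inv ≫ (braid (g * h) (A ⊗ B) hAB D).hom ≫
        (gammaIso ξ g h).hom.app D ▷ (A ⊗ B) ≫ (α_ ((act ξ g).obj ((act ξ h).obj D)) A B).inv =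
      A ◁ (braid h B hB D).hom ≫ (α_ A ((act ξ h).obj D) B).inv ≫
        (braid g A hA ((act ξ h).obj D)).hom ▷ B :=
  tensor_hom_ext₃' fun x v y w z u hv hw hu => by
    rcases eq_or_ne v 0 with rfl | hv0
    · simp only [map_zero, LinearMap.zero_apply]
    rcases eq_or_ne w 0 with rfl | hw0
    · simp only [map_zero, LinearMap.zero_apply]
    obtain rfl := hA x v hv hv0
    obtain rfl := hB y w hw hw0
    simp only [comp_lin_apply]
    rw [whiskerLeft_tm, braid_tm hB hw hu, associator_inv_tm hv hw hu]
    simp only [map_smul]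
    rw [braid_tm hAB (tmul_isHom hv hw) hu, associator_inv_tm hv (T_isHom _ hu) hw]
    simp only [map_smul]
    rw [whiskerRight_tm, whiskerRight_tm, gammaIso_toT _ _ hu, braid_tm hA hv (T_isHom _ hu)]
    simp only [map_smul, LinearMap.smul_apply]
    rw [associator_inv_tm (T_isHom _ (T_isHom _ hu)) hv hw]
    simp only [smul_smul]
    congr 1
    have := congrArg Units.val (ξ.2.c_mul_left x y z)
    simp only [𝒳.bd_smul]
    have e1 : (𝒳.bd x * 𝒳.bd y) • z = x * y * z * (x * y)⁻¹ := by
      rw [← map_mul, 𝒳.bd_smul]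
    rw [e1]
    simp only [omega]
    push_cast at this ⊢
    rw [this]
    field_simp

theorem braid_tensor_right {g : 𝒳.G} {A : TwVec (omega ξ)} (hA : supp ξ g A)
    (B D : TwVec (omega ξ)) :
    (α_ A B D).hom ≫ (braid g A hA (B ⊗ D)).hom ≫ δ (act ξ g) B D ▷ A ≫
        (α_ ((act ξ g).obj B) ((act ξ g).obj D) A).hom =
      (braid g A hA B).hom ▷ D ≫ (α_ ((act ξ g).obj B) A D).hom ≫
        (act ξ g).obj B ◁ (braid g A hA D).hom :=
  tensor_hom_ext₃ fun x v y w z u hv hw hu => by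
    rcases eq_or_ne v 0 with rfl | hv0
    · simp only [map_zero, LinearMap.zero_apply]
    obtain rfl := hA x v hv hv0
    simp only [comp_lin_apply]
    rw [associator_tm hv hw hu, whiskerRight_tm, braid_tm hA hv hw]
    simp only [map_smul, LinearMap.smul_apply]
    rw [braid_tm hA hv (tmul_isHom hw hu), associator_tm (T_isHom _ hw) hv hu]
    simp only [map_smul]
    rw [whiskerRight_tm, whiskerLeft_tm, δ_tm _ hw hu, braid_tm hA hv hu]
    simp only [map_smul, LinearMap.smul_apply]
    rw [associator_tm (T_isHom _ hw) (T_isHom _ hu) hv]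
    simp only [smul_smul]
    congr 1
    have := congrArg Units.val (ξ.2.c_mul_right x y z)
    simp only [𝒳.bd_smul]
    simp only [omega]
    push_cast at this ⊢
    rw [this]
    field_simp

variable (ξ)

/-- The crossed structure on `Vec_X^ω` given by `(γ, μ, c)`. -/
def crossedStructure : CrossedStructure K (TwVec (omega ξ)) 𝒳.G where
  toGroupGrading := suppGrading ξ
  T := act ξ
  T_comp hA := supp_T ξ hA
  γ := gammaIso ξ
  ι := iotaIso ξ
  γ_assoc g h k A := T_hom_ext fun x v hv => by
    simp only [comp_lin_apply]
    rw [eqToHom_act (mul_assoc g h k), gammaIso_toT _ _ hv, gammaIso_toT _ _ hv, map_smul, map_smul,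
      gammaIso_toT _ _ (T_isHom k hv), act_map, gammaIso_toT _ _ hv, map_smul]
    simp only [smul_smul]
    congr 1
    have := congrArg Units.val (ξ.2.γ_cocycle g h k x)
    push_cast at this
    linear_combination -this
  γ_one_left := γ_one_left
  γ_one_right := γ_one_right
  c g A hA B := braid g A hA B
  c_natural_left hA hA' f B := tensor_hom_ext fun x v y w hv hw => by
    rw [comp_lin_apply, comp_lin_apply, whiskerRight_tm, braid_tm hA' (f.isHom _ _ hv) hw,
      braid_tm hA hv hw, map_smul, whiskerLeft_tm]
  c_natural_right hA B B' f := tensor_hom_ext fun x v y w hv hw => by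
    rw [comp_lin_apply, comp_lin_apply, whiskerLeft_tm, braid_tm hA hv (f.isHom _ _ hw),
      braid_tm hA hv hw, map_smul, whiskerRight_tm, act_map]
  T_c hA B := T_braid hA B
  c_tensor_left hA hB D := braid_tensor_left hA hB _ D
  c_tensor_right hA B D := braid_tensor_right hA B D

end Crossed

end Construction

/-- The crossed pointed category `C(ω, γ, μ, c)`, with underlying fusion category `Vec_X^ω`. -/
def catOf {K : Type w} [Field K] {𝒳 : FinCrossedModule.{a}} (ξ : Zqa 𝒳 K) :
    CrossedPointedCategory.{a, w, w, max a (w + 1)} K where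
  C := TwVec (omega ξ)
  fusion := TwVec.isFusion (omega ξ)
  pointed := TwVec.isPointed (omega ξ)
  G := 𝒳.G
  crossed := crossedStructure ξ

end

end CrossedPointed

open CrossedPointed

/-!
The argument is organized around the notion of a *framing* of a crossed category by a crossed module
`𝒳 = (G, X, ∂)` and a quadruple `ξ = (ω, γ, μ, c)` of functions (`Framing`): representatives `s x`
of the isomorphism classes of simple objects, indexed by `X`, and isomorphisms
`s (x * y) ≅ s x ⊗ s y` and `s (g • x) ≅ T_g (s x)`, in terms of which the associator, the
constraints of the action and the `G`-braiding are multiplication by the scalars `ξ`.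

* Every crossed pointed category has a framing (`CrossedPointedCategory.exists_framing`). By Schur's
  lemma all endomorphisms of simple objects are scalars. Simple objects being invertible, their
  isomorphism classes form a group `X`, on which `G` acts and which maps to `G` by the degree; the
  `G`-braiding `s x ⊗ s y ≅ T_g (s y) ⊗ s x` makes this a crossed module. The isomorphisms can be
  chosen arbitrarily, and the scalars then exist because isomorphisms between simple objects are
  unique up to scalars.
* The scalars of a framing form a quasi-abelian cocycle (`Framing.isQuasiAbelian`): each cocycle
  identity is one axiom of the crossed category evaluated on simple objects.
* A crossed pointed category framed by `(𝒳, ξ)` is equivalent to `C(ξ)`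
  (`Framing.crossedEquivalent`), by the functor sending `A` to the graded space `⨁ x, Hom(s x, A)`.
* `C(ξ)` is framed by `(𝒳, ξ)`, with the one-dimensional spaces as simple objects (`lineFraming`).
* Two framings of the same category differ by an isomorphism of crossed modules and a coboundary
  (`Framing.exists_eq_pullCochain_mul_coboundary`), and every such change can be realized
  (`Framing.change`). Framings can be transported along equivalences (`Framing.map`).

Together with the composition and inversion of crossed equivalences (`CrossedEquivalent.trans`,
`CrossedEquivalent.symm`), these facts show that `C(ξ)` and `C(ξ')` are equivalent exactly when the
orbits of `ξ` and `ξ'` correspond under an isomorphism of crossed modules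
(`catOf_crossedEquivalent_iff`), and that every crossed pointed category is some `C(ξ)`.
-/

namespace CrossedPointed

noncomputable section

/-! ### Bricks -/

section Brick

variable (K : Type w) [Field K] {C : Type u} [Category.{v} C] [Preadditive C] [Linear K C]

/-- A nonzero object all of whose endomorphisms are scalars. In a fusion category over an
algebraically closed field these are the simple objects; unlike simplicity, the condition is visibly
transported by fully faithful linear functors. -/
structure IsBrick (A : C) : Prop where
  id_ne_zero : 𝟙 A ≠ 0
  endo : ∀ φ : A ⟶ A, ∃ r : K, φ = r • 𝟙 A

/-- A family of pairwise non-isomorphic bricks such that every object is a direct sum of members of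
the family. For the direct sum decomposition only the resolution of the identity is recorded. -/
structure IsBrickBasis {X : Type a} (s : X → C) : Prop where
  brick : ∀ x, IsBrick K (s x)
  hom_eq_zero : ∀ {x y}, x ≠ y → ∀ φ : s x ⟶ s y, φ = 0
  decomp : ∀ A : C, ∃ (n : ℕ) (x : Fin n → X) (i : ∀ j, s (x j) ⟶ A) (p : ∀ j, A ⟶ s (x j)),
    ∑ j, p j ≫ i j = 𝟙 A

variable {K}

theorem IsBrick.of_iso {A B : C} (hA : IsBrick K A) (i : A ≅ B) : IsBrick K B where
  id_ne_zero h := hA.id_ne_zero <| by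
    rw [← i.hom_inv_id, ← Category.comp_id i.hom, h]
    simp
  endo φ := by
    obtain ⟨r, hr⟩ := hA.endo (i.hom ≫ φ ≫ i.inv)
    refine ⟨r, ?_⟩
    rw [← cancel_epi i.hom, ← cancel_mono i.inv, Category.assoc, hr]
    simp

/-- Two isomorphisms out of a brick differ by an invertible scalar. This is the source of all the
scalars below. -/
theorem IsBrick.exists_unit {A B : C} (hA : IsBrick K A) (i j : A ≅ B) :
    ∃ r : Kˣ, i.hom = (r : K) • j.hom := by
  obtain ⟨r, hr⟩ := hA.endo (i.hom ≫ j.inv)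
  have h : i.hom = r • j.hom := by
    rw [← cancel_mono j.inv, hr]; simp
  refine ⟨Units.mk0 r ?_, h⟩
  rintro rfl
  refine hA.id_ne_zero ?_
  rw [← i.hom_inv_id, h]
  simp

theorem IsBrick.ne_zero_of_isIso {A B : C} (hA : IsBrick K A) (i : A ⟶ B) [IsIso i] : i ≠ 0 := by
  rintro rfl
  exact hA.id_ne_zero (by rw [← IsIso.hom_inv_id (0 : A ⟶ B), zero_comp])

theorem IsBrick.smul_left_injective {A B : C} (hA : IsBrick K A) {i : A ⟶ B} [IsIso i] {r r' : K}
    (h : r • i = r' • i) : r = r' := by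
  have : (r - r') • i = 0 := by rw [sub_smul, h, sub_self]
  rcases smul_eq_zero.1 this with h | h
  · exact sub_eq_zero.1 h
  · exact absurd h (hA.ne_zero_of_isIso i)

theorem IsBrick.isIso {A B : C} (hA : IsBrick K A) (hB : IsBrick K B) {i : A ⟶ B} {p : B ⟶ A}
    (h : p ≫ i ≠ 0) : Nonempty (A ≅ B) := by
  obtain ⟨r, hr⟩ := hB.endo (p ≫ i)
  obtain ⟨r', hr'⟩ := hA.endo (i ≫ p)
  have hr0 : r ≠ 0 := by rintro rfl; exact h (by rw [hr, zero_smul])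
  have h1 : r' • i = r • i := by
    have := congrArg (· ≫ i) hr'
    simp only [Category.assoc, hr] at this
    simpa using this.symm
  have hi : i ≠ 0 := by rintro rfl; exact h comp_zero
  have h2 : r' = r := by
    have : (r' - r) • i = 0 := by rw [sub_smul, h1, sub_self]
    exact sub_eq_zero.1 ((smul_eq_zero.1 this).resolve_right hi)
  subst h2
  exact ⟨⟨i, r'⁻¹ • p, by rw [Linear.comp_smul, hr', smul_smul, inv_mul_cancel₀ hr0, one_smul],
    by rw [Linear.smul_comp, hr, smul_smul, inv_mul_cancel₀ hr0, one_smul]⟩⟩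

theorem IsBrick.of_full {D : Type u'} [Category.{v'} D] [Preadditive D] [Linear K D] {A : C}
    (hA : IsBrick K A) (F : C ⥤ D) [F.Additive] [F.Linear K] [F.Full] [F.Faithful] :
    IsBrick K (F.obj A) where
  id_ne_zero h := hA.id_ne_zero <| F.map_injective <| by
    rw [F.map_id, h, F.map_zero]
  endo φ := by
    obtain ⟨φ, rfl⟩ := F.map_surjective φ
    obtain ⟨r, rfl⟩ := hA.endo φ
    exact ⟨r, by rw [F.map_smul, F.map_id]⟩

theorem IsBrickBasis.exists_iso {X : Type a} {s : X → C} (hs : IsBrickBasis K s) {A : C}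
    (hA : IsBrick K A) : ∃ x, Nonempty (s x ≅ A) := by
  obtain ⟨n, x, i, p, h⟩ := hs.decomp A
  by_contra! hx
  refine hA.id_ne_zero ?_
  rw [← h]
  refine Finset.sum_eq_zero fun j _ => ?_
  by_contra h0
  exact (hx (x j)).false ((hs.brick (x j)).isIso hA h0).some

theorem IsBrickBasis.eq_of_iso {X : Type a} {s : X → C} (hs : IsBrickBasis K s) {x y : X}
    (i : s x ≅ s y) : x = y := by
  by_contra h
  exact (hs.brick x).ne_zero_of_isIso i.hom (hs.hom_eq_zero h _)

/-- An equivalence of categories maps a brick basis to a brick basis. -/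
theorem IsBrickBasis.map {D : Type u'} [Category.{v'} D] [Preadditive D] [Linear K D] {X : Type a}
    {s : X → C} (hs : IsBrickBasis K s) (F : C ⥤ D) [F.Additive] [F.Linear K] [F.IsEquivalence] :
    IsBrickBasis K fun x => F.obj (s x) where
  brick x := (hs.brick x).of_full F
  hom_eq_zero h φ := by
    obtain ⟨φ, rfl⟩ := F.map_surjective φ
    rw [hs.hom_eq_zero h φ, F.map_zero]
  decomp A := by
    obtain ⟨n, x, i, p, h⟩ := hs.decomp (F.objPreimage A)
    refine ⟨n, x, fun j => F.map (i j) ≫ (F.objObjPreimageIso A).hom,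
      fun j => (F.objObjPreimageIso A).inv ≫ F.map (p j), ?_⟩
    have h1 := congrArg (fun k => (F.objObjPreimageIso A).inv ≫ F.map k ≫
      (F.objObjPreimageIso A).hom) h
    simpa [F.map_sum, Preadditive.sum_comp, Preadditive.comp_sum] using h1

end Brick

/-! ### Framings of crossed categories -/

open Functor.OplaxMonoidal

section Framing

variable {K : Type w} [Field K] {C : Type u} [Category.{v} C] [Preadditive C] [Linear K C]
  [MonoidalCategory C] {G : Type b} [Group G]

/-- A framing of a crossed category by a crossed module `𝒳` and a quadruple `ξ = (ω, γ, μ, c)`: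
a basis of simple objects `s x` indexed by `𝒳.X`, together with isomorphisms
`s (x * y) ≅ s x ⊗ s y` and `s (g • x) ≅ T_g (s x)` with respect to which the constraints of the
crossed category are given by the scalars `ω`, `γ`, `μ` and `c`. The index of the source of
such an isomorphism is a free variable constrained by an equation, so that associativity in `𝒳.X`
does not have to be transported along. -/
structure Framing (S : CrossedStructure K C G) (𝒳 : FinCrossedModule.{a}) (ξ : Cochain 𝒳 K) where
  f : G ≃* 𝒳.G
  s : 𝒳.X → C
  basis : IsBrickBasis K s
  comp : ∀ {g x}, f g = 𝒳.bd x → S.comp g (s x)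
  m : ∀ {x y z}, x * y = z → (s z ≅ s x ⊗ s y)
  t : ∀ g {x y}, f g • x = y → (s y ≅ (S.T g).obj (s x))
  m_assoc : ∀ {x y z xy yz xyz} (h1 : x * y = xy) (h2 : xy * z = xyz) (h3 : y * z = yz)
    (h4 : x * yz = xyz), (m h2).hom ≫ (m h1).hom ▷ s z ≫ (α_ (s x) (s y) (s z)).hom =
      (ξ.ω x y z : K) • (m h4).hom ≫ s x ◁ (m h3).hom
  t_δ : ∀ g {x y xy gx gy gxy} (h1 : x * y = xy) (h2 : f g • xy = gxy) (h3 : f g • x = gx)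
    (h4 : f g • y = gy) (h5 : gx * gy = gxy),
    (t g h2).hom ≫ (S.T g).map (m h1).hom ≫ δ (S.T g) (s x) (s y) =
      (ξ.μ (f g) x y : K) • (m h5).hom ≫ ((t g h3).hom ⊗ₘ (t g h4).hom)
  t_γ : ∀ g h {x hx ghx} (h1 : f (g * h) • x = ghx) (h2 : f h • x = hx) (h3 : f g • hx = ghx),
    (t (g * h) h1).hom ≫ (S.γ g h).hom.app (s x) =
      (ξ.γ (f g) (f h) x : K) • (t g h3).hom ≫ (S.T g).map (t h h2).hom
  m_c : ∀ {g x y xy z} (hg : f g = 𝒳.bd x) (h1 : x * y = xy) (h2 : f g • y = z) (h3 : z * x = xy),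
    (m h1).hom ≫ (S.c g (s x) (comp hg) (s y)).hom =
      (ξ.c x y : K) • (m h3).hom ≫ (t g h2).hom ▷ s x

namespace Framing

variable {S : CrossedStructure K C G} {𝒳 : FinCrossedModule.{a}} {ξ : Cochain 𝒳 K}
  (Θ : Framing S 𝒳 ξ)

/-- The product of `φ : s x ⟶ A` and `ψ : s y ⟶ B`. -/
def star {x y z : 𝒳.X} (h : x * y = z) {A B : C} (φ : Θ.s x ⟶ A) (ψ : Θ.s y ⟶ B) :
    Θ.s z ⟶ A ⊗ B := (Θ.m h).hom ≫ (φ ⊗ₘ ψ)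

/-- The translate of `φ : s x ⟶ A` by `g`. -/
def tr (g : G) {x y : 𝒳.X} (h : Θ.f g • x = y) {A : C} (φ : Θ.s x ⟶ A) :
    Θ.s y ⟶ (S.T g).obj A := (Θ.t g h).hom ≫ (S.T g).map φ

section

variable {x y z xy yz xyz : 𝒳.X} {A B D A' B' : C}

instance (h : x * y = z) (φ : Θ.s x ⟶ A) (ψ : Θ.s y ⟶ B) [IsIso φ] [IsIso ψ] :
    IsIso (Θ.star h φ ψ) := by unfold star; infer_instance

instance (g : G) (h : Θ.f g • x = y) (φ : Θ.s x ⟶ A) [IsIso φ] : IsIso (Θ.tr g h φ) := by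
  unfold tr; infer_instance

theorem star_comp (h : x * y = z) (φ : Θ.s x ⟶ A) (ψ : Θ.s y ⟶ B) (k : A ⟶ A') (l : B ⟶ B') :
    Θ.star h φ ψ ≫ (k ⊗ₘ l) = Θ.star h (φ ≫ k) (ψ ≫ l) := by simp [star]

theorem star_whiskerRight (h : x * y = z) (φ : Θ.s x ⟶ A) (ψ : Θ.s y ⟶ B) (k : A ⟶ A') :
    Θ.star h φ ψ ≫ k ▷ B = Θ.star h (φ ≫ k) ψ := by
  rw [← tensorHom_id, star_comp, Category.comp_id]

theorem star_whiskerLeft (h : x * y = z) (φ : Θ.s x ⟶ A) (ψ : Θ.s y ⟶ B) (l : B ⟶ B') :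
    Θ.star h φ ψ ≫ A ◁ l = Θ.star h φ (ψ ≫ l) := by
  rw [← id_tensorHom, star_comp, Category.comp_id]

theorem tr_map (g : G) (h : Θ.f g • x = y) (φ : Θ.s x ⟶ A) (k : A ⟶ A') :
    Θ.tr g h φ ≫ (S.T g).map k = Θ.tr g h (φ ≫ k) := by simp [tr]

theorem tr_eqToHom {g g' : G} (p : g = g') (h : Θ.f g • x = y) (h' : Θ.f g' • x = y)
    (φ : Θ.s x ⟶ A) :
    Θ.tr g h φ ≫ eqToHom (congrArg (fun l => (S.T l).obj A) p) = Θ.tr g' h' φ := by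
  subst p; simp

/-! The defining relations of a framing, in terms of `star` and `tr`. -/

theorem star_assoc (h1 : x * y = xy) (h2 : xy * z = xyz) (h3 : y * z = yz) (h4 : x * yz = xyz)
    (φ : Θ.s x ⟶ A) (ψ : Θ.s y ⟶ B) (χ : Θ.s z ⟶ D) :
    Θ.star h2 (Θ.star h1 φ ψ) χ ≫ (α_ A B D).hom =
      (ξ.ω x y z : K) • Θ.star h4 φ (Θ.star h3 ψ χ) := by
  have h := Θ.m_assoc h1 h2 h3 h4
  have e1 : (Θ.m h1).hom ≫ (φ ⊗ₘ ψ) ⊗ₘ χ =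
      (Θ.m h1).hom ▷ Θ.s z ≫ ((φ ⊗ₘ ψ) ⊗ₘ χ) := by
    rw [← tensorHom_id, tensorHom_comp_tensorHom, Category.id_comp]
  have e2 : φ ⊗ₘ ((Θ.m h3).hom ≫ (ψ ⊗ₘ χ)) =
      Θ.s x ◁ (Θ.m h3).hom ≫ (φ ⊗ₘ (ψ ⊗ₘ χ)) := by
    rw [← id_tensorHom, tensorHom_comp_tensorHom, Category.id_comp]
  simp only [star]
  rw [e1, e2, Category.assoc, Category.assoc, associator_naturality]
  have := congrArg (· ≫ (φ ⊗ₘ (ψ ⊗ₘ χ))) h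
  simpa only [Category.assoc, Linear.smul_comp] using this

theorem tr_δ (g : G) {gx gy gxy : 𝒳.X} (h1 : x * y = xy) (h2 : Θ.f g • xy = gxy)
    (h3 : Θ.f g • x = gx) (h4 : Θ.f g • y = gy) (h5 : gx * gy = gxy)
    (φ : Θ.s x ⟶ A) (ψ : Θ.s y ⟶ B) :
    Θ.tr g h2 (Θ.star h1 φ ψ) ≫ δ (S.T g) A B =
      (ξ.μ (Θ.f g) x y : K) • Θ.star h5 (Θ.tr g h3 φ) (Θ.tr g h4 ψ) := by
  have h := congrArg (· ≫ ((S.T g).map φ ⊗ₘ (S.T g).map ψ)) (Θ.t_δ g h1 h2 h3 h4 h5)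
  simp only [Category.assoc, Linear.smul_comp, δ_natural, tensorHom_comp_tensorHom] at h
  simpa only [tr, star, Functor.map_comp, Category.assoc] using h

theorem tr_γ (g h : G) {hx ghx : 𝒳.X} (h1 : Θ.f (g * h) • x = ghx) (h2 : Θ.f h • x = hx)
    (h3 : Θ.f g • hx = ghx) (φ : Θ.s x ⟶ A) :
    Θ.tr (g * h) h1 φ ≫ (S.γ g h).hom.app A =
      (ξ.γ (Θ.f g) (Θ.f h) x : K) • Θ.tr g h3 (Θ.tr h h2 φ) := by
  have := congrArg (· ≫ (S.T g).map ((S.T h).map φ)) (Θ.t_γ g h h1 h2 h3)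
  simp only [Category.assoc, Linear.smul_comp] at this
  rw [tr, Category.assoc, (S.γ g h).hom.naturality, Functor.comp_map, this]
  simp only [tr, Functor.map_comp]

theorem star_c {g : G} (hg : Θ.f g = 𝒳.bd x) (hA : S.comp g A) (h1 : x * y = xy)
    (h2 : Θ.f g • y = z) (h3 : z * x = xy) (φ : Θ.s x ⟶ A) (ψ : Θ.s y ⟶ B) :
    Θ.star h1 φ ψ ≫ (S.c g A hA B).hom = (ξ.c x y : K) • Θ.star h3 (Θ.tr g h2 ψ) φ := by
  have := congrArg (· ≫ ((S.T g).map ψ ⊗ₘ φ)) (Θ.m_c hg h1 h2 h3)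
  simp only [Category.assoc, Linear.smul_comp] at this
  rw [star, Category.assoc, MonoidalCategory.tensorHom_def', Category.assoc,
    S.c_natural_left (Θ.comp hg) hA,
    ← Category.assoc (Θ.s x ◁ ψ), S.c_natural_right, Category.assoc,
    ← MonoidalCategory.tensorHom_def, this]
  simp only [star, tr]
  rw [← tensorHom_id, tensorHom_comp_tensorHom, Category.id_comp]

end

end Framing

end Framing

/-! ### The scalars of a framing form a quasi-abelian 3-cocycle -/

open Functor.OplaxMonoidal

/-- The compatibility of a monoidal transformation with the oplax structures. -/
theorem δ_comp_app {C : Type u} [Category.{v} C] [MonoidalCategory C] {D : Type u'}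
    [Category.{v'} D] [MonoidalCategory D] {F F' : C ⥤ D} [F.Monoidal] [F'.Monoidal] (τ : F ⟶ F')
    [NatTrans.IsMonoidal τ] (X Y : C) :
    δ F X Y ≫ (τ.app X ⊗ₘ τ.app Y) = τ.app (X ⊗ Y) ≫ δ F' X Y := by
  rw [← cancel_epi (Functor.LaxMonoidal.μ F X Y), Functor.Monoidal.μ_δ_assoc,
    NatTrans.IsMonoidal.tensor_assoc, Functor.Monoidal.μ_δ, Category.comp_id]

namespace Framing

variable {K : Type w} [Field K] {C : Type u} [Category.{v} C] [Preadditive C] [Linear K C]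
  [MonoidalCategory C] {G : Type b} [Group G] {S : CrossedStructure K C G}
  {𝒳 : FinCrossedModule.{a}} {ξ : Cochain 𝒳 K}

section

variable (Θ : Framing S 𝒳 ξ)

variable {x y z xy yz xyz : 𝒳.X} {A B D : C}

theorem tr_smul (g : G) (h : Θ.f g • x = y) (r : K) (φ : Θ.s x ⟶ A) :
    Θ.tr g h (r • φ) = r • Θ.tr g h φ := by
  simp [tr, Functor.map_smul]

theorem tr_γ_inv (g h : G) {hx ghx : 𝒳.X} (h1 : Θ.f (g * h) • x = ghx) (h2 : Θ.f h • x = hx)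
    (h3 : Θ.f g • hx = ghx) (φ : Θ.s x ⟶ A) :
    Θ.tr g h3 (Θ.tr h h2 φ) ≫ (S.γ g h).inv.app A =
      (((ξ.γ (Θ.f g) (Θ.f h) x)⁻¹ : Kˣ) : K) • Θ.tr (g * h) h1 φ := by
  rw [← cancel_mono ((S.γ g h).hom.app A), Category.assoc, Iso.inv_hom_id_app, Linear.smul_comp,
    Θ.tr_γ g h h1 h2 h3, smul_smul, Units.inv_mul, one_smul]
  exact Category.comp_id _

theorem star_assoc_inv (h1 : x * y = xy) (h2 : xy * z = xyz) (h3 : y * z = yz) (h4 : x * yz = xyz)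
    (φ : Θ.s x ⟶ A) (ψ : Θ.s y ⟶ B) (χ : Θ.s z ⟶ D) :
    Θ.star h4 φ (Θ.star h3 ψ χ) ≫ (α_ A B D).inv =
      (((ξ.ω x y z)⁻¹ : Kˣ) : K) • Θ.star h2 (Θ.star h1 φ ψ) χ := by
  rw [← cancel_mono (α_ A B D).hom, Category.assoc, Iso.inv_hom_id, Linear.smul_comp,
    Θ.star_assoc h1 h2 h3 h4, smul_smul, Units.inv_mul, one_smul, Category.comp_id]

end

/-- From the associativity of `γ`. -/
theorem γ_cocycle (Θ : Framing S 𝒳 ξ) (g h k : 𝒳.G) (x : 𝒳.X) :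
    ξ.γ h k x * ξ.γ g (h * k) x = ξ.γ g h (k • x) * ξ.γ (g * h) k x := by
  obtain ⟨g, rfl⟩ := Θ.f.surjective g
  obtain ⟨h, rfl⟩ := Θ.f.surjective h
  obtain ⟨k, rfl⟩ := Θ.f.surjective k
  have key := congrArg (Θ.tr (g * h * k) rfl (𝟙 (Θ.s x)) ≫ ·) (S.γ_assoc g h k (Θ.s x))
  have e1 : Θ.f (g * h) • Θ.f k • x = Θ.f (g * h * k) • x := by simp [mul_smul]
  have e2 : Θ.f g • Θ.f h • Θ.f k • x = Θ.f (g * h * k) • x := by simp [mul_smul]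
  have e3 : Θ.f (g * (h * k)) • x = Θ.f (g * h * k) • x := by simp [mul_smul]
  have e4 : Θ.f (h * k) • x = Θ.f h • Θ.f k • x := by simp [mul_smul]
  simp only [← Category.assoc] at key
  rw [Θ.tr_γ (g * h) k rfl rfl e1, Linear.smul_comp,
    Θ.tr_γ g h _ rfl e2, smul_smul (M := K), Θ.tr_eqToHom (mul_assoc g h k) _ e3,
    Θ.tr_γ g (h * k) _ e4 e2, Linear.smul_comp, Θ.tr_map,
    Θ.tr_γ h k _ rfl rfl, Θ.tr_smul, smul_smul (M := K)] at key
  have h2 := (Θ.basis.brick _).smul_left_injective key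
  refine Units.ext ?_
  push_cast
  rw [map_mul, map_mul] at h2
  linear_combination -h2

variable [MonoidalPreadditive C] [MonoidalLinear K C]

section

variable (Θ : Framing S 𝒳 ξ)

variable {x y z xy yz xyz : 𝒳.X} {A B D : C}

theorem star_smul_left (h : x * y = z) (r : K) (φ : Θ.s x ⟶ A) (ψ : Θ.s y ⟶ B) :
    Θ.star h (r • φ) ψ = r • Θ.star h φ ψ := by
  simp [star, MonoidalCategory.tensorHom_def]

theorem star_smul_right (h : x * y = z) (r : K) (φ : Θ.s x ⟶ A) (ψ : Θ.s y ⟶ B) :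
    Θ.star h φ (r • ψ) = r • Θ.star h φ ψ := by
  simp [star, MonoidalCategory.tensorHom_def]

end

/-! Each cocycle identity is obtained by evaluating one axiom of the crossed category on products
of identity morphisms of the `s x`, and comparing scalars. -/

/-- From the pentagon. -/
theorem ω_cocycle (Θ : Framing S 𝒳 ξ) : ξ.ω ∈ Z3 𝒳.X K := by
  intro t x y z
  have h := congrArg (Θ.star (z := t * (x * (y * z))) (by simp only [mul_assoc])
    (Θ.star (rfl : t * x * y = _) (Θ.star (rfl : t * x = _) (𝟙 (Θ.s t)) (𝟙 (Θ.s x)))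
      (𝟙 (Θ.s y))) (𝟙 (Θ.s z)) ≫ ·) (MonoidalCategory.pentagon (Θ.s t) (Θ.s x) (Θ.s y) (Θ.s z))
  simp only [← Category.assoc] at h
  rw [Θ.star_whiskerRight, Θ.star_assoc rfl rfl (rfl : x * y = _) (mul_assoc _ _ _).symm,
    Θ.star_smul_left, Linear.smul_comp,
    Θ.star_assoc (yz := x * (y * z)) _ _ (by simp only [mul_assoc]) rfl, smul_smul (M := K),
    Linear.smul_comp, Θ.star_whiskerLeft,
    Θ.star_assoc (yz := y * z) _ _ rfl rfl, Θ.star_smul_right, smul_smul (M := K),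
    Θ.star_assoc (yz := y * z) _ _ rfl (by simp only [mul_assoc]), Linear.smul_comp,
    Θ.star_assoc (yz := x * (y * z)) _ _ rfl rfl, smul_smul (M := K)] at h
  have h2 := (Θ.basis.brick _).smul_left_injective h
  refine Units.ext ?_
  push_cast
  linear_combination h2

/-- From the compatibility of `T_g` with the associator. -/
theorem μ_ω (Θ : Framing S 𝒳 ξ) (g : 𝒳.G) (x y z : 𝒳.X) :
    ξ.μ g y z * ξ.μ g x (y * z) / (ξ.μ g (x * y) z * ξ.μ g x y) =
      ξ.ω (g • x) (g • y) (g • z) / ξ.ω x y z := by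
  obtain ⟨g, rfl⟩ := Θ.f.surjective g
  have h := congrArg (Θ.tr g rfl (Θ.star rfl (Θ.star rfl (𝟙 (Θ.s x)) (𝟙 (Θ.s y)))
    (𝟙 (Θ.s z))) ≫ ·) (associativity (S.T g) (Θ.s x) (Θ.s y) (Θ.s z))
  simp only [← Category.assoc] at h
  rw [Θ.tr_δ g _ _ rfl rfl (by simp only [smul_mul']), Linear.smul_comp, Θ.star_whiskerRight,
    Θ.tr_δ g _ _ rfl rfl (by simp only [smul_mul']), Θ.star_smul_left, smul_smul (M := K),
    Linear.smul_comp,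
    Θ.star_assoc _ _ rfl (by simp only [smul_mul', mul_assoc]), smul_smul (M := K), Θ.tr_map,
    Θ.star_assoc _ _ rfl (by simp only [mul_assoc]), Θ.tr_smul, Linear.smul_comp,
    Θ.tr_δ g _ _ rfl (smul_mul' _ _ _) (by simp only [smul_mul', mul_assoc]),
    Linear.smul_comp, Linear.smul_comp, Θ.star_whiskerLeft,
    Θ.tr_δ g _ _ rfl rfl rfl, Θ.star_smul_right, smul_smul (M := K), smul_smul (M := K)] at h
  have h2 := (Θ.basis.brick _).smul_left_injective h
  refine Units.ext ?_
  push_cast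
  field_simp
  linear_combination -h2

/-- From the monoidality of `T_{gh} ⟶ T_g T_h`. -/
theorem γ_μ (Θ : Framing S 𝒳 ξ) (g h : 𝒳.G) (x y : 𝒳.X) :
    ξ.γ g h x * ξ.γ g h y / ξ.γ g h (x * y) =
      ξ.μ g (h • x) (h • y) * ξ.μ h x y / ξ.μ (g * h) x y := by
  obtain ⟨g, rfl⟩ := Θ.f.surjective g
  obtain ⟨h, rfl⟩ := Θ.f.surjective h
  have e : ∀ z : 𝒳.X, Θ.f g • Θ.f h • z = Θ.f (g * h) • z := fun z => by rw [map_mul, mul_smul]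
  have key := congrArg (Θ.tr (g * h) rfl (Θ.star rfl (𝟙 (Θ.s x)) (𝟙 (Θ.s y))) ≫ ·)
    (δ_comp_app (S.γ g h).hom (Θ.s x) (Θ.s y))
  rw [Functor.OplaxMonoidal.comp_δ] at key
  simp only [← Category.assoc] at key
  rw [Θ.tr_δ (g * h) _ _ rfl rfl (smul_mul' _ _ _).symm, Linear.smul_comp, Θ.star_comp,
    Θ.tr_γ g h _ rfl (e _), Θ.tr_γ g h _ rfl (e _), Θ.star_smul_left, Θ.star_smul_right,
    Θ.tr_γ g h _ rfl (e _), Linear.smul_comp, Θ.tr_map, Θ.tr_δ h _ _ rfl rfl (smul_mul' _ _ _).symm,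
    Θ.tr_smul, smul_smul (M := K), smul_smul (M := K), smul_smul (M := K), Linear.smul_comp,
    Θ.tr_δ g _ _ (e _) (e _) (smul_mul' _ _ _).symm, smul_smul (M := K)] at key
  have h2 := (Θ.basis.brick _).smul_left_injective key
  refine Units.ext ?_
  push_cast
  rw [map_mul] at h2
  field_simp
  linear_combination h2

/-- From the compatibility of the `G`-braiding with the action. -/
theorem c_smul (Θ : Framing S 𝒳 ξ) (g : 𝒳.G) (x y : 𝒳.X) : ξ.c (g • x) (g • y) / ξ.c x y =
    ξ.μ g (x * y * x⁻¹) x / ξ.μ g x y * (ξ.γ (g * 𝒳.bd x * g⁻¹) g y / ξ.γ g (𝒳.bd x) y) := by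
  obtain ⟨g, rfl⟩ := Θ.f.surjective g
  obtain ⟨h, hh⟩ := Θ.f.surjective (𝒳.bd x)
  have hy : Θ.f h • y = x * y * x⁻¹ := by rw [hh, 𝒳.bd_smul]
  have key := congrArg (Θ.tr g rfl (Θ.star rfl (𝟙 (Θ.s x)) (𝟙 (Θ.s y))) ≫ ·)
    (S.T_c (g := g) (Θ.comp hh) (Θ.s y))
  simp only [← Category.assoc] at key
  have e1 : Θ.f h • y * x = x * y := by rw [hy, inv_mul_cancel_right]
  have e2 : Θ.f g • Θ.f h • y * Θ.f g • x = Θ.f g • (x * y) := by rw [← smul_mul', e1]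
  rw [Θ.tr_δ g _ _ rfl rfl (smul_mul' _ _ _).symm, Linear.smul_comp,
    Θ.star_c (z := Θ.f g • Θ.f h • y) (by simp [hh, 𝒳.smul_bd]) _ _ (by simp [mul_smul]) e2,
    smul_smul (M := K), Linear.smul_comp, Linear.smul_comp, Linear.smul_comp, Θ.star_whiskerRight,
    Θ.tr_γ_inv _ _ (by simp [mul_smul]), Θ.star_smul_left, Linear.smul_comp, Linear.smul_comp,
    Θ.star_whiskerRight, Θ.tr_eqToHom (inv_mul_cancel_right (g * h) g) _ (by simp [mul_smul]),
    Θ.star_whiskerRight, Θ.tr_γ g h _ rfl rfl, Θ.star_smul_left, smul_smul (M := K),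
    smul_smul (M := K),
    Θ.tr_map, Θ.star_c hh _ _ rfl e1, Θ.tr_smul, Linear.smul_comp,
    Θ.tr_δ g _ _ rfl rfl e2, smul_smul (M := K)] at key
  have h2 := (Θ.basis.brick _).smul_left_injective key
  simp only [map_mul, map_inv, hh, 𝒳.bd_smul] at h2
  refine Units.ext ?_
  push_cast at h2 ⊢
  field_simp at h2 ⊢
  linear_combination h2

/-- From the first hexagon. -/
theorem c_mul_left (Θ : Framing S 𝒳 ξ) (x y z : 𝒳.X) : ξ.c (x * y) z =
    ξ.ω x y z * ξ.ω (x * y * z * (x * y)⁻¹) x y /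
      (ξ.ω x (y * z * y⁻¹) y * ξ.γ (𝒳.bd x) (𝒳.bd y) z) * ξ.c x (y * z * y⁻¹) * ξ.c y z := by
  obtain ⟨g, hg⟩ := Θ.f.surjective (𝒳.bd x)
  obtain ⟨h, hh⟩ := Θ.f.surjective (𝒳.bd y)
  have hz : Θ.f h • z = y * z * y⁻¹ := by rw [hh, 𝒳.bd_smul]
  have gz : Θ.f g • Θ.f h • z = x * y * z * (x * y)⁻¹ := by
    rw [hz, hg, 𝒳.bd_smul]; group
  have key := congrArg (Θ.star rfl (𝟙 (Θ.s x)) (Θ.star rfl (𝟙 (Θ.s y)) (𝟙 (Θ.s z))) ≫ ·)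
    (S.c_tensor_left (Θ.comp hg) (Θ.comp hh) (Θ.s z))
  simp only [← Category.assoc] at key
  have e1 : Θ.f g • Θ.f h • z * (x * y) = x * (y * z) := by rw [gz]; group
  have e2 : Θ.f g • Θ.f h • z * x * y = x * (y * z) := by rw [gz]; group
  have e3 : Θ.f h • z * y = y * z := by rw [hz]; group
  have e4 : Θ.f g • Θ.f h • z * x = x * Θ.f h • z := by rw [gz, hz]; group
  have e5 : x * Θ.f h • z * y = x * (y * z) := by rw [hz]; group
  have e6 : Θ.f (g * h) • z = Θ.f g • Θ.f h • z := by simp [mul_smul]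
  rw [Θ.star_assoc_inv rfl (mul_assoc _ _ _), Linear.smul_comp,
    Θ.star_c (by simp [hg, hh]) _ _ e6 e1, smul_smul (M := K), Linear.smul_comp,
    Θ.star_whiskerRight, Θ.tr_γ g h _ rfl rfl, Θ.star_smul_left, smul_smul (M := K),
    Linear.smul_comp] at key
  dsimp only [Functor.comp_obj] at key
  rw [Θ.star_assoc_inv e4 e5, smul_smul (M := K), Θ.star_whiskerLeft, Θ.star_c hh _ _ rfl e3,
    Θ.star_smul_right, Linear.smul_comp, Linear.smul_comp, Θ.star_assoc_inv rfl e5,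
    Linear.smul_comp, Θ.star_whiskerRight, Θ.star_c hg _ _ rfl e4, Θ.star_smul_left,
    smul_smul (M := K), smul_smul (M := K)] at key
  have h2 := (Θ.basis.brick _).smul_left_injective key
  rw [gz, hz, hh, hg] at h2
  refine Units.ext ?_
  push_cast at h2 ⊢
  field_simp at h2 ⊢
  linear_combination h2

/-- From the second hexagon. -/
theorem c_mul_right (Θ : Framing S 𝒳 ξ) (x y z : 𝒳.X) : ξ.c x (y * z) =
    ξ.ω (x * y * x⁻¹) x z /
      (ξ.ω x y z * ξ.ω (x * y * x⁻¹) (x * z * x⁻¹) x * ξ.μ (𝒳.bd x) y z) * ξ.c x y * ξ.c x z := by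
  obtain ⟨g, hg⟩ := Θ.f.surjective (𝒳.bd x)
  have hy : ∀ y, Θ.f g • y = x * y * x⁻¹ := fun y => by rw [hg, 𝒳.bd_smul]
  have key := congrArg (Θ.star rfl (Θ.star rfl (𝟙 (Θ.s x)) (𝟙 (Θ.s y))) (𝟙 (Θ.s z)) ≫ ·)
    (S.c_tensor_right (Θ.comp hg) (Θ.s y) (Θ.s z))
  simp only [← Category.assoc] at key
  have e1 : Θ.f g • (y * z) * x = x * y * z := by rw [hy]; group
  have e2 : ∀ y, Θ.f g • y * x = x * y := fun y => by rw [hy]; group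
  have e3 : Θ.f g • y * (x * z) = x * y * z := by rw [hy]; group
  rw [Θ.star_assoc _ _ rfl (mul_assoc _ _ _).symm, Linear.smul_comp, Θ.star_c hg _ _ rfl e1,
    smul_smul (M := K), Linear.smul_comp, Θ.star_whiskerRight,
    Θ.tr_δ g _ _ rfl rfl (smul_mul' _ _ _).symm, Θ.star_smul_left, smul_smul (M := K),
    Linear.smul_comp, Θ.star_assoc _ _ (e2 z) e3, smul_smul (M := K),
    Θ.star_whiskerRight, Θ.star_c hg _ _ rfl (e2 y), Θ.star_smul_left, Linear.smul_comp,
    Θ.star_assoc _ _ rfl e3, smul_smul (M := K), Linear.smul_comp, Θ.star_whiskerLeft,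
    Θ.star_c hg _ _ rfl (e2 z), Θ.star_smul_right, smul_smul (M := K)] at key
  have h2 := (Θ.basis.brick _).smul_left_injective key
  simp only [hg, 𝒳.bd_smul] at h2
  refine Units.ext ?_
  push_cast at h2 ⊢
  field_simp at h2 ⊢
  linear_combination h2

theorem isQuasiAbelian (Θ : Framing S 𝒳 ξ) : IsQuasiAbelian ξ :=
  ⟨Θ.ω_cocycle, Θ.γ_cocycle, Θ.μ_ω, Θ.γ_μ, Θ.c_smul, Θ.c_mul_left, Θ.c_mul_right⟩

end Framing

/-! ### The functor from a framed category to graded vector spaces -/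

theorem small_of_finite (K : Type w) [Field K] (M : Type v) [AddCommGroup M] [Module K M]
    [Module.Finite K M] : Small.{w} M :=
  Small.mk' (Module.finBasis K M).equivFun.toEquiv

/-- A natural transformation of additive functors is an isomorphism if it is so on a brick basis. -/
theorem IsBrickBasis.isIso_app {K : Type w} [Field K] {C : Type u} [Category.{v} C] [Preadditive C]
    [Linear K C] {X : Type a} {s : X → C} (hs : IsBrickBasis K s) {D : Type u'} [Category.{v'} D]
    [Preadditive D] {F F' : C ⥤ D} [F.Additive] [F'.Additive] (τ : F ⟶ F')
    (h : ∀ x, IsIso (τ.app (s x))) (A : C) : IsIso (τ.app A) := by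
  obtain ⟨n, x, i, p, hip⟩ := hs.decomp A
  refine ⟨∑ j, F'.map (p j) ≫ inv (τ.app (s (x j))) ≫ F.map (i j), ?_, ?_⟩
  · rw [Preadditive.comp_sum, ← F.map_id, ← hip, F.map_sum]
    refine Finset.sum_congr rfl fun j _ => ?_
    rw [← τ.naturality_assoc, IsIso.hom_inv_id_assoc, F.map_comp]
  · rw [Preadditive.sum_comp, ← F'.map_id, ← hip, F'.map_sum]
    refine Finset.sum_congr rfl fun j _ => ?_
    rw [Category.assoc, Category.assoc, τ.naturality, IsIso.inv_hom_id_assoc, F'.map_comp]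

/-- Bijectivity of a morphism of graded vector spaces can be checked on homogeneous vectors. -/
theorem TwVec.isIso_of_isHom {K : Type w} [Field K] {X : Type a} [Group X] [Fintype X]
    [DecidableEq X] {ω : Z3 X K} {A B : TwVec ω} (f : A ⟶ B)
    (inj : ∀ x v, A.gr.IsHom x v → f.lin v = 0 → v = 0)
    (surj : ∀ x w, B.gr.IsHom x w → ∃ v, f.lin v = w) : IsIso f := by
  have h1 : Function.Injective f.lin := by
    rw [injective_iff_map_eq_zero]
    intro v hv
    rw [← A.gr.sum_proj v]
    refine Finset.sum_eq_zero fun x _ => inj x _ (A.gr.isHom_proj x v) ?_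
    rw [lin_proj, hv, map_zero]
  have h2 : Function.Surjective f.lin := fun w =>
    B.gr.induction (P := fun w => ∃ v, f.lin v = w) ⟨0, map_zero _⟩
      (by rintro _ _ ⟨v, rfl⟩ ⟨v', rfl⟩; exact ⟨v + v', map_add _ _ _⟩) surj w
  exact (isoMk (LinearEquiv.ofBijective f.lin ⟨h1, h2⟩) f.isHom).isIso_hom

namespace Framing

variable {K : Type w} [Field K] {C : Type u} [Category.{v} C] [Preadditive C] [Linear K C]
  [MonoidalCategory C] {G : Type b} [Group G] {S : CrossedStructure K C G}
  {𝒳 : FinCrossedModule.{a}}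

section Vec

variable {ξ : Zqa 𝒳 K} (Θ : Framing S 𝒳 ξ.1) [∀ A B : C, Module.Finite K (A ⟶ B)]

instance (A : C) : Small.{w} (∀ x, Θ.s x ⟶ A) := small_of_finite K _

/-- The underlying space `⨁ x, Hom(s x, A)` of the graded vector space attached to `A`, moved to
the universe of `K`. -/
def Vec (A : C) : Type w := Shrink.{w} (∀ x, Θ.s x ⟶ A)

instance (A : C) : AddCommGroup (Θ.Vec A) := inferInstanceAs (AddCommGroup (Shrink.{w} _))
instance (A : C) : Module K (Θ.Vec A) := inferInstanceAs (Module K (Shrink.{w} _))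

/-- `Vec` is linearly isomorphic to the product it encodes. -/
def vecEquiv (A : C) : Θ.Vec A ≃ₗ[K] ∀ x, Θ.s x ⟶ A := Shrink.linearEquiv K _

instance (A : C) : Module.Finite K (Θ.Vec A) := Module.Finite.equiv (Θ.vecEquiv A).symm

/-- The grading of `⨁ x, Hom(s x, A)`. -/
def vecGrading (A : C) : Grading K 𝒳.X (Θ.Vec A) where
  proj x := (Θ.vecEquiv A).symm.toLinearMap ∘ₗ LinearMap.single K (fun x => Θ.s x ⟶ A) x ∘ₗ
    LinearMap.proj x ∘ₗ (Θ.vecEquiv A).toLinearMap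
  proj_proj x y v := by
    simp only [LinearMap.comp_apply, LinearEquiv.coe_coe, LinearEquiv.apply_symm_apply]
    by_cases h : x = y
    · subst h; simp
    · simp [h]
  sum_proj v := by
    simp only [LinearMap.comp_apply, LinearEquiv.coe_coe]
    rw [← map_sum, LinearEquiv.symm_apply_eq]
    exact Finset.univ_sum_single (Θ.vecEquiv A v)

theorem vecGrading_proj (A : C) (x : 𝒳.X) (v : Θ.Vec A) :
    Θ.vecEquiv A ((Θ.vecGrading A).proj x v) = Pi.single x (Θ.vecEquiv A v x) :=
  (Θ.vecEquiv A).apply_symm_apply _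

/-- Postcomposition with a morphism. -/
def vecMap {A B : C} (k : A ⟶ B) : Θ.Vec A →ₗ[K] Θ.Vec B :=
  (Θ.vecEquiv B).symm.toLinearMap ∘ₗ (LinearMap.pi fun x => Linear.rightComp K _ k ∘ₗ
    LinearMap.proj x) ∘ₗ (Θ.vecEquiv A).toLinearMap

theorem vecEquiv_vecMap {A B : C} (k : A ⟶ B) (v : Θ.Vec A) (x : 𝒳.X) :
    Θ.vecEquiv B (Θ.vecMap k v) x = Θ.vecEquiv A v x ≫ k :=
  congrFun ((Θ.vecEquiv B).apply_symm_apply _) x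

theorem vecMap_isHom {A B : C} (k : A ⟶ B) (x : 𝒳.X) (v : Θ.Vec A)
    (hv : (Θ.vecGrading A).IsHom x v) : (Θ.vecGrading B).IsHom x (Θ.vecMap k v) := by
  refine (Θ.vecEquiv B).injective (funext fun y => ?_)
  rw [vecGrading_proj, vecEquiv_vecMap]
  rcases eq_or_ne y x with rfl | hy
  · simp [vecEquiv_vecMap]
  · have h : (Θ.vecGrading A).proj x v = v := hv
    have h2 := congrFun (Θ.vecGrading_proj A x v) y
    rw [h, Pi.single_eq_of_ne hy] at h2
    rw [vecEquiv_vecMap, Pi.single_eq_of_ne hy, h2, zero_comp]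

/-- The functor `A ↦ ⨁ x, Hom(s x, A)` to graded vector spaces. -/
def vecFunctor : C ⥤ TwVec (omega ξ) where
  obj A := { V := Θ.Vec A, gr := Θ.vecGrading A }
  map k := ⟨Θ.vecMap k, Θ.vecMap_isHom k⟩
  map_id A := TwVec.Hom.ext <| LinearMap.ext fun _ => (Θ.vecEquiv A).injective <|
    funext fun _ => (Θ.vecEquiv_vecMap _ _ _).trans (Category.comp_id _)
  map_comp k l := TwVec.Hom.ext <| LinearMap.ext fun v => (Θ.vecEquiv _).injective <|
    funext fun x => (Θ.vecEquiv_vecMap _ _ _).trans <| (Category.assoc _ _ _).symm.trans <|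
      (congrArg (· ≫ l) (Θ.vecEquiv_vecMap k v x).symm).trans (Θ.vecEquiv_vecMap l _ x).symm

/-- The components of a vector. -/
def ev (A : C) : (Θ.vecFunctor.obj A).V ≃ₗ[K] ∀ x, Θ.s x ⟶ A := Θ.vecEquiv A

/-- A morphism `s x ⟶ A` as a homogeneous vector of degree `x`. -/
def el (x : 𝒳.X) (A : C) : (Θ.s x ⟶ A) →ₗ[K] (Θ.vecFunctor.obj A).V :=
  (Θ.ev A).symm.toLinearMap ∘ₗ LinearMap.single K (fun x => Θ.s x ⟶ A) x

variable {Θ} {A B D : C}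

theorem proj_vecFunctor (x : 𝒳.X) (v : (Θ.vecFunctor.obj A).V) :
    (Θ.vecFunctor.obj A).gr.proj x v = Θ.el x A (Θ.ev A v x) := rfl

theorem ev_map (k : A ⟶ B) (v : (Θ.vecFunctor.obj A).V) (x : 𝒳.X) :
    Θ.ev B ((Θ.vecFunctor.map k).lin v) x = Θ.ev A v x ≫ k := Θ.vecEquiv_vecMap k v x

theorem ev_el (x : 𝒳.X) (φ : Θ.s x ⟶ A) : Θ.ev A (Θ.el x A φ) = Pi.single x φ :=
  (Θ.ev A).apply_symm_apply _

theorem el_isHom {x : 𝒳.X} (φ : Θ.s x ⟶ A) : (Θ.vecFunctor.obj A).gr.IsHom x (Θ.el x A φ) := by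
  rw [Grading.IsHom, proj_vecFunctor, ev_el, Pi.single_eq_same]

theorem exists_el {x : 𝒳.X} {v : (Θ.vecFunctor.obj A).V}
    (h : (Θ.vecFunctor.obj A).gr.IsHom x v) : ∃ φ, v = Θ.el x A φ := by
  rw [Grading.IsHom, proj_vecFunctor] at h
  exact ⟨_, h.symm⟩

theorem el_eq_zero {x : 𝒳.X} {φ : Θ.s x ⟶ A} (h : Θ.el x A φ = 0) : φ = 0 := by
  have : Pi.single (M := fun x => Θ.s x ⟶ A) x φ = 0 := (ev_el x φ).symm.trans <| by
    rw [h]; exact map_zero _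
  simpa using congrFun this x

theorem vec_ext {P : Type*} [AddCommGroup P] [Module K P] {f g : (Θ.vecFunctor.obj A).V →ₗ[K] P}
    (h : ∀ x φ, f (Θ.el x A φ) = g (Θ.el x A φ)) : f = g :=
  (Θ.vecFunctor.obj A).gr.hom_ext fun x v hv => by
    obtain ⟨φ, rfl⟩ := exists_el hv
    exact h x φ

theorem vec_hom_ext {V : TwVec (omega ξ)} {f g : Θ.vecFunctor.obj A ⟶ V}
    (h : ∀ x φ, f.lin (Θ.el x A φ) = g.lin (Θ.el x A φ)) : f = g :=
  TwVec.Hom.ext (vec_ext h)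

/-- The linear map with prescribed values on homogeneous vectors. -/
def desc {P : Type*} [AddCommGroup P] [Module K P] (f : ∀ x, (Θ.s x ⟶ A) →ₗ[K] P) :
    (Θ.vecFunctor.obj A).V →ₗ[K] P := (∑ x, f x ∘ₗ LinearMap.proj x) ∘ₗ (Θ.ev A).toLinearMap

theorem desc_el {P : Type*} [AddCommGroup P] [Module K P] (f : ∀ x, (Θ.s x ⟶ A) →ₗ[K] P)
    (x : 𝒳.X) (φ : Θ.s x ⟶ A) : desc f (Θ.el x A φ) = f x φ := by
  rw [desc, LinearMap.comp_apply, LinearEquiv.coe_coe, ev_el, LinearMap.sum_apply,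
    Finset.sum_eq_single x]
  · simp
  · intro y _ hy
    simp [hy]
  · simp

theorem vecFunctor_map_el (k : A ⟶ B) {x : 𝒳.X} (φ : Θ.s x ⟶ A) :
    (Θ.vecFunctor.map k).lin (Θ.el x A φ) = Θ.el x B (φ ≫ k) := by
  refine (Θ.ev B).injective (funext fun y => ?_)
  rw [ev_map, ev_el, ev_el]
  rcases eq_or_ne y x with rfl | hy
  · simp
  · simp [hy]

instance : Θ.vecFunctor.Additive where
  map_add {A B k l} := vec_hom_ext fun x φ => by
    rw [TwVec.add_lin, LinearMap.add_apply, vecFunctor_map_el, vecFunctor_map_el, vecFunctor_map_el,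
      Preadditive.comp_add, map_add]

instance : Θ.vecFunctor.Linear K where
  map_smul {A B} k r := vec_hom_ext fun x φ => by
    rw [TwVec.smul_lin, LinearMap.smul_apply, vecFunctor_map_el, vecFunctor_map_el,
      Linear.comp_smul, map_smul]

instance : Θ.vecFunctor.Faithful where
  map_injective {A B k l} h := by
    obtain ⟨n, x, i, p, hip⟩ := Θ.basis.decomp A
    rw [← Category.id_comp k, ← Category.id_comp l, ← hip, Preadditive.sum_comp,
      Preadditive.sum_comp]
    refine Finset.sum_congr rfl fun j _ => ?_
    have h1 := congrArg (fun q => TwVec.Hom.lin q (Θ.el _ A (i j))) h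
    simp only [vecFunctor_map_el] at h1
    rw [← sub_eq_zero, ← map_sub] at h1
    rw [Category.assoc, Category.assoc, sub_eq_zero.1 (el_eq_zero h1)]

instance : Θ.vecFunctor.Full where
  map_surjective {A B} q := by
    obtain ⟨n, x, i, p, hip⟩ := Θ.basis.decomp A
    have h : ∀ j, ∃ ψ : Θ.s (x j) ⟶ B, q.lin (Θ.el _ A (i j)) = Θ.el _ B ψ := fun j =>
      exists_el (q.isHom _ _ (el_isHom (i j)))
    choose ψ hψ using h
    refine ⟨∑ j, p j ≫ ψ j, vec_hom_ext fun y φ => ?_⟩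
    rw [vecFunctor_map_el, Preadditive.comp_sum]
    conv_rhs => rw [← Category.comp_id φ, ← hip, Preadditive.comp_sum, map_sum, map_sum]
    rw [map_sum]
    refine Finset.sum_congr rfl fun j _ => ?_
    -- `φ ≫ p j` is a scalar or zero, and `q` is known on the `i j`
    by_cases hy : y = x j
    · subst hy
      obtain ⟨r, hr⟩ := (Θ.basis.brick _).endo (φ ≫ p j)
      rw [← Category.assoc, ← Category.assoc, hr, Linear.smul_comp, Linear.smul_comp,
        Category.id_comp, Category.id_comp, map_smul, map_smul, map_smul, hψ]
    · rw [← Category.assoc, ← Category.assoc, Θ.basis.hom_eq_zero hy (φ ≫ p j)]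
      simp

variable (Θ) in
/-- The isomorphism from the line of degree `x` to the image of `s x`. -/
def lineHom (x : 𝒳.X) : TwVec.line (omega ξ) x ⟶ Θ.vecFunctor.obj (Θ.s x) :=
  TwVec.ofVec (el_isHom (𝟙 (Θ.s x)))

theorem lineHom_e (x : 𝒳.X) :
    (Θ.lineHom x).lin (TwVec.e (omega ξ) x) = Θ.el x _ (𝟙 (Θ.s x)) := TwVec.ofVec_e _

instance (x : 𝒳.X) : IsIso (Θ.lineHom x) := by
  refine TwVec.isIso_of_isHom _ (fun y v _ h => ?_) fun y v hv => ?_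
  · obtain ⟨r, rfl⟩ := TwVec.line_eq_smul v
    rw [map_smul, lineHom_e, ← map_smul] at h
    rcases smul_eq_zero.1 (el_eq_zero h) with rfl | h
    · rw [zero_smul]
    · exact absurd h (Θ.basis.brick x).id_ne_zero
  · obtain ⟨φ, rfl⟩ := exists_el hv
    by_cases hy : y = x
    · subst hy
      obtain ⟨r, rfl⟩ := (Θ.basis.brick y).endo φ
      exact ⟨r • TwVec.e _ y, by rw [map_smul, lineHom_e, map_smul]⟩
    · exact ⟨0, by rw [Θ.basis.hom_eq_zero hy φ, map_zero, map_zero]⟩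

/-- Every graded vector space is a direct sum of lines, hence in the essential image. -/
theorem vecFunctor_isEquivalence [HasFiniteBiproducts C] : Θ.vecFunctor.IsEquivalence where
  essSurj := ⟨fun V => by
    obtain ⟨n, x, i, p, h1, h2, h3⟩ := TwVec.exists_lines V
    have hm : ∀ j k, Θ.vecFunctor.map (biproduct.ι (fun j => Θ.s (x j)) j) ≫
        Θ.vecFunctor.map (biproduct.π (fun j => Θ.s (x j)) k) =
        Θ.vecFunctor.map (biproduct.ι (fun j => Θ.s (x j)) j ≫ biproduct.π _ k) := fun j k =>
      (Functor.map_comp _ _ _).symm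
    refine ⟨⨁ fun j => Θ.s (x j), ⟨⟨∑ j, Θ.vecFunctor.map
      (biproduct.π (fun j => Θ.s (x j)) j) ≫ inv (Θ.lineHom (x j)) ≫ i j,
      ∑ j, p j ≫ Θ.lineHom (x j) ≫ Θ.vecFunctor.map (biproduct.ι (fun j => Θ.s (x j)) j), ?_, ?_⟩⟩⟩
    · rw [← CategoryTheory.Functor.map_id, ← biproduct.total, Functor.map_sum, Preadditive.sum_comp]
      refine Finset.sum_congr rfl fun j _ => ?_
      rw [Preadditive.comp_sum, Finset.sum_eq_single j]
      · simp [reassoc_of% h1]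
      · intro k _ hk
        simp [reassoc_of% (h2 j k hk.symm)]
      · simp
    · rw [← h3, Preadditive.sum_comp]
      refine Finset.sum_congr rfl fun j _ => ?_
      rw [Preadditive.comp_sum, Finset.sum_eq_single j]
      · simp [reassoc_of% (hm j j)]
      · intro k _ hk
        simp [reassoc_of% (hm j k), biproduct.ι_π_ne _ hk.symm]
      · simp⟩

end Vec

end Framing

/-! ### The monoidal structure of this functor -/

namespace Framing

open TwVec

variable {K : Type w} [Field K] {C : Type u} [Category.{v} C] [Preadditive C] [Linear K C]
  [MonoidalCategory C] {G : Type b} [Group G] {S : CrossedStructure K C G}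
  {𝒳 : FinCrossedModule.{a}} {ξ : Zqa 𝒳 K} {Θ : Framing S 𝒳 ξ.1}

section Unit

variable [MonoidalPreadditive C] [MonoidalLinear K C]

/-- If the unit object is a brick, it is isomorphic to `s 1`, and the isomorphism can be normalized
so as to correspond to the left unit constraint. -/
theorem exists_unit (Θ : Framing S 𝒳 ξ.1) (h1 : IsBrick K (𝟙_ C)) : ∃ u : Θ.s 1 ≅ 𝟙_ C,
    Θ.star (one_mul 1) u.hom (𝟙 (Θ.s 1)) ≫ (λ_ (Θ.s 1)).hom = 𝟙 (Θ.s 1) := by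
  obtain ⟨x, ⟨i⟩⟩ := Θ.basis.exists_iso h1
  have hx : x * x = x := Θ.basis.eq_of_iso <| Θ.m rfl ≪≫ whiskerRightIso i (Θ.s x) ≪≫ λ_ _
  obtain rfl : x = 1 := mul_eq_left.1 hx
  -- the normalization determines the scalar by which `i` has to be multiplied
  obtain ⟨r, hr⟩ := (Θ.basis.brick 1).exists_unit (Iso.refl _)
    (Θ.m (one_mul 1) ≪≫ whiskerRightIso i (Θ.s 1) ≪≫ λ_ _)
  refine ⟨⟨(r : K) • i.hom, ((r⁻¹ : Kˣ) : K) • i.inv, ?_, ?_⟩, ?_⟩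
  · simp [smul_smul]
  · simp [smul_smul]
  · simp only [Iso.refl_hom, Iso.trans_hom, whiskerRightIso_hom] at hr
    rw [star_smul_left, Linear.smul_comp]
    conv_rhs => rw [hr]
    simp [star]

variable (u : Θ.s 1 ≅ 𝟙_ C)

/-- The left unit constraint in terms of a normalized unit; the scalar comes from the triangle
identity. -/
theorem star_unit_left
    (hu : Θ.star (one_mul 1) u.hom (𝟙 (Θ.s 1)) ≫ (λ_ (Θ.s 1)).hom = 𝟙 (Θ.s 1))
    {x : 𝒳.X} (h : 1 * x = x) {A : C} (φ : Θ.s x ⟶ A) :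
    Θ.star h u.hom φ ≫ (λ_ A).hom = (((ξ.1.ω 1 1 x)⁻¹ : Kˣ) : K) • φ := by
  obtain ⟨k, hk⟩ := (Θ.basis.brick x).endo (Θ.star h u.hom (𝟙 _) ≫ (λ_ _).hom)
  have h1 : Θ.star h (Θ.star (one_mul 1) u.hom u.hom) (𝟙 (Θ.s x)) ≫ (α_ _ _ _).hom ≫
      (𝟙_ C) ◁ (λ_ _).hom = Θ.star h u.hom (𝟙 (Θ.s x)) := by
    have h2 : Θ.star (one_mul 1) u.hom u.hom ≫ (ρ_ (𝟙_ C)).hom = u.hom := by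
      have h3 : Θ.star (one_mul 1) u.hom u.hom =
          Θ.star (one_mul 1) u.hom (𝟙 (Θ.s 1)) ≫ 𝟙_ C ◁ u.hom := by
        rw [star_whiskerLeft, Category.id_comp]
      rw [← unitors_equal, h3, Category.assoc, leftUnitor_naturality, ← Category.assoc, hu,
        Category.id_comp]
    rw [MonoidalCategory.triangle, star_whiskerRight, h2]
  rw [← Category.assoc, Θ.star_assoc _ _ h h, Linear.smul_comp, star_whiskerLeft, hk,
    star_smul_right, smul_smul] at h1
  conv_rhs at h1 => rw [← one_smul K (Θ.star h u.hom (𝟙 (Θ.s x)))]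
  have h3 := (Θ.basis.brick x).smul_left_injective h1
  have h4 : Θ.star h u.hom φ ≫ (λ_ A).hom = (Θ.star h u.hom (𝟙 _) ≫ (λ_ _).hom) ≫ φ := by
    rw [Category.assoc, ← leftUnitor_naturality, ← Category.assoc, star_whiskerLeft,
      Category.id_comp]
  rw [h4, hk, Linear.smul_comp, Category.id_comp, Units.val_inv_eq_inv_val,
    eq_inv_of_mul_eq_one_right h3]

theorem star_unit_right
    (hu : Θ.star (one_mul 1) u.hom (𝟙 (Θ.s 1)) ≫ (λ_ (Θ.s 1)).hom = 𝟙 (Θ.s 1))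
    {x : 𝒳.X} (h : x * 1 = x) {A : C} (φ : Θ.s x ⟶ A) :
    Θ.star h φ u.hom ≫ (ρ_ A).hom = (ξ.1.ω x 1 1 : K) • φ := by
  obtain ⟨k, hk⟩ := (Θ.basis.brick x).endo (Θ.star h (𝟙 _) u.hom ≫ (ρ_ _).hom)
  have h1 := congrArg (Θ.star h (Θ.star h (𝟙 (Θ.s x)) u.hom) (𝟙 (Θ.s 1)) ≫ ·)
    (MonoidalCategory.triangle (Θ.s x) (Θ.s 1))
  simp only [← Category.assoc] at h1
  rw [Θ.star_assoc _ _ (one_mul 1) h, Linear.smul_comp, star_whiskerLeft, hu, star_whiskerRight, hk,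
    star_smul_left] at h1
  have h3 := (Θ.basis.brick x).smul_left_injective h1
  have h4 : Θ.star h φ u.hom ≫ (ρ_ A).hom = (Θ.star h (𝟙 _) u.hom ≫ (ρ_ _).hom) ≫ φ := by
    rw [Category.assoc, ← rightUnitor_naturality, ← Category.assoc, star_whiskerRight,
      Category.id_comp]
  rw [h4, hk, Linear.smul_comp, Category.id_comp, h3]

end Unit

variable [∀ A B : C, Module.Finite K (A ⟶ B)]

section Mul

variable {A B D : C}

theorem vec_hom_ext₂ {V : TwVec (omega ξ)} {f g : Θ.vecFunctor.obj A ⊗ Θ.vecFunctor.obj B ⟶ V}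
    (h : ∀ x φ y ψ, f.lin (tm (Θ.el x A φ) (Θ.el y B ψ)) =
      g.lin (tm (Θ.el x A φ) (Θ.el y B ψ))) : f = g :=
  tensor_hom_ext fun x v y w hv hw => by
    obtain ⟨φ, rfl⟩ := exists_el hv
    obtain ⟨ψ, rfl⟩ := exists_el hw
    exact h x φ y ψ

variable [MonoidalPreadditive C] [MonoidalLinear K C]

variable (Θ A B) in
/-- The product of morphisms `s x ⟶ A` and `s y ⟶ B`, as a bilinear map. -/
def starLin (x y : 𝒳.X) : (Θ.s x ⟶ A) →ₗ[K] (Θ.s y ⟶ B) →ₗ[K] (Θ.vecFunctor.obj (A ⊗ B)).V :=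
  LinearMap.mk₂ K (fun φ ψ => Θ.el (x * y) (A ⊗ B) (Θ.star rfl φ ψ))
    (fun φ φ' ψ => by rw [← map_add]; congr 1; simp [star, MonoidalCategory.tensorHom_def])
    (fun r φ ψ => by rw [star_smul_left, map_smul])
    (fun φ ψ ψ' => by rw [← map_add]; congr 1; simp [star, MonoidalCategory.tensorHom_def])
    (fun r φ ψ => by rw [star_smul_right, map_smul])

variable (Θ A B) in
/-- The linear map underlying the tensor structure of `Θ.vecFunctor`. -/
def mulLin : (tens (Θ.vecFunctor.obj A) (Θ.vecFunctor.obj B)).V →ₗ[K]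
    (Θ.vecFunctor.obj (A ⊗ B)).V :=
  TensorProduct.lift (desc fun x => (desc fun y => (Θ.starLin A B x y).flip).flip)

theorem mulLin_tm {x y z : 𝒳.X} (h : x * y = z) (φ : Θ.s x ⟶ A) (ψ : Θ.s y ⟶ B) :
    Θ.mulLin A B (tm (Θ.el x A φ) (Θ.el y B ψ)) = Θ.el z (A ⊗ B) (Θ.star h φ ψ) := by
  subst h
  change (desc fun x => (desc fun y => (Θ.starLin A B x y).flip).flip) (Θ.el x A φ) (Θ.el y B ψ) = _
  rw [desc_el, LinearMap.flip_apply, desc_el, LinearMap.flip_apply]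
  rfl

variable (Θ A B) in
/-- The tensor structure of `Θ.vecFunctor`. -/
def mulHom : Θ.vecFunctor.obj A ⊗ Θ.vecFunctor.obj B ⟶ Θ.vecFunctor.obj (A ⊗ B) :=
  ⟨Θ.mulLin A B, isHom_of_tm _ fun x v y w hv hw => by
    obtain ⟨φ, rfl⟩ := exists_el hv
    obtain ⟨ψ, rfl⟩ := exists_el hw
    rw [mulLin_tm rfl]
    exact el_isHom _⟩

theorem mulHom_tm {x y z : 𝒳.X} (h : x * y = z) (φ : Θ.s x ⟶ A) (ψ : Θ.s y ⟶ B) :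
    (Θ.mulHom A B).lin (tm (Θ.el x A φ) (Θ.el y B ψ)) = Θ.el z (A ⊗ B) (Θ.star h φ ψ) :=
  mulLin_tm h φ ψ

theorem mulHom_natural_left {A' : C} (k : A ⟶ A') (B : C) :
    Θ.vecFunctor.map k ▷ Θ.vecFunctor.obj B ≫ Θ.mulHom A' B =
      Θ.mulHom A B ≫ Θ.vecFunctor.map (k ▷ B) := vec_hom_ext₂ fun x φ y ψ => by
  rw [comp_lin_apply, comp_lin_apply, whiskerRight_tm, vecFunctor_map_el, mulHom_tm rfl,
    mulHom_tm rfl, vecFunctor_map_el, star_whiskerRight]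

theorem mulHom_natural_right (A : C) {B' : C} (k : B ⟶ B') :
    Θ.vecFunctor.obj A ◁ Θ.vecFunctor.map k ≫ Θ.mulHom A B' =
      Θ.mulHom A B ≫ Θ.vecFunctor.map (A ◁ k) := vec_hom_ext₂ fun x φ y ψ => by
  rw [comp_lin_apply, comp_lin_apply, whiskerLeft_tm, vecFunctor_map_el, mulHom_tm rfl,
    mulHom_tm rfl, vecFunctor_map_el, star_whiskerLeft]

theorem isIso_mulHom_s (x y : 𝒳.X) : IsIso (Θ.mulHom (Θ.s x) (Θ.s y)) := by
  have h : (Θ.lineHom x ⊗ₘ Θ.lineHom y) ≫ Θ.mulHom (Θ.s x) (Θ.s y) =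
      (lineTens (omega ξ) rfl).hom ≫ Θ.lineHom (x * y) ≫ Θ.vecFunctor.map (Θ.m rfl).hom := by
    rw [← Iso.inv_comp_eq]
    refine line_hom_ext ?_
    rw [comp_lin_apply, comp_lin_apply, comp_lin_apply, lineTens_inv_e, tensorHom_tm, lineHom_e,
      lineHom_e, lineHom_e, mulHom_tm rfl, vecFunctor_map_el]
    simp [star]
  have h2 : IsIso ((Θ.lineHom x ⊗ₘ Θ.lineHom y) ≫ Θ.mulHom (Θ.s x) (Θ.s y)) := by
    rw [h]; infer_instance
  exact IsIso.of_isIso_comp_left (Θ.lineHom x ⊗ₘ Θ.lineHom y) _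

instance (A B : C) : IsIso (Θ.mulHom A B) := by
  -- both variables are reduced to basis objects, one after the other
  have h1 : ∀ x (B : C), IsIso (Θ.mulHom (Θ.s x) B) := fun x B =>
    Θ.basis.isIso_app (F := Θ.vecFunctor ⋙ tensorLeft (Θ.vecFunctor.obj (Θ.s x)))
      (F' := tensorLeft (Θ.s x) ⋙ Θ.vecFunctor)
      { app := fun B => Θ.mulHom (Θ.s x) B
        naturality := fun _ _ k => mulHom_natural_right (Θ.s x) k }
      (fun y => isIso_mulHom_s x y) B
  exact Θ.basis.isIso_app (F := Θ.vecFunctor ⋙ tensorRight (Θ.vecFunctor.obj B))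
      (F' := tensorRight B ⋙ Θ.vecFunctor)
      { app := fun A => Θ.mulHom A B
        naturality := fun _ _ k => mulHom_natural_left k B }
      (fun x => h1 x B) A

theorem mulHom_assoc (A B D : C) :
    Θ.mulHom A B ▷ Θ.vecFunctor.obj D ≫ Θ.mulHom (A ⊗ B) D ≫ Θ.vecFunctor.map (α_ A B D).hom =
      (α_ _ _ _).hom ≫ Θ.vecFunctor.obj A ◁ Θ.mulHom B D ≫ Θ.mulHom A (B ⊗ D) :=
  tensor_hom_ext₃ fun x v y w z u hv hw hu => by
    obtain ⟨φ, rfl⟩ := exists_el hv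
    obtain ⟨ψ, rfl⟩ := exists_el hw
    obtain ⟨χ, rfl⟩ := exists_el hu
    simp only [comp_lin_apply]
    rw [whiskerRight_tm, mulHom_tm rfl, mulHom_tm rfl, vecFunctor_map_el, associator_tm hv hw hu,
      Θ.star_assoc _ _ rfl (mul_assoc _ _ _).symm, map_smul, map_smul, map_smul, whiskerLeft_tm,
      mulHom_tm rfl, mulHom_tm (mul_assoc _ _ _).symm]
    rfl

end Mul

section Monoidal

variable (u : Θ.s 1 ≅ 𝟙_ C)

/-- The unit structure of `Θ.vecFunctor`. -/
def unitHom : 𝟙_ (TwVec (omega ξ)) ⟶ Θ.vecFunctor.obj (𝟙_ C) :=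
  Θ.lineHom 1 ≫ Θ.vecFunctor.map u.hom

theorem unitHom_e : (unitHom u).lin (e (omega ξ) 1) = Θ.el 1 (𝟙_ C) u.hom := by
  rw [unitHom, comp_lin_apply, lineHom_e, vecFunctor_map_el, Category.id_comp]

instance : IsIso (unitHom u) := by unfold unitHom; infer_instance

variable [MonoidalPreadditive C] [MonoidalLinear K C]

/-- The monoidal structure of `Θ.vecFunctor`. -/
def vecMonoidal
    (hu : Θ.star (one_mul 1) u.hom (𝟙 (Θ.s 1)) ≫ (λ_ (Θ.s 1)).hom = 𝟙 (Θ.s 1)) :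
    Θ.vecFunctor.CoreMonoidal where
  εIso := asIso (unitHom u)
  μIso A B := asIso (Θ.mulHom A B)
  μIso_hom_natural_left k B := mulHom_natural_left k B
  μIso_hom_natural_right A k := mulHom_natural_right A k
  associativity A B D := mulHom_assoc A B D
  left_unitality A := unit_tensor_hom_ext fun x v hv => by
    obtain ⟨φ, rfl⟩ := exists_el hv
    simp only [comp_lin_apply, asIso_hom]
    rw [leftUnitor_tm hv, whiskerRight_tm, unitHom_e, mulHom_tm (one_mul x), vecFunctor_map_el,
      star_unit_left u hu, map_smul]
    rfl
  right_unitality A := tensor_unit_hom_ext fun x v hv => by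
    obtain ⟨φ, rfl⟩ := exists_el hv
    simp only [comp_lin_apply, asIso_hom]
    rw [rightUnitor_tm hv, whiskerLeft_tm, unitHom_e, mulHom_tm (mul_one x), vecFunctor_map_el,
      star_unit_right u hu, map_smul]
    rfl

end Monoidal

end Framing

/-! ### A framed category is equivalent to the category of its cocycle -/

namespace Framing

open TwVec Functor.OplaxMonoidal Functor.LaxMonoidal

variable {K : Type w} [Field K] {C : Type u} [Category.{v} C] [Preadditive C] [Linear K C]
  [MonoidalCategory C] {G : Type b} [Group G] {S : CrossedStructure K C G}
  {𝒳 : FinCrossedModule.{a}}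

section

variable {ξ : Cochain 𝒳 K} (Θ : Framing S 𝒳 ξ)

theorem exists_tr (g : G) {x y : 𝒳.X} (h : Θ.f g • x = y) {A : C} (ψ : Θ.s y ⟶ (S.T g).obj A) :
    ∃ φ : Θ.s x ⟶ A, Θ.tr g h φ = ψ := by
  obtain ⟨φ, hφ⟩ := (S.T g).map_surjective ((Θ.t g h).inv ≫ ψ)
  exact ⟨φ, by rw [tr, hφ, Iso.hom_inv_id_assoc]⟩

theorem eq_zero_of_tr (g : G) {x y : 𝒳.X} (h : Θ.f g • x = y) {A : C} {φ : Θ.s x ⟶ A}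
    (h0 : Θ.tr g h φ = 0) : φ = 0 := by
  refine (S.T g).map_injective ?_
  rw [← cancel_epi (Θ.t g h).hom, Functor.map_zero, comp_zero]
  exact h0

/-- Translation by `g` as a linear map. -/
def trLin (g : G) {x y : 𝒳.X} (h : Θ.f g • x = y) (A : C) :
    (Θ.s x ⟶ A) →ₗ[K] (Θ.s y ⟶ (S.T g).obj A) where
  toFun := Θ.tr g h
  map_add' φ ψ := by simp [tr]
  map_smul' r φ := Θ.tr_smul g h r φ

end

variable {ξ : Zqa 𝒳 K} {Θ : Framing S 𝒳 ξ.1}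

section

variable [MonoidalPreadditive C] [MonoidalLinear K C] [h1 : Fact (IsBrick K (𝟙_ C))]

variable (Θ) in
/-- A normalized isomorphism from `s 1` to the unit object. -/
def unitIso : Θ.s 1 ≅ 𝟙_ C := (Θ.exists_unit h1.out).choose

theorem unitIso_spec : Θ.star (one_mul 1) Θ.unitIso.hom (𝟙 (Θ.s 1)) ≫ (λ_ (Θ.s 1)).hom =
    𝟙 (Θ.s 1) := (Θ.exists_unit h1.out).choose_spec

/-- The unit constraint of `T_g` is determined by its tensor constraint. -/
theorem unitIso_ε (g : G) : Θ.unitIso.hom ≫ ε (S.T g) =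
    (ξ.1.μ (Θ.f g) 1 1 : K) • Θ.tr g (smul_one _) Θ.unitIso.hom := by
  obtain ⟨k, hk⟩ := (Θ.basis.brick 1).endo
    (Θ.tr g (smul_one _) Θ.unitIso.hom ≫ η (S.T g) ≫ Θ.unitIso.inv)
  have hk : Θ.tr g (smul_one _) Θ.unitIso.hom ≫ η (S.T g) = k • Θ.unitIso.hom := by
    rw [← cancel_mono Θ.unitIso.inv, Category.assoc, hk, Linear.smul_comp, Iso.hom_inv_id]
  have key := congrArg (Θ.tr g (smul_one _) (Θ.star (one_mul 1) Θ.unitIso.hom Θ.unitIso.hom) ≫ ·)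
    (left_unitality_hom (S.T g) (𝟙_ C))
  simp only [← Category.assoc] at key
  rw [Θ.tr_δ g _ _ (smul_one _) (smul_one _) (one_mul 1), Linear.smul_comp, Linear.smul_comp,
    star_whiskerRight, hk, star_smul_left, Linear.smul_comp, star_unit_left _ unitIso_spec,
    tr_map, star_unit_left _ unitIso_spec, tr_smul, smul_smul, smul_smul] at key
  have h2 := (Θ.basis.brick 1).smul_left_injective key
  have h3 : (ξ.1.μ (Θ.f g) 1 1 : K) * k = 1 := by
    refine mul_right_cancel₀ (Units.ne_zero (ξ.1.ω 1 1 1)⁻¹) ?_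
    rw [h2, one_mul]
  have h4 : k • Θ.unitIso.hom ≫ ε (S.T g) = Θ.tr g (smul_one _) Θ.unitIso.hom := by
    rw [← Linear.smul_comp, ← hk, Category.assoc, Functor.Monoidal.η_ε, Category.comp_id]
  rw [← h4, smul_smul, h3, one_smul]

end

variable [∀ A B : C, Module.Finite K (A ⟶ B)]

variable (Θ) in
/-- The linear map underlying the compatibility of `Θ.vecFunctor` with the actions. -/
def actLin (g : G) (A : C) : ((act ξ (Θ.f g)).obj (Θ.vecFunctor.obj A)).V →ₗ[K]
    (Θ.vecFunctor.obj ((S.T g).obj A)).V :=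
  (desc fun x => Θ.el (Θ.f g • x) _ ∘ₗ Θ.trLin g rfl A) ∘ₗ
    (toT (Θ.f g) (Θ.vecFunctor.obj A)).symm.toLinearMap

theorem actLin_toT (g : G) {A : C} {x y : 𝒳.X} (h : Θ.f g • x = y) (φ : Θ.s x ⟶ A) :
    Θ.actLin g A (toT (Θ.f g) _ (Θ.el x A φ)) = Θ.el y _ (Θ.tr g h φ) := by
  subst h
  rw [actLin, LinearMap.comp_apply, LinearEquiv.coe_coe, LinearEquiv.symm_apply_apply, desc_el]
  rfl

variable (Θ) in
/-- The compatibility of `Θ.vecFunctor` with the actions. -/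
def actHom (g : G) (A : C) : (act ξ (Θ.f g)).obj (Θ.vecFunctor.obj A) ⟶
    Θ.vecFunctor.obj ((S.T g).obj A) :=
  ⟨Θ.actLin g A, fun x v hv => by
    obtain ⟨x, v, hv', rfl, rfl⟩ := exists_of_T_isHom hv
    obtain ⟨φ, rfl⟩ := exists_el hv'
    rw [actLin_toT g rfl]
    exact el_isHom _⟩

theorem actHom_toT (g : G) {A : C} {x y : 𝒳.X} (h : Θ.f g • x = y) (φ : Θ.s x ⟶ A) :
    (Θ.actHom g A).lin (toT (Θ.f g) _ (Θ.el x A φ)) = Θ.el y _ (Θ.tr g h φ) := actLin_toT g h φ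

instance (g : G) (A : C) : IsIso (Θ.actHom g A) := by
  refine isIso_of_isHom _ (fun x v hv h0 => ?_) fun y w hw => ?_
  · obtain ⟨x, v, hv', rfl, rfl⟩ := exists_of_T_isHom hv
    obtain ⟨φ, rfl⟩ := exists_el hv'
    rw [actHom_toT g rfl] at h0
    rw [Θ.eq_zero_of_tr g rfl (el_eq_zero h0), map_zero, map_zero]
  · obtain ⟨ψ, rfl⟩ := exists_el hw
    obtain ⟨φ, rfl⟩ := Θ.exists_tr g (smul_inv_smul (Θ.f g) y) ψ
    exact ⟨_, actHom_toT g _ φ⟩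

variable (Θ) in
/-- `Θ.actHom` as a natural isomorphism. -/
def actIso (g : G) : Θ.vecFunctor ⋙ act ξ (Θ.f g) ≅ S.T g ⋙ Θ.vecFunctor :=
  NatIso.ofComponents (fun A => asIso (Θ.actHom g A)) fun {A B} k => T_hom_ext fun x v hv => by
    obtain ⟨φ, rfl⟩ := exists_el hv
    simp only [comp_lin_apply, Functor.comp_map, asIso_hom]
    rw [act_map, vecFunctor_map_el, actHom_toT g rfl, actHom_toT g rfl, vecFunctor_map_el, tr_map]

theorem actIso_inv_el (g : G) {A : C} {x y : 𝒳.X} (h : Θ.f g • x = y) (φ : Θ.s x ⟶ A) :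
    ((Θ.actIso g).inv.app A).lin (Θ.el y _ (Θ.tr g h φ)) = toT (Θ.f g) _ (Θ.el x A φ) := by
  rw [← actHom_toT g h]
  exact LinearMap.congr_fun (congrArg Hom.lin ((Θ.actIso g).hom_inv_id_app A)) _

/-- If `A` has degree `g`, only the `s x` with `∂ x = g` map nontrivially to `A`. -/
theorem supp_vecFunctor {A : C} {g : G} (hA : S.comp g A) :
    supp ξ (Θ.f g) (Θ.vecFunctor.obj A) := by
  intro x v hv h0
  obtain ⟨φ, rfl⟩ := exists_el hv
  by_contra hx
  refine h0 ?_
  rw [S.hom_eq_zero (Θ.comp (Θ.f.apply_symm_apply (𝒳.bd x))) hA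
    (fun h => hx (by rw [← h, Θ.f.apply_symm_apply])) φ, map_zero]

theorem vecFunctor_γ (g h : G) (A : C) :
    Θ.vecFunctor.map ((S.γ g h).hom.app A) ≫ (Θ.actIso g).inv.app ((S.T h).obj A) ≫
        (act ξ (Θ.f g)).map ((Θ.actIso h).inv.app A) =
      (Θ.actIso (g * h)).inv.app A ≫
        eqToHom (congrArg (fun l => (act ξ l).obj (Θ.vecFunctor.obj A)) (map_mul Θ.f g h)) ≫
        (gammaIso ξ (Θ.f g) (Θ.f h)).hom.app (Θ.vecFunctor.obj A) := by
  refine vec_hom_ext fun y ψ => ?_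
  obtain ⟨φ, rfl⟩ := Θ.exists_tr (g * h) (smul_inv_smul (Θ.f (g * h)) y) ψ
  simp only [comp_lin_apply]
  rw [vecFunctor_map_el, Θ.tr_γ g h _ rfl (by rw [smul_smul, ← map_mul, smul_inv_smul]), map_smul,
    map_smul, map_smul]
  -- the two sides of `actIso` are compositions of functors, which `rw` does not unfold
  erw [actIso_inv_el, actIso_inv_el]
  rw [act_map, eqToHom_act (map_mul Θ.f g h), gammaIso_toT _ _ (el_isHom φ)]
  exact congrArg (fun v => (ξ.1.γ (Θ.f g) (Θ.f h) _ : K) • toT (Θ.f g) _ v)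
    (actIso_inv_el h rfl φ)

variable [MonoidalPreadditive C] [MonoidalLinear K C]

section

variable [h1 : Fact (IsBrick K (𝟙_ C))]

instance : Θ.vecFunctor.Monoidal := (vecMonoidal Θ.unitIso unitIso_spec).toMonoidal

variable {A B : C}

theorem vecFunctor_ε : (ε Θ.vecFunctor).lin (e (omega ξ) 1) = Θ.el 1 (𝟙_ C) Θ.unitIso.hom :=
  unitHom_e _

theorem vecFunctor_μ {x y z : 𝒳.X} (h : x * y = z) (φ : Θ.s x ⟶ A) (ψ : Θ.s y ⟶ B) :
    (μ Θ.vecFunctor A B).lin (tm (Θ.el x A φ) (Θ.el y B ψ)) = Θ.el z (A ⊗ B) (Θ.star h φ ψ) :=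
  mulHom_tm h φ ψ

theorem vecFunctor_δ {x y z : 𝒳.X} (h : x * y = z) (φ : Θ.s x ⟶ A) (ψ : Θ.s y ⟶ B) :
    (δ Θ.vecFunctor A B).lin (Θ.el z (A ⊗ B) (Θ.star h φ ψ)) = tm (Θ.el x A φ) (Θ.el y B ψ) := by
  rw [← vecFunctor_μ h]
  exact LinearMap.congr_fun (congrArg Hom.lin (Functor.Monoidal.μ_δ Θ.vecFunctor A B)) _

instance (g : G) : NatTrans.IsMonoidal (Θ.actIso g).hom where
  unit := unit_hom_ext <| by
    have e1 : ε (Θ.vecFunctor ⋙ act ξ (Θ.f g)) =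
      ε (act ξ (Θ.f g)) ≫ (act ξ (Θ.f g)).map (ε Θ.vecFunctor) := rfl
    have e2 : ε (S.T g ⋙ Θ.vecFunctor) = ε Θ.vecFunctor ≫ Θ.vecFunctor.map (ε (S.T g)) := rfl
    have e3 : (Θ.actIso g).hom.app (𝟙_ C) = Θ.actHom g (𝟙_ C) := rfl
    rw [e1, e2, e3]
    simp only [comp_lin_apply]
    rw [ε_e, map_smul, act_map, map_smul, vecFunctor_ε, actHom_toT g (smul_one _),
      vecFunctor_map_el, unitIso_ε, map_smul]
  tensor A B := tensor_hom_ext fun x v y w hv hw => by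
    obtain ⟨x, v, hv', rfl, rfl⟩ := exists_of_T_isHom hv
    obtain ⟨y, w, hw', rfl, rfl⟩ := exists_of_T_isHom hw
    have e1 : μ (Θ.vecFunctor ⋙ act ξ (Θ.f g)) A B =
      μ (act ξ (Θ.f g)) _ _ ≫ (act ξ (Θ.f g)).map (μ Θ.vecFunctor A B) := rfl
    have e2 : μ (S.T g ⋙ Θ.vecFunctor) A B =
      μ Θ.vecFunctor _ _ ≫ Θ.vecFunctor.map (μ (S.T g) A B) := rfl
    have e3 : ∀ A, (Θ.actIso g).hom.app A = Θ.actHom g A := fun _ => rfl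
    rw [e1, e2, e3, e3, e3]
    simp only [comp_lin_apply]
    rw [μ_tm _ hv' hw', map_smul, act_map, map_smul, tensorHom_tm]
    obtain ⟨φ, rfl⟩ := exists_el hv'
    obtain ⟨ψ, rfl⟩ := exists_el hw'
    rw [vecFunctor_μ rfl, actHom_toT g rfl, actHom_toT g rfl, actHom_toT g rfl,
      vecFunctor_μ (smul_mul' _ _ _).symm, vecFunctor_map_el, ← map_smul]
    congr 1
    rw [← cancel_mono (δ (S.T g) A B), Linear.smul_comp,
      Θ.tr_δ g rfl rfl rfl rfl (smul_mul' _ _ _).symm, smul_smul, Units.inv_mul, one_smul,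
      Category.assoc, Functor.Monoidal.μ_δ, Category.comp_id]

theorem vecFunctor_braid {g : G} (hA : S.comp g A) (B : C) :
    Θ.vecFunctor.map (S.c g A hA B).hom ≫ δ Θ.vecFunctor ((S.T g).obj B) A ≫
        (Θ.actIso g).inv.app B ▷ Θ.vecFunctor.obj A =
      δ Θ.vecFunctor A B ≫
        (braid (Θ.f g) (Θ.vecFunctor.obj A) (supp_vecFunctor hA) (Θ.vecFunctor.obj B)).hom := by
  rw [← cancel_epi (μ Θ.vecFunctor A B), Functor.Monoidal.μ_δ_assoc]
  refine vec_hom_ext₂ fun x φ y ψ => ?_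
  rcases eq_or_ne (Θ.el x A φ) 0 with h0 | h0
  · rw [h0, map_zero, LinearMap.zero_apply, map_zero, map_zero]
  have hx : 𝒳.bd x = Θ.f g := supp_vecFunctor hA x _ (el_isHom φ) h0
  have e1 : Θ.f g • y * x = x * y := by rw [← hx, 𝒳.bd_smul, inv_mul_cancel_right]
  simp only [comp_lin_apply]
  rw [vecFunctor_μ rfl, vecFunctor_map_el, Θ.star_c hx.symm hA rfl rfl e1, map_smul, map_smul,
    map_smul, vecFunctor_δ, whiskerRight_tm, braid_tm _ (el_isHom φ) (el_isHom ψ)]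
  congr 3
  exact actIso_inv_el g rfl ψ

variable (Θ) in
/-- The crossed tensor functor to the category of the cocycle of a framing. -/
def vecCrossedFunctor : CrossedFunctor S (crossedStructure ξ) where
  f := Θ.f.toMonoidHom
  F := Θ.vecFunctor
  β g := (Θ.actIso g).symm
  β_monoidal g := inferInstanceAs (NatTrans.IsMonoidal (Θ.actIso g).inv)
  F_comp hA := supp_vecFunctor hA
  F_c hA B := vecFunctor_braid hA B
  β_γ g h A := vecFunctor_γ g h A

end

end Framing

theorem IsFusion.hasFiniteBiproducts (K : Type w) [Field K] {C : Type u} [Category.{v} C]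
    [Preadditive C] [Linear K C] [MonoidalCategory C] [IsFusion K C] : HasFiniteBiproducts C :=
  haveI : IsAbelian C := IsFusion.toIsAbelian K
  HasFiniteBiproducts.of_hasFiniteProducts

/-- Schur's lemma. -/
theorem IsFusion.isBrick (K : Type w) [Field K] [IsAlgClosed K] {C : Type u} [Category.{v} C]
    [Preadditive C] [Linear K C] [MonoidalCategory C] [IsFusion K C] {A : C} (hA : Simple A) :
    IsBrick K A := by
  have : IsAbelian C := IsFusion.toIsAbelian K
  have : ∀ A B : C, Module.Finite K (A ⟶ B) := IsFusion.finite_hom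
  have : HasKernels C := IsAbelian.toHasKernels
  exact ⟨id_nonzero A, fun φ => (endomorphism_simple_eq_smul_id K φ).imp fun _ h => h.symm⟩

/-- A framed crossed pointed category is equivalent to the category of the cocycle. -/
theorem Framing.crossedEquivalent {K : Type w} [Field K] [IsAlgClosed K]
    {𝒟 : CrossedPointedCategory.{b, w, v, u} K} {𝒳 : FinCrossedModule.{a}} {ξ : Zqa 𝒳 K}
    (Θ : Framing 𝒟.crossed 𝒳 ξ.1) : CrossedEquivalent 𝒟 (catOf ξ) := by
  have := 𝒟.fusion
  have : MonoidalPreadditive 𝒟.C := IsFusion.monoidalPreadditive K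
  have : MonoidalLinear K 𝒟.C := IsFusion.monoidalLinear
  have : ∀ A B : 𝒟.C, Module.Finite K (A ⟶ B) := IsFusion.finite_hom
  have : HasFiniteBiproducts 𝒟.C := IsFusion.hasFiniteBiproducts K
  have : Fact (IsBrick K (𝟙_ 𝒟.C)) := ⟨IsFusion.isBrick K (IsFusion.simple_unit K)⟩
  exact ⟨Θ.vecCrossedFunctor, Θ.f.bijective, Θ.vecFunctor_isEquivalence⟩

/-! ### The tautological framing -/

section Tautological

open TwVec

variable {K : Type w} [Field K] {𝒳 : FinCrossedModule.{a}} (ξ : Zqa 𝒳 K)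

theorem isBrickBasis_line : IsBrickBasis K (line (omega ξ)) where
  brick x := ⟨id_line_ne_zero x, line_end⟩
  hom_eq_zero {x y} h φ := line_hom_ext <| by
    rcases line_isHom (φ.isHom x _ (e_isHom x)) with h' | h'
    · exact absurd h' h
    · exact h'
  decomp A := by
    obtain ⟨n, x, i, p, -, -, h⟩ := exists_lines A
    exact ⟨n, x, i, p, h⟩

variable {ξ}

theorem isHom_toT_e (g : 𝒳.G) {x y : 𝒳.X} (h : g • x = y) :
    ((act ξ g).obj (line (omega ξ) x)).gr.IsHom y (toT g _ (e _ x)) := by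
  subst h; exact T_isHom g (e_isHom x)

theorem isIso_ofVec_toT_e (g : 𝒳.G) {x y : 𝒳.X} (h : g • x = y) :
    IsIso (ofVec (isHom_toT_e (ξ := ξ) g h)) := by
  refine isIso_of_isHom _ (fun z v _ h0 => ?_) fun z w hw => ?_
  · obtain ⟨r, rfl⟩ := line_eq_smul v
    rw [map_smul, ofVec_e, ← map_smul, LinearEquiv.map_eq_zero_iff] at h0
    rw [(smul_eq_zero.1 h0).resolve_right (e_ne_zero x), zero_smul]
  · obtain ⟨z, v, -, rfl, rfl⟩ := exists_of_T_isHom hw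
    obtain ⟨r, rfl⟩ := line_eq_smul v
    exact ⟨r • e _ y, by rw [map_smul, ofVec_e, map_smul]⟩

/-- The isomorphism `line (g • x) ≅ T_g (line x)`. -/
def lineAct (g : 𝒳.G) {x y : 𝒳.X} (h : g • x = y) :
    line (omega ξ) y ≅ (act ξ g).obj (line (omega ξ) x) :=
  @asIso _ _ _ _ _ (isIso_ofVec_toT_e g h)

theorem lineAct_e (g : 𝒳.G) {x y : 𝒳.X} (h : g • x = y) :
    (lineAct (ξ := ξ) g h).hom.lin (e _ y) = toT g _ (e _ x) :=
  ofVec_e (isHom_toT_e g h)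

theorem refl_smul {g : 𝒳.G} {x y : 𝒳.X} (h : MulEquiv.refl 𝒳.G g • x = y) : g • x = y := h

theorem supp_line {g : 𝒳.G} {x : 𝒳.X} (h : MulEquiv.refl 𝒳.G g = 𝒳.bd x) :
    supp ξ g (line (omega ξ) x) := fun y v hv h0 => by
  rcases line_isHom hv with rfl | h'
  · exact h.symm
  · exact absurd h' h0

theorem lineAct_δ (g : 𝒳.G) {x y xy gx gy gxy : 𝒳.X} (h1 : x * y = xy) (h2 : g • xy = gxy)
    (h3 : g • x = gx) (h4 : g • y = gy) (h5 : gx * gy = gxy) :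
    (lineAct g h2).hom ≫ (act ξ g).map (lineTens (omega ξ) h1).inv ≫
        Functor.OplaxMonoidal.δ (act ξ g) _ _ =
      (ξ.1.μ g x y : K) • (lineTens (omega ξ) h5).inv ≫
        ((lineAct g h3).hom ⊗ₘ (lineAct g h4).hom) :=
  line_hom_ext <| by
    simp only [comp_lin_apply, smul_lin, LinearMap.smul_apply]
    rw [lineAct_e, lineTens_inv_e, tensorHom_tm, lineAct_e, lineAct_e, act_map, lineTens_inv_e,
      δ_tm g (e_isHom x) (e_isHom y)]

theorem lineAct_γ (g h : 𝒳.G) {x hx ghx : 𝒳.X} (h1 : (g * h) • x = ghx) (h2 : h • x = hx)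
    (h3 : g • hx = ghx) :
    (lineAct (g * h) h1).hom ≫ (gammaIso ξ g h).hom.app _ =
      (ξ.1.γ g h x : K) • (lineAct g h3).hom ≫ (act ξ g).map (lineAct h h2).hom :=
  line_hom_ext <| by
    simp only [comp_lin_apply, smul_lin, LinearMap.smul_apply]
    rw [lineAct_e, lineAct_e, act_map, lineAct_e, gammaIso_toT g h (e_isHom x)]

theorem lineTens_braid {g : 𝒳.G} {x y xy z : 𝒳.X} (hg : supp ξ g (line (omega ξ) x))
    (h1 : x * y = xy) (h2 : g • y = z) (h3 : z * x = xy) :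
    (lineTens (omega ξ) h1).inv ≫ (braid g _ hg (line (omega ξ) y)).hom =
      (ξ.1.c x y : K) • (lineTens (omega ξ) h3).inv ≫ (lineAct g h2).hom ▷ _ :=
  line_hom_ext <| by
    simp only [comp_lin_apply, smul_lin, LinearMap.smul_apply]
    rw [lineTens_inv_e, lineTens_inv_e, whiskerRight_tm, lineAct_e,
      braid_tm _ (e_isHom x) (e_isHom y)]

variable (ξ)

/-- The framing of `C(ξ)` by the one-dimensional spaces. -/
def lineFraming : Framing (crossedStructure ξ) 𝒳 ξ.1 where
  f := .refl _
  s := line (omega ξ)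
  basis := isBrickBasis_line ξ
  comp hg := supp_line hg
  m h := (lineTens (omega ξ) h).symm
  t g _ _ h := lineAct g (refl_smul h)
  m_assoc {x y z _ _ _} h1 h2 h3 h4 := line_hom_ext <| by
    simp only [comp_lin_apply, Iso.symm_hom, smul_lin, LinearMap.smul_apply]
    rw [lineTens_inv_e, lineTens_inv_e, whiskerRight_tm, whiskerLeft_tm, lineTens_inv_e,
      lineTens_inv_e, associator_tm (e_isHom x) (e_isHom y) (e_isHom z)]
    rfl
  t_δ g _ _ _ _ _ _ h1 h2 h3 h4 h5 := lineAct_δ g h1 h2 h3 h4 h5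
  t_γ g h _ _ _ h1 h2 h3 := lineAct_γ g h h1 h2 h3
  m_c hg h1 h2 h3 := lineTens_braid (supp_line hg) h1 h2 h3

end Tautological

/-! ### Change of framing -/

namespace Framing

open Functor.OplaxMonoidal

variable {K : Type w} [Field K] {C : Type u} [Category.{v} C] [Preadditive C] [Linear K C]
  [MonoidalCategory C] {G : Type b} [Group G] {S : CrossedStructure K C G}
  {𝒳 𝒳' : FinCrossedModule.{a}}

/-- Rescaling an isomorphism by a unit. -/
def _root_.CrossedPointed.unitSmulIso {A B : C} (r : Kˣ) (i : A ≅ B) : A ≅ B where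
  hom := (r : K) • i.hom
  inv := ((r⁻¹ : Kˣ) : K) • i.inv
  hom_inv_id := by simp [smul_smul]
  inv_hom_id := by simp [smul_smul]

theorem _root_.CrossedPointed.FinCrossedModule.Iso.F_mul {φ : 𝒳'.Iso 𝒳} {x y z : 𝒳'.X}
    (h : x * y = z) : φ.F x * φ.F y = φ.F z := by rw [← map_mul, h]

theorem _root_.CrossedPointed.FinCrossedModule.Iso.F_trans_smul {φ : 𝒳'.Iso 𝒳}
    {f : G ≃* 𝒳.G} {g : G} {x y : 𝒳'.X} (h : f.trans φ.f.symm g • x = y) : f g • φ.F x = φ.F y := by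
  rw [← h, φ.F_smul]; simp

/-- Two framings of the same crossed category have isomorphic crossed modules, since both index the
isomorphism classes of simple objects. -/
theorem exists_iso_of_framings {ξ : Cochain 𝒳 K} {ξ' : Cochain 𝒳' K}
    (Θ : Framing S 𝒳 ξ) (Θ' : Framing S 𝒳' ξ') :
    ∃ φ : 𝒳.Iso 𝒳', φ.f = Θ.f.symm.trans Θ'.f ∧
    ∀ x, Nonempty (Θ.s x ≅ Θ'.s (φ.F x)) := by
  choose F hF using fun x => Θ'.basis.exists_iso (Θ.basis.brick x)
  choose F' hF' using fun x => Θ.basis.exists_iso (Θ'.basis.brick x)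
  have smul : ∀ g x, F (g • x) = Θ'.f (Θ.f.symm g) • F x := fun g x => by
    refine Θ'.basis.eq_of_iso ((hF (g • x)).some ≪≫ Θ.t (Θ.f.symm g) (by simp) ≪≫
      (S.T _).mapIso (hF x).some.symm ≪≫ (Θ'.t _ rfl).symm)
  refine ⟨⟨Θ.f.symm.trans Θ'.f, MulEquiv.mk' ⟨F, F', fun x => ?_, fun x => ?_⟩ fun x y => ?_,
    fun x => ?_, smul⟩, rfl, fun x => ⟨(hF x).some.symm⟩⟩
  · exact Θ.basis.eq_of_iso ((hF' _).some ≪≫ (hF x).some)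
  · exact Θ'.basis.eq_of_iso ((hF _).some ≪≫ (hF' x).some)
  · exact Θ'.basis.eq_of_iso ((hF _).some ≪≫ Θ.m rfl ≪≫
      ((hF x).some.symm ⊗ᵢ (hF y).some.symm) ≪≫ (Θ'.m rfl).symm)
  · change 𝒳'.bd (F x) = Θ'.f (Θ.f.symm (𝒳.bd x))
    by_contra h
    refine (Θ'.basis.brick (F x)).ne_zero_of_isIso (hF x).some.hom (S.hom_eq_zero
      (Θ'.comp (Θ'.f.apply_symm_apply _)) (Θ.comp (Θ.f.apply_symm_apply _)) (fun h' => h ?_) _)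
    rw [← h', Θ'.f.apply_symm_apply]

variable [MonoidalPreadditive C] [MonoidalLinear K C]

/-- A framing can be reindexed along an isomorphism of crossed modules, and the isomorphisms it
consists of can be rescaled; this replaces the cocycle by its pull-back times a coboundary. -/
def change {ξ : Cochain 𝒳 K} (Θ : Framing S 𝒳 ξ) (φ : 𝒳'.Iso 𝒳)
    (p : (𝒳'.X → 𝒳'.X → Kˣ) × (𝒳'.G → 𝒳'.X → Kˣ)) :
    Framing S 𝒳' (pullCochain K φ ξ * coboundary 𝒳' K p) where
  f := Θ.f.trans φ.f.symm
  s x := Θ.s (φ.F x)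
  basis :=
    { brick := fun x => Θ.basis.brick _
      hom_eq_zero := fun h => Θ.basis.hom_eq_zero fun h' => h (φ.F.injective h')
      decomp := fun A => by
        obtain ⟨n, x, i, q, h⟩ := Θ.basis.decomp A
        obtain ⟨x, rfl⟩ : ∃ x', x = fun j => φ.F (x' j) :=
          ⟨fun j => φ.F.symm (x j), funext fun j => (φ.F.apply_symm_apply _).symm⟩
        exact ⟨n, x, i, q, h⟩ }
  comp {g x} h := Θ.comp (by rw [φ.bd_F, ← h]; simp)
  m {x y _} h := unitSmulIso (p.1 x y)⁻¹ (Θ.m (FinCrossedModule.Iso.F_mul h))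
  t g {x _} h := unitSmulIso (p.2 (φ.f.symm (Θ.f g)) x)⁻¹
    (Θ.t g (FinCrossedModule.Iso.F_trans_smul h))
  m_assoc {x y z _ _ _} h1 h2 h3 h4 := by
    have key := Θ.m_assoc (x := φ.F x) (y := φ.F y) (z := φ.F z) (FinCrossedModule.Iso.F_mul h1)
      (FinCrossedModule.Iso.F_mul h2) (FinCrossedModule.Iso.F_mul h3)
      (FinCrossedModule.Iso.F_mul h4)
    subst h1 h2 h3
    simp only [unitSmulIso, MonoidalLinear.smul_whiskerRight, MonoidalLinear.whiskerLeft_smul,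
      Linear.smul_comp, Linear.comp_smul, smul_smul]
    rw [key, smul_smul]
    congr 1
    simp only [Cochain.ω_mul, Pi.mul_apply, pullCochain_ω]
    simp only [coboundary, MonoidHom.coe_mk, OneHom.coe_mk, Cochain.ω]
    push_cast
    field_simp
  t_δ g {x y _ _ _ _} h1 h2 h3 h4 h5 := by
    have key := Θ.t_δ g (x := φ.F x) (y := φ.F y) (FinCrossedModule.Iso.F_mul h1)
      (FinCrossedModule.Iso.F_trans_smul h2) (FinCrossedModule.Iso.F_trans_smul h3)
      (FinCrossedModule.Iso.F_trans_smul h4) (FinCrossedModule.Iso.F_mul h5)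
    subst h1 h2 h3 h4
    simp only [unitSmulIso, MonoidalCategory.tensorHom_def, Functor.map_smul,
      MonoidalLinear.smul_whiskerRight, MonoidalLinear.whiskerLeft_smul,
      Linear.smul_comp, Linear.comp_smul, smul_smul] at key ⊢
    rw [key, smul_smul]
    congr 1
    simp only [Cochain.μ_mul, Pi.mul_apply, pullCochain_μ]
    simp only [coboundary, MonoidHom.coe_mk, OneHom.coe_mk, Cochain.μ, MulEquiv.trans_apply,
      MulEquiv.apply_symm_apply]
    push_cast
    field_simp
  t_γ g h {x _ _} h1 h2 h3 := by
    have key := Θ.t_γ g h (x := φ.F x) (FinCrossedModule.Iso.F_trans_smul h1)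
      (FinCrossedModule.Iso.F_trans_smul h2) (FinCrossedModule.Iso.F_trans_smul h3)
    subst h2 h3
    simp only [unitSmulIso, Functor.map_smul, Linear.smul_comp, Linear.comp_smul,
      smul_smul (M := K)]
    rw [key, smul_smul (M := K)]
    congr 1
    simp only [Cochain.γ_mul, Pi.mul_apply, pullCochain_γ]
    simp only [coboundary, MonoidHom.coe_mk, OneHom.coe_mk, Cochain.γ, MulEquiv.trans_apply,
      MulEquiv.apply_symm_apply, map_mul]
    push_cast
    field_simp
  m_c {g x y _ _} hg h1 h2 h3 := by
    have hg' : Θ.f g = 𝒳.bd (φ.F x) := by rw [φ.bd_F, ← hg]; simp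
    have key := Θ.m_c (y := φ.F y) hg' (FinCrossedModule.Iso.F_mul h1)
      (FinCrossedModule.Iso.F_trans_smul h2) (FinCrossedModule.Iso.F_mul h3)
    subst h1
    have h4 : x * y * x⁻¹ = _ := eq_mul_inv_of_mul_eq h3 |>.symm
    simp only [unitSmulIso, MonoidalLinear.smul_whiskerRight,
      Linear.smul_comp, Linear.comp_smul, smul_smul]
    rw [key, smul_smul]
    congr 1
    simp only [Cochain.c_mul, Pi.mul_apply, pullCochain_c]
    simp only [coboundary, MonoidHom.coe_mk, OneHom.coe_mk, Cochain.c, h4, ← hg,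
      MulEquiv.trans_apply]
    push_cast
    field_simp

/-- The cocycles of two framings of the same crossed category differ by an isomorphism of crossed
modules and a coboundary. -/
theorem exists_eq_pullCochain_mul_coboundary {ξ : Cochain 𝒳 K} {ξ' : Cochain 𝒳' K}
    (Θ : Framing S 𝒳 ξ) (Θ' : Framing S 𝒳' ξ') :
    ∃ (φ : 𝒳.Iso 𝒳')
    (p : (𝒳.X → 𝒳.X → Kˣ) × (𝒳.G → 𝒳.X → Kˣ)),
    ξ = pullCochain K φ ξ' * coboundary 𝒳 K p := by
  obtain ⟨φ, hf, hs⟩ := exists_iso_of_framings Θ Θ'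
  have hf : ∀ g, φ.f (Θ.f g) = Θ'.f g := fun g => by rw [hf]; simp
  let i := fun x => (hs x).some
  -- the identifications `i x` respect `m` and `t` up to scalars `η` and `β`
  have hm : ∀ {x y z}, x * y = z → φ.F x * φ.F y = φ.F z := fun h => by rw [← map_mul, h]
  have ht : ∀ {g x y}, Θ.f g • x = y → Θ'.f g • φ.F x = φ.F y := fun h => by
    rw [← h, φ.F_smul, hf]
  have hη : ∀ x y, ∃ r : Kˣ, ∀ {z} (h : x * y = z), (i z).hom ≫ (Θ'.m (hm h)).hom =
      (r : K) • Θ.star h (i x).hom (i y).hom := fun x y => by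
    obtain ⟨r, hr⟩ := (Θ.basis.brick (x * y)).exists_unit (i (x * y) ≪≫ Θ'.m (hm rfl))
      (Θ.m rfl ≪≫ (i x ⊗ᵢ i y))
    exact ⟨r, fun h => by subst h; exact hr⟩
  choose η hη using hη
  have hβ : ∀ g x, ∃ r : Kˣ, ∀ {y} (h : Θ.f (Θ.f.symm g) • x = y),
      (i y).hom ≫ (Θ'.t (Θ.f.symm g) (ht h)).hom =
        (r : K) • Θ.tr (Θ.f.symm g) h (i x).hom := fun g x => by
    obtain ⟨r, hr⟩ := (Θ.basis.brick _).exists_unit (i _ ≪≫ Θ'.t (Θ.f.symm g) (ht rfl))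
      (Θ.t (Θ.f.symm g) rfl ≪≫ (S.T _).mapIso (i x))
    exact ⟨r, fun h => by subst h; exact hr⟩
  choose β hβ using hβ
  have hβ : ∀ g {x y} (h : Θ.f g • x = y), (i y).hom ≫ (Θ'.t g (ht h)).hom =
      (β (Θ.f g) x : K) • Θ.tr g h (i x).hom := fun g x y h => by
    obtain ⟨g, rfl⟩ := Θ.f.symm.surjective g
    rw [hβ, Θ.f.apply_symm_apply]
  refine ⟨φ, (η, β), Prod.ext ?_ (Prod.ext ?_ (Prod.ext ?_ ?_))⟩
  · funext x y z
    have key := congrArg ((i (x * y * z)).hom ≫ ·) (Θ'.m_assoc (hm (x := x) (y := y) rfl)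
      (hm (y := z) rfl) (hm rfl) (hm (mul_assoc x y z).symm))
    simp only [Linear.comp_smul, ← Category.assoc] at key
    rw [hη _ _ rfl, Linear.smul_comp, Linear.smul_comp, star_whiskerRight, hη _ _ rfl,
      star_smul_left, Linear.smul_comp, Θ.star_assoc _ _ rfl (mul_assoc x y z).symm,
      hη _ _ (mul_assoc x y z).symm, Linear.smul_comp, star_whiskerLeft, hη _ _ rfl,
      star_smul_right] at key
    simp only [smul_smul] at key
    have := (Θ.basis.brick _).smul_left_injective key
    refine Units.ext ?_
    change (ξ.ω x y z : K) = _
    simp only [Prod.fst_mul, Pi.mul_apply, coboundary, MonoidHom.coe_mk, OneHom.coe_mk]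
    push_cast
    change _ = (ξ'.ω _ _ _ : K) * _
    field_simp
    linear_combination this
  · funext g h x
    obtain ⟨g, rfl⟩ := Θ.f.surjective g
    obtain ⟨h, rfl⟩ := Θ.f.surjective h
    have e1 : Θ.f g • Θ.f h • x = Θ.f (g * h) • x := by rw [map_mul, mul_smul]
    have key := congrArg ((i (Θ.f (g * h) • x)).hom ≫ ·) (Θ'.t_γ g h (ht rfl) (ht rfl) (ht e1))
    simp only [Linear.comp_smul, ← Category.assoc] at key
    rw [hβ _ rfl, Linear.smul_comp, Θ.tr_γ g h _ rfl e1, hβ _ e1, Linear.smul_comp, tr_map,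
      hβ _ rfl, tr_smul] at key
    simp only [smul_smul (M := K)] at key
    have := (Θ.basis.brick _).smul_left_injective key
    refine Units.ext ?_
    change (ξ.γ _ _ x : K) = _
    simp only [Prod.fst_mul, Prod.snd_mul, Pi.mul_apply, coboundary, MonoidHom.coe_mk,
      OneHom.coe_mk]
    push_cast
    change _ = (ξ'.γ (φ.f (Θ.f g)) (φ.f (Θ.f h)) _ : K) * _
    rw [hf, hf]
    rw [map_mul] at this
    field_simp
    linear_combination this
  · funext g x y
    obtain ⟨g, rfl⟩ := Θ.f.surjective g
    have e1 := (smul_mul' (Θ.f g) x y).symm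
    have key := congrArg ((i (Θ.f g • (x * y))).hom ≫ ·)
      (Θ'.t_δ g (hm rfl) (ht rfl) (ht rfl) (ht rfl) (hm e1))
    simp only [Linear.comp_smul, ← Category.assoc] at key
    rw [hβ _ rfl, Linear.smul_comp, Linear.smul_comp, tr_map, hη _ _ rfl, tr_smul,
      Linear.smul_comp, Θ.tr_δ g _ _ rfl rfl e1, hη _ _ e1, Linear.smul_comp, star_comp, hβ _ rfl,
      hβ _ rfl, star_smul_left,
      star_smul_right] at key
    simp only [smul_smul (M := K)] at key
    have := (Θ.basis.brick _).smul_left_injective key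
    refine Units.ext ?_
    change (ξ.μ _ x y : K) = _
    simp only [Prod.fst_mul, Prod.snd_mul, Pi.mul_apply, coboundary, MonoidHom.coe_mk,
      OneHom.coe_mk]
    push_cast
    change _ = (ξ'.μ (φ.f (Θ.f g)) _ _ : K) * _
    rw [hf]
    field_simp
    linear_combination this
  · funext x y
    obtain ⟨g, hg⟩ := Θ.f.surjective (𝒳.bd x)
    have e1 : Θ.f g • y = x * y * x⁻¹ := by rw [hg, 𝒳.bd_smul]
    have e2 : x * y * x⁻¹ * x = x * y := inv_mul_cancel_right _ _
    have key := congrArg ((i (x * y)).hom ≫ ·)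
      (Θ'.m_c (by rw [φ.bd_F, ← hg, hf]) (hm rfl) (ht e1) (hm e2))
    simp only [Linear.comp_smul, ← Category.assoc] at key
    rw [hη _ _ rfl, Linear.smul_comp, Θ.star_c hg _ _ e1 e2, hη _ _ e2, Linear.smul_comp,
      star_whiskerRight, hβ _ e1, star_smul_left] at key
    simp only [smul_smul (M := K)] at key
    have := (Θ.basis.brick _).smul_left_injective key
    refine Units.ext ?_
    change (ξ.c x y : K) = _
    simp only [Prod.snd_mul, Pi.mul_apply, coboundary, MonoidHom.coe_mk,
      OneHom.coe_mk, ← hg]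
    push_cast
    change _ = (ξ'.c _ _ : K) * _
    field_simp
    linear_combination this

end Framing

/-! ### Composition of crossed functors -/

attribute [instance] CrossedFunctor.F_additive CrossedFunctor.F_linear CrossedFunctor.F_monoidal
  CrossedFunctor.β_monoidal

namespace GroupGrading

variable {C : Type u} [Category.{v} C] [Preadditive C] [MonoidalCategory C] {G : Type b} [Group G]
  (S : GroupGrading C G)

/-- An object without nonzero morphisms to the other components lies in the component of `g`. -/
theorem comp_of_hom_eq_zero {g : G} {A : C}
    (h : ∀ {k B}, S.comp k B → k ≠ g → ∀ φ : A ⟶ B, φ = 0) : S.comp g A := by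
  obtain ⟨Y, hY, b, ⟨hb⟩, ⟨i⟩⟩ := S.exists_decomp A
  have h0 : ∀ k, k ≠ g → b.π k = 0 := fun k hk => by
    rw [← cancel_epi i.hom, h (hY k) hk (i.hom ≫ b.π k), comp_zero]
  have h1 : b.π g ≫ b.ι g = 𝟙 b.pt := hb.isLimit.hom_ext fun ⟨k⟩ => by
    change (b.π g ≫ b.ι g) ≫ b.π k = 𝟙 _ ≫ b.π k
    by_cases hk : k = g
    · subst hk; simp
    · rw [h0 k hk, comp_zero, comp_zero]
  exact S.comp_iso g (⟨b.ι g ≫ i.inv, i.hom ≫ b.π g, by simp, by simp [reassoc_of% h1]⟩) (hY g)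

/-- A brick lies in a single component. -/
theorem exists_comp (K : Type w) [Field K] [Linear K C] {A : C} (hA : IsBrick K A) :
    ∃ g, S.comp g A := by
  obtain ⟨Y, hY, b, ⟨hb⟩, ⟨i⟩⟩ := S.exists_decomp A
  obtain ⟨k, hk⟩ : ∃ k, b.π k ≠ 0 := by
    by_contra! h
    refine hA.id_ne_zero ?_
    have h0 : i.hom = 0 := hb.isLimit.hom_ext fun ⟨k⟩ => by
      change i.hom ≫ b.π k = 0 ≫ b.π k
      rw [h, comp_zero, comp_zero]
    rw [← i.hom_inv_id, h0, zero_comp]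
  refine ⟨k, S.comp_of_hom_eq_zero fun {l B} hB hl φ => ?_⟩
  -- the projection onto the `k`-th summand is a nonzero idempotent of `A`, hence invertible
  obtain ⟨r, hr⟩ := hA.endo (i.hom ≫ b.π k ≫ b.ι k ≫ i.inv)
  have h1 : r • (i.hom ≫ b.π k) = i.hom ≫ b.π k := by
    have := congrArg (· ≫ i.hom ≫ b.π k) hr
    simpa using this.symm
  have h2 : r • φ = 0 := by
    have := congrArg (· ≫ φ) hr
    simp only [Category.assoc, Linear.smul_comp, Category.id_comp] at this
    rw [← this, S.hom_eq_zero (hY k) hB hl.symm (b.ι k ≫ i.inv ≫ φ), comp_zero, comp_zero]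
  refine (smul_eq_zero.1 h2).resolve_left fun hr0 => hk ?_
  rw [← cancel_epi i.hom, ← h1, hr0, zero_smul, comp_zero]

end GroupGrading

namespace CrossedFunctor

open Functor.OplaxMonoidal

universe u₁ v₁ a₁ u₂ v₂ a₂ u₃ v₃ a₃

variable {K : Type w} [Field K]
  {C : Type u₁} [Category.{v₁} C] [Preadditive C] [Linear K C] [MonoidalCategory C]
  {G : Type a₁} [Group G] {S : CrossedStructure K C G}
  {D : Type u₂} [Category.{v₂} D] [Preadditive D] [Linear K D] [MonoidalCategory D]
  {H : Type a₂} [Group H] {S' : CrossedStructure K D H}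

section Aux

variable (Φ : CrossedFunctor S S')

/-- The isomorphism `β g`, with `Φ.f g` replaced by an element equal to it. -/
def βOf (g : G) {h : H} (p : Φ.f g = h) : S.T g ⋙ Φ.F ≅ Φ.F ⋙ S'.T h :=
  Φ.β g ≪≫ eqToIso (by rw [p])

theorem βOf_rfl (g : G) : Φ.βOf g rfl = Φ.β g := by
  ext X; simp [βOf]

instance (g : G) {h : H} (p : Φ.f g = h) : NatTrans.IsMonoidal (Φ.βOf g p).hom := by
  subst p; rw [βOf_rfl]; infer_instance

theorem βOf_c {g : G} {h : H} (p : Φ.f g = h) {X : C} (hX : S.comp g X)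
    (hX' : S'.comp h (Φ.F.obj X)) (Y : C) :
    Φ.F.map (S.c g X hX Y).hom ≫ δ Φ.F ((S.T g).obj Y) X ≫
        (Φ.βOf g p).hom.app Y ▷ Φ.F.obj X =
      δ Φ.F X Y ≫ (S'.c h (Φ.F.obj X) hX' (Φ.F.obj Y)).hom := by
  subst p
  rw [βOf_rfl]
  exact Φ.F_c hX Y

theorem βOf_app_eqToHom {k l : G} {h h' : H} (p : Φ.f k = h) (p' : Φ.f l = h') (q : k = l)
    (q' : h = h') (X : C) :
    Φ.F.map (eqToHom (congrArg (fun l => (S.T l).obj X) q)) ≫ (Φ.βOf l p').hom.app X =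
      (Φ.βOf k p).hom.app X ≫ eqToHom (congrArg (fun l => (S'.T l).obj (Φ.F.obj X)) q') := by
  subst q q'; simp

theorem βOf_γ {g h : G} {g' h' : H} (p : Φ.f g = g') (q : Φ.f h = h')
    (r : Φ.f (g * h) = g' * h') (X : C) :
    Φ.F.map ((S.γ g h).hom.app X) ≫ (Φ.βOf g p).hom.app ((S.T h).obj X) ≫
        (S'.T g').map ((Φ.βOf h q).hom.app X) =
      (Φ.βOf (g * h) r).hom.app X ≫ (S'.γ g' h').hom.app (Φ.F.obj X) := by
  subst p q
  have h1 := Φ.βOf_app_eqToHom (k := g * h) rfl r rfl (map_mul Φ.f g h) X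
  rw [eqToHom_refl, CategoryTheory.Functor.map_id, Category.id_comp] at h1
  rw [h1, βOf_rfl, βOf_rfl, βOf_rfl, Category.assoc]
  exact Φ.β_γ g h X

end Aux

section Comp

variable {E : Type u₃} [Category.{v₃} E] [Preadditive E] [Linear K E] [MonoidalCategory E]
  {L : Type a₃} [Group L] {S'' : CrossedStructure K E L}
  (Φ : CrossedFunctor S S') (Ψ : CrossedFunctor S' S'')

/-- The isomorphisms `β` of the composition of two crossed functors. -/
def compβ (g : G) : S.T g ⋙ Φ.F ⋙ Ψ.F ≅ (Φ.F ⋙ Ψ.F) ⋙ S''.T (Ψ.f (Φ.f g)) :=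
  (Functor.associator _ _ _).symm ≪≫ Functor.isoWhiskerRight (Φ.β g) Ψ.F ≪≫
    Functor.associator _ _ _ ≪≫ Functor.isoWhiskerLeft Φ.F (Ψ.β (Φ.f g)) ≪≫
    (Functor.associator _ _ _).symm

theorem compβ_app (g : G) (X : C) : (compβ Φ Ψ g).hom.app X =
    Ψ.F.map ((Φ.β g).hom.app X) ≫ (Ψ.β (Φ.f g)).hom.app (Φ.F.obj X) := by
  simp [compβ]

instance (g : G) : NatTrans.IsMonoidal (compβ Φ Ψ g).hom := by
  unfold compβ
  simp only [Iso.trans_hom, Functor.isoWhiskerRight_hom, Functor.isoWhiskerLeft_hom, Iso.symm_hom]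
  infer_instance

/-- Composition of crossed functors. -/
def comp : CrossedFunctor S S'' where
  f := Ψ.f.comp Φ.f
  F := Φ.F ⋙ Ψ.F
  β := compβ Φ Ψ
  F_comp hX := Ψ.F_comp (Φ.F_comp hX)
  F_c {g X} hX Y := by
    have h1 := Φ.F_c hX Y
    have h2 := Ψ.F_c (Φ.F_comp hX) (Φ.F.obj Y)
    rw [compβ_app]
    simp only [Functor.comp_map, comp_δ, comp_whiskerRight, Functor.comp_obj, Category.assoc]
    rw [δ_natural_left_assoc, ← Ψ.F.map_comp_assoc, ← Ψ.F.map_comp_assoc, Category.assoc, h1,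
      Ψ.F.map_comp, Category.assoc, h2]
    rfl
  β_γ g h X := by
    have h1 := congrArg Ψ.F.map (Φ.β_γ g h X)
    have h2 := Ψ.β_γ (Φ.f g) (Φ.f h) (Φ.F.obj X)
    have h3 := Ψ.βOf_app_eqToHom (k := Φ.f (g * h)) rfl rfl (map_mul Φ.f g h)
      (congrArg Ψ.f (map_mul Φ.f g h)) (Φ.F.obj X)
    have h4 := (Ψ.β (Φ.f g)).hom.naturality ((Φ.β h).hom.app X)
    simp only [Functor.map_comp, Functor.comp_map, Functor.comp_obj, βOf_rfl] at h1 h3 h4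
    simp only [compβ_app, Functor.comp_map, Functor.comp_obj, Functor.map_comp, Category.assoc]
    dsimp only [MonoidHom.comp_apply]
    rw [← reassoc_of% h4, reassoc_of% h1, h2, reassoc_of% h3, eqToHom_trans_assoc]

end Comp

section Symm

theorem map_δ_counit (Φ : CrossedFunctor S S') {P : D ⥤ C} (ε : P ⋙ Φ.F ≅ 𝟭 D) [P.Monoidal]
    [NatTrans.IsMonoidal ε.hom] (X Y : D) : Φ.F.map (δ P X Y) ≫ δ Φ.F (P.obj X) (P.obj Y) =
    ε.hom.app (X ⊗ Y) ≫ (ε.inv.app X ⊗ₘ ε.inv.app Y) := by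
  have h := δ_comp_app ε.hom X Y
  rw [comp_δ] at h
  rw [← cancel_mono (ε.hom.app X ⊗ₘ ε.hom.app Y), h, Category.assoc, tensorHom_comp_tensorHom]
  simp

variable (Φ : CrossedFunctor S S') [Φ.F.Full] [Φ.F.Faithful] {P : D ⥤ C}
  (ε : P ⋙ Φ.F ≅ 𝟭 D)

/-- The isomorphisms `β` of the inverse of a crossed functor. -/
def symmβ {g : G} {h : H} (p : Φ.f g = h) : S'.T h ⋙ P ≅ P ⋙ S.T g :=
  NatIso.ofComponents (fun Y => Φ.F.preimageIso (ε.app ((S'.T h).obj Y) ≪≫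
      (S'.T h).mapIso (ε.app Y).symm ≪≫ (Φ.βOf g p).symm.app (P.obj Y)))
    fun {X Y} k => Φ.F.map_injective <| by
      have h1 := ε.hom.naturality ((S'.T h).map k)
      have h2 := ε.inv.naturality k
      have h3 := (Φ.βOf g p).inv.naturality (P.map k)
      simp only [Functor.comp_map, Functor.comp_obj, Functor.id_map, Functor.id_obj] at h1 h2 h3
      simp only [Functor.comp_map, Functor.comp_obj, Functor.map_comp, Functor.preimageIso_hom,
        Functor.map_preimage, Iso.trans_hom, Functor.mapIso_hom, Iso.symm_hom, Iso.app_hom,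
        Iso.app_inv, Category.assoc]
      rw [reassoc_of% h1, ← h3, ← (S'.T h).map_comp_assoc, h2, (S'.T h).map_comp_assoc]

theorem map_symmβ {g : G} {h : H} (p : Φ.f g = h) (Y : D) :
    Φ.F.map ((Φ.symmβ ε p).hom.app Y) = ε.hom.app ((S'.T h).obj Y) ≫
      (S'.T h).map (ε.inv.app Y) ≫ (Φ.βOf g p).inv.app (P.obj Y) := by
  simp [symmβ]

/-- Monoidality of a transformation can be checked after a faithful monoidal functor. -/
theorem isMonoidal_of_whiskerRight {A B A' : Type*} [Category A] [Category B] [Category A']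
    [MonoidalCategory A] [MonoidalCategory B] [MonoidalCategory A'] {F F' : A ⥤ B} [F.Monoidal]
    [F'.Monoidal] (τ : F ⟶ F') (U : B ⥤ A') [U.Monoidal] [U.Faithful]
    [NatTrans.IsMonoidal (Functor.whiskerRight τ U)] : NatTrans.IsMonoidal τ where
  unit := U.map_injective <| by
    have := NatTrans.IsMonoidal.unit (τ := Functor.whiskerRight τ U)
    simp only [Functor.LaxMonoidal.comp_ε, Functor.whiskerRight_app, Category.assoc,
      cancel_epi, ← Functor.map_comp] at this
    exact this
  tensor X Y := U.map_injective <| by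
    have := NatTrans.IsMonoidal.tensor (τ := Functor.whiskerRight τ U) X Y
    simp only [Functor.LaxMonoidal.comp_μ, Functor.whiskerRight_app, Category.assoc,
      Functor.LaxMonoidal.μ_natural_assoc, cancel_epi, ← Functor.map_comp] at this
    exact this

variable [P.Monoidal] [NatTrans.IsMonoidal ε.hom]

instance instIsMonoidalHomSymmβ {g : G} {h : H} (p : Φ.f g = h) :
    NatTrans.IsMonoidal (Φ.symmβ ε p).hom := by
  have h1 : Functor.whiskerRight (Φ.symmβ ε p).hom Φ.F =
      (Functor.associator _ _ _).hom ≫ Functor.whiskerLeft (S'.T h) ε.hom ≫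
        (Functor.rightUnitor _).hom ≫ (Functor.leftUnitor _).inv ≫
        Functor.whiskerRight ε.inv (S'.T h) ≫ (Functor.associator _ _ _).hom ≫
        Functor.whiskerLeft P (Φ.βOf g p).inv ≫ (Functor.associator _ _ _).inv := by
    ext Y
    simp [map_symmβ]
  have : NatTrans.IsMonoidal (Functor.whiskerRight (Φ.symmβ ε p).hom Φ.F) := by
    rw [h1]; infer_instance
  exact isMonoidal_of_whiskerRight _ Φ.F

end Symm

section Symm

/-- A crossed functor which is injective on groups and faithful reflects the grading. -/
theorem comp_of_comp_obj (Φ : CrossedFunctor S S') [Φ.F.Faithful] (hf : Function.Injective Φ.f)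
    {g : G} {A : C} (hA : S'.comp (Φ.f g) (Φ.F.obj A)) : S.comp g A := by
  refine S.comp_of_hom_eq_zero fun {k B} hB hk φ => Φ.F.map_injective ?_
  exact (S'.hom_eq_zero hA (Φ.F_comp hB) (fun h => hk (hf h).symm) (Φ.F.map φ)).trans
    (Φ.F.map_zero _ _).symm

variable (Φ : CrossedFunctor S S') [Φ.F.Full] [Φ.F.Faithful] {P : D ⥤ C} (ε : P ⋙ Φ.F ≅ 𝟭 D)

theorem map_symmβ_βOf {g : G} {h : H} (p : Φ.f g = h) (Y : D) :
    Φ.F.map ((Φ.symmβ ε p).hom.app Y) ≫ (Φ.βOf g p).hom.app (P.obj Y) =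
      ε.hom.app ((S'.T h).obj Y) ≫ (S'.T h).map (ε.inv.app Y) := by
  rw [map_symmβ, Category.assoc, Category.assoc, Iso.inv_hom_id_app]
  exact congrArg _ (Category.comp_id _)

theorem symmβ_eqToHom {k l : G} {h : H} (p : Φ.f k = h) (p' : Φ.f l = h) (q : k = l) (Y : D) :
    (Φ.symmβ ε p).hom.app Y ≫ eqToHom (congrArg (fun l => (S.T l).obj (P.obj Y)) q) =
      (Φ.symmβ ε p').hom.app Y := by
  subst q; simp

theorem symmβ_γ {g h : G} {g' h' : H} (p : Φ.f g = g') (q : Φ.f h = h')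
    (r : Φ.f (g * h) = g' * h') (Y : D) :
    P.map ((S'.γ g' h').hom.app Y) ≫ (Φ.symmβ ε p).hom.app ((S'.T h').obj Y) ≫
        (S.T g).map ((Φ.symmβ ε q).hom.app Y) =
      (Φ.symmβ ε r).hom.app Y ≫ (S.γ g h).hom.app (P.obj Y) := by
  have h1 := Φ.βOf_γ p q r (P.obj Y)
  have h2 := (Φ.βOf g p).hom.naturality ((Φ.symmβ ε q).hom.app Y)
  have h3 := Φ.map_symmβ_βOf ε p ((S'.T h').obj Y)
  have h4 := Φ.map_symmβ_βOf ε q Y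
  have h5 := Φ.map_symmβ_βOf ε r Y
  have h6 := ε.hom.naturality ((S'.γ g' h').hom.app Y)
  have h7 := (S'.γ g' h').hom.naturality (ε.inv.app Y)
  simp only [Functor.comp_map, Functor.comp_obj, Functor.id_map, Functor.id_obj]
    at h2 h3 h4 h5 h6 h7
  refine Φ.F.map_injective ?_
  rw [← cancel_mono ((Φ.βOf g p).hom.app ((S.T h).obj (P.obj Y))),
    ← cancel_mono ((S'.T g').map ((Φ.βOf h q).hom.app (P.obj Y)))]
  simp only [Functor.map_comp, Category.assoc, Functor.comp_obj]
  rw [h1, reassoc_of% h5, h7, ← reassoc_of% h6, reassoc_of% h2, ← Functor.map_comp, h4,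
    reassoc_of% h3, ← Functor.map_comp]
  have h8 := ε.inv_hom_id_app ((S'.T h').obj Y)
  simp only [Functor.comp_obj, Functor.id_obj] at h8
  rw [reassoc_of% h8]

variable [P.Monoidal] [NatTrans.IsMonoidal ε.hom]

theorem symmβ_c {g : G} {h : H} (p : Φ.f g = h) {X : D} (hX : S'.comp h X)
    (hPX : S.comp g (P.obj X)) (Y : D) :
    P.map (S'.c h X hX Y).hom ≫ δ P ((S'.T h).obj Y) X ≫ (Φ.symmβ ε p).hom.app Y ▷ P.obj X =
      δ P X Y ≫ (S.c g (P.obj X) hPX (P.obj Y)).hom := by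
  have hX' : S'.comp h (Φ.F.obj (P.obj X)) := S'.comp_iso _ (ε.app X).symm hX
  have h1 := Φ.βOf_c p hPX hX' (P.obj Y)
  have h2 := S'.c_natural_left hX hX' (ε.inv.app X) Y
  have h3 := S'.c_natural_right hX' (ε.inv.app Y)
  have h4 := ε.hom.naturality (S'.c h X hX Y).hom
  have h5 := Φ.map_symmβ_βOf ε p Y
  have h6 := ε.inv_hom_id_app ((S'.T h).obj Y)
  simp only [Functor.comp_map, Functor.comp_obj, Functor.id_map, Functor.id_obj] at h2 h3 h4 h5 h6
  refine Φ.F.map_injective ?_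
  rw [← cancel_mono (δ Φ.F ((S.T g).obj (P.obj Y)) (P.obj X)),
    ← cancel_mono ((Φ.βOf g p).hom.app (P.obj Y) ▷ Φ.F.obj (P.obj X))]
  simp only [Functor.map_comp, Category.assoc, Functor.comp_obj]
  rw [h1, reassoc_of% (Φ.map_δ_counit ε X Y), ← δ_natural_left_assoc, ← comp_whiskerRight, h5,
    reassoc_of% (Φ.map_δ_counit ε ((S'.T h).obj Y) X), reassoc_of% h4]
  congr 1
  rw [← tensorHom_id, tensorHom_comp_tensorHom, reassoc_of% h6, Category.comp_id,
    MonoidalCategory.tensorHom_def', ← reassoc_of% h2, ← h3, MonoidalCategory.tensorHom_def,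
    Category.assoc]

variable [P.Additive] [P.Linear K]

/-- The inverse of a crossed equivalence. -/
def symm (e : G ≃* H) (he : ∀ g, Φ.f g = e g) : CrossedFunctor S' S where
  f := e.symm.toMonoidHom
  F := P
  β h := Φ.symmβ ε (g := e.symm h) (by rw [he, e.apply_symm_apply])
  β_monoidal h := instIsMonoidalHomSymmβ Φ ε (g := e.symm h) (by rw [he, e.apply_symm_apply])
  F_comp {h Y} hY := Φ.comp_of_comp_obj (fun a b hab => e.injective (by rwa [← he, ← he])) <|
    S'.comp_iso _ (ε.app Y).symm (by
      change S'.comp (Φ.f (e.symm h)) Y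
      rwa [he, e.apply_symm_apply])
  F_c hX Y := Φ.symmβ_c ε _ hX _ Y
  β_γ g h Y := (Φ.symmβ_γ ε _ _ (by rw [map_mul, he, he, e.apply_symm_apply, e.apply_symm_apply])
    Y).trans <| by
      rw [← Φ.symmβ_eqToHom ε (by rw [he, e.apply_symm_apply]) _ (map_mul e.symm g h) Y,
        Category.assoc]
      rfl

end Symm

end CrossedFunctor

namespace CrossedEquivalent

universe u₁ v₁ a₁ u₂ v₂ a₂ u₃ v₃ a₃

variable {K : Type w} [Field K] {𝒞 : CrossedPointedCategory.{a₁, w, v₁, u₁} K}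
  {𝒟 : CrossedPointedCategory.{a₂, w, v₂, u₂} K} {𝒟' : CrossedPointedCategory.{a₃, w, v₃, u₃} K}

theorem trans (h : CrossedEquivalent 𝒞 𝒟) (h' : CrossedEquivalent 𝒟 𝒟') :
    CrossedEquivalent 𝒞 𝒟' := by
  obtain ⟨Φ, hf, hF⟩ := h
  obtain ⟨Ψ, hf', hF'⟩ := h'
  exact ⟨Φ.comp Ψ, hf'.comp hf, inferInstanceAs (Φ.F ⋙ Ψ.F).IsEquivalence⟩

theorem symm (h : CrossedEquivalent 𝒞 𝒟) : CrossedEquivalent 𝒟 𝒞 := by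
  obtain ⟨Φ, hf, hF⟩ := h
  let E := Φ.F.asEquivalence
  let : E.functor.Monoidal := Φ.F_monoidal
  let : E.inverse.Monoidal := E.inverseMonoidal
  have : E.IsMonoidal := { leftAdjoint_ε := rfl, leftAdjoint_μ := fun _ _ => rfl }
  have : E.functor.Additive := Φ.F_additive
  have : E.functor.Linear K := Φ.F_linear
  have : E.inverse.Additive := E.inverse_additive
  have : E.inverse.Linear K := E.inverseLinear K
  have h : NatTrans.IsMonoidal E.counitIso.hom :=
    inferInstanceAs (NatTrans.IsMonoidal E.toAdjunction.counit)
  let ε : E.inverse ⋙ Φ.F ≅ 𝟭 _ := E.counitIso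
  have : NatTrans.IsMonoidal ε.hom := h
  exact ⟨Φ.symm ε (MulEquiv.ofBijective Φ.f hf) fun _ => rfl,
    (MulEquiv.ofBijective Φ.f hf).symm.bijective, inferInstanceAs E.inverse.IsEquivalence⟩

end CrossedEquivalent

/-! ### Existence of framings -/

open Functor.OplaxMonoidal

section Existence

variable {K : Type w} [Field K] {C : Type u} [Category.{v} C] [Preadditive C] [Linear K C]
  [MonoidalCategory C] {G : Type b} [Group G]

/-- Isomorphisms of the kind required in a framing have the required compatibilities, for suitable
scalars, because their sources are bricks. -/
theorem exists_framing_of_iso (S : CrossedStructure K C G) (𝒳 : FinCrossedModule.{a})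
    (f : G ≃* 𝒳.G) (s : 𝒳.X → C) (basis : IsBrickBasis K s)
    (comp : ∀ {g x}, f g = 𝒳.bd x → S.comp g (s x))
    (hm : ∀ x y, Nonempty (s (x * y) ≅ s x ⊗ s y))
    (ht : ∀ g x, Nonempty (s (f g • x) ≅ (S.T g).obj (s x))) :
    ∃ ξ : Cochain 𝒳 K, Nonempty (Framing S 𝒳 ξ) := by
  let m : ∀ {x y z}, x * y = z → (s z ≅ s x ⊗ s y) := fun {x y z} h =>
    eqToIso (by rw [h]) ≪≫ (hm x y).some
  let t : ∀ g {x y}, f g • x = y → (s y ≅ (S.T g).obj (s x)) := fun g {x y} h =>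
    eqToIso (by rw [h]) ≪≫ (ht g x).some
  have hω : ∀ x y z, ∃ r : Kˣ, ∀ {xy yz xyz} (h1 : x * y = xy) (h2 : xy * z = xyz)
      (h3 : y * z = yz) (h4 : x * yz = xyz),
      (m h2).hom ≫ (m h1).hom ▷ s z ≫ (α_ (s x) (s y) (s z)).hom =
        (r : K) • (m h4).hom ≫ s x ◁ (m h3).hom := fun x y z => by
    obtain ⟨r, hr⟩ := (basis.brick (x * y * z)).exists_unit
      (m rfl ≪≫ whiskerRightIso (m rfl) (s z) ≪≫ α_ (s x) (s y) (s z))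
      (m (mul_assoc x y z).symm ≪≫ whiskerLeftIso (s x) (m rfl))
    refine ⟨r, ?_⟩
    rintro _ _ _ rfl rfl rfl _
    simpa using hr
  have hμ : ∀ k x y, ∃ r : Kˣ, ∀ g, f g = k → ∀ {xy gx gy gxy} (h1 : x * y = xy)
      (h2 : f g • xy = gxy) (h3 : f g • x = gx) (h4 : f g • y = gy) (h5 : gx * gy = gxy),
      (t g h2).hom ≫ (S.T g).map (m h1).hom ≫ δ (S.T g) (s x) (s y) =
        (r : K) • (m h5).hom ≫ ((t g h3).hom ⊗ₘ (t g h4).hom) := fun k x y => by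
    obtain ⟨g, rfl⟩ := f.surjective k
    obtain ⟨r, hr⟩ := (basis.brick (f g • (x * y))).exists_unit
      (t g rfl ≪≫ (S.T g).mapIso (m rfl) ≪≫ (Functor.Monoidal.μIso (S.T g) (s x) (s y)).symm)
      (m (smul_mul' (f g) x y).symm ≪≫ (t g rfl ⊗ᵢ t g rfl))
    refine ⟨r, fun g' hg => ?_⟩
    obtain rfl := f.injective hg
    rintro _ _ _ _ rfl rfl rfl rfl _
    simpa using hr
  have hγ : ∀ k l x, ∃ r : Kˣ, ∀ g h, f g = k → f h = l → ∀ {hx ghx} (h1 : f (g * h) • x = ghx)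
      (h2 : f h • x = hx) (h3 : f g • hx = ghx),
      (t (g * h) h1).hom ≫ (S.γ g h).hom.app (s x) =
        (r : K) • (t g h3).hom ≫ (S.T g).map (t h h2).hom := fun k l x => by
    obtain ⟨g, rfl⟩ := f.surjective k
    obtain ⟨h, rfl⟩ := f.surjective l
    obtain ⟨r, hr⟩ := (basis.brick (f (g * h) • x)).exists_unit
      (t (g * h) rfl ≪≫ (S.γ g h).app (s x))
      (t g (by rw [map_mul, mul_smul]) ≪≫ (S.T g).mapIso (t h rfl))
    refine ⟨r, fun g' h' hg hh => ?_⟩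
    obtain rfl := f.injective hg
    obtain rfl := f.injective hh
    rintro _ _ rfl rfl _
    simpa using hr
  have hc : ∀ x y, ∃ r : Kˣ, ∀ {g xy z} (hg : f g = 𝒳.bd x) (h1 : x * y = xy) (h2 : f g • y = z)
      (h3 : z * x = xy), (m h1).hom ≫ (S.c g (s x) (comp hg) (s y)).hom =
        (r : K) • (m h3).hom ≫ (t g h2).hom ▷ s x := fun x y => by
    obtain ⟨g, hg⟩ := f.surjective (𝒳.bd x)
    obtain ⟨r, hr⟩ := (basis.brick (x * y)).exists_unit
      (m rfl ≪≫ S.c g (s x) (comp hg) (s y))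
      (m (x := f g • y) (by rw [hg, 𝒳.bd_smul, inv_mul_cancel_right]) ≪≫
        whiskerRightIso (t g rfl) (s x))
    refine ⟨r, fun {g'} _ _ hg' => ?_⟩
    obtain rfl := f.injective (hg.trans hg'.symm)
    rintro rfl rfl _
    simpa using hr
  choose ω hω using hω
  choose μ hμ using hμ
  choose γ hγ using hγ
  choose c hc using hc
  exact ⟨(ω, γ, μ, c), ⟨{
    f := f, s := s, basis := basis, comp := comp, m := m, t := t
    m_assoc := fun {x y z} _ _ _ => hω x y z
    t_δ := fun g {x y} _ _ _ _ => hμ _ x y g rfl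
    t_γ := fun g h {x} _ _ => hγ _ _ x g h rfl rfl
    m_c := fun {g x y} _ _ => hc x y }⟩⟩

end Existence

section Invertible

variable {C : Type u} [Category.{v} C] [MonoidalCategory C]

theorem isEquivalence_tensorLeft {A B : C} (i : A ⊗ B ≅ 𝟙_ C) (j : B ⊗ A ≅ 𝟙_ C) :
    (tensorLeft A).IsEquivalence :=
  (CategoryTheory.Equivalence.mk (tensorLeft A) (tensorLeft B)
    ((leftUnitorNatIso C).symm ≪≫ (tensoringLeft C).mapIso j.symm ≪≫ tensorLeftTensor B A)
    ((tensorLeftTensor A B).symm ≪≫ (tensoringLeft C).mapIso i ≪≫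
      leftUnitorNatIso C)).isEquivalence_functor

variable {K : Type w} [Field K] [Preadditive C] [Linear K C] [MonoidalPreadditive C]
  [MonoidalLinear K C]

theorem IsBrick.tensor {A B D : C} (hD : IsBrick K D) (i : A ⊗ B ≅ 𝟙_ C) (j : B ⊗ A ≅ 𝟙_ C) :
    IsBrick K (A ⊗ D) :=
  have := isEquivalence_tensorLeft i j
  hD.of_full (tensorLeft A)

end Invertible

section

variable {K : Type w} [Field K] {C : Type u} [Category.{v} C] [Preadditive C] [Linear K C]
  [MonoidalCategory C] [MonoidalPreadditive C] [MonoidalLinear K C] {G : Type b} [Group G]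

theorem GroupGrading.eq_of_comp {C : Type u} [Category.{v} C] [Preadditive C] [Linear K C]
    [MonoidalCategory C] (S : GroupGrading C G) {g h : G} {A : C} (hA : IsBrick K A)
    (hg : S.comp g A) (hh : S.comp h A) : g = h := by
  by_contra hgh
  exact hA.id_ne_zero (S.hom_eq_zero hg hh hgh _)

/-- The classes of simple objects form a finite group, on which the grading group acts, and with the
degree as boundary they form a crossed module; its axioms hold since isomorphic members of a brick
basis are equal. -/
theorem exists_framing (S : CrossedStructure K C G) {G' : Type a} [Group G'] [Finite G']
    (e : G ≃* G') {X : Type a} [Finite X] {s : X → C} (hs : IsBrickBasis K s)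
    (hone : IsBrick K (𝟙_ C))
    (hinv : ∀ x, ∃ B, Nonempty (s x ⊗ B ≅ 𝟙_ C) ∧ Nonempty (B ⊗ s x ≅ 𝟙_ C)) :
    ∃ (𝒳 : FinCrossedModule.{a}) (ξ : Cochain 𝒳 K), Nonempty (Framing S 𝒳 ξ) := by
  have hmul : ∀ x y, ∃ z, Nonempty (s z ≅ s x ⊗ s y) := fun x y => by
    obtain ⟨B, ⟨i⟩, ⟨j⟩⟩ := hinv x
    exact hs.exists_iso ((hs.brick y).tensor i j)
  have hleft : ∀ x, ∃ y, Nonempty (𝟙_ C ≅ s y ⊗ s x) := fun x => by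
    obtain ⟨B, ⟨i⟩, ⟨j⟩⟩ := hinv x
    obtain ⟨y, ⟨k⟩⟩ := hs.exists_iso ((hone.tensor j i).of_iso (ρ_ B))
    exact ⟨y, ⟨j.symm ≪≫ whiskerRightIso k.symm (s x)⟩⟩
  have hact : ∀ (g' : G') x, ∃ y, Nonempty (s y ≅ (S.T (e.symm g')).obj (s x)) := fun g' x =>
    hs.exists_iso ((hs.brick x).of_full _)
  have hdeg : ∀ x, ∃ g' : G', S.comp (e.symm g') (s x) := fun x => by
    obtain ⟨g, hg⟩ := S.exists_comp K (hs.brick x)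
    exact ⟨e g, by rwa [e.symm_apply_apply]⟩
  obtain ⟨one, ⟨i1⟩⟩ := hs.exists_iso hone
  choose mul hmul using hmul
  choose inv hinv' using hleft
  choose act hact using hact
  choose deg hdeg using hdeg
  let m x y : s (mul x y) ≅ s x ⊗ s y := (hmul x y).some
  let t g' x : s (act g' x) ≅ (S.T (e.symm g')).obj (s x) := (hact g' x).some
  have hdeg' : ∀ x g', S.comp (e.symm g') (s x) → deg x = g' := fun x g' h =>
    e.symm.injective (S.eq_of_comp (hs.brick x) (hdeg x) h)
  let _ : Mul X := ⟨mul⟩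
  let _ : One X := ⟨one⟩
  let _ : Inv X := ⟨inv⟩
  let _ : Group X := Group.ofLeftAxioms
    (fun x y z => hs.eq_of_iso (m (mul x y) z ≪≫ whiskerRightIso (m x y) (s z) ≪≫
      α_ _ _ _ ≪≫ whiskerLeftIso (s x) (m y z).symm ≪≫ (m x (mul y z)).symm))
    (fun x => hs.eq_of_iso (m one x ≪≫ whiskerRightIso i1 (s x) ≪≫ λ_ (s x)))
    (fun x => hs.eq_of_iso (m (inv x) x ≪≫ (hinv' x).some.symm ≪≫ i1.symm))
  let _ : MulDistribMulAction G' X :=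
    { smul := act
      one_smul := fun x => hs.eq_of_iso (t 1 x ≪≫ eqToIso (by rw [map_one]) ≪≫ S.ι.app (s x))
      mul_smul := fun g h x => hs.eq_of_iso (t (g * h) x ≪≫ eqToIso (by rw [map_mul]) ≪≫
        (S.γ (e.symm g) (e.symm h)).app (s x) ≪≫ (S.T (e.symm g)).mapIso (t h x).symm ≪≫
        (t g (act h x)).symm)
      smul_mul := fun g x y => hs.eq_of_iso (t g (mul x y) ≪≫ (S.T _).mapIso (m x y) ≪≫
        (Functor.Monoidal.μIso (S.T _) (s x) (s y)).symm ≪≫ ((t g x).symm ⊗ᵢ (t g y).symm) ≪≫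
        (m (act g x) (act g y)).symm)
      smul_one := fun g => hs.eq_of_iso (t g one ≪≫ (S.T _).mapIso i1 ≪≫
        (Functor.Monoidal.εIso (S.T _)).symm ≪≫ i1.symm) }
  have bd_mul : ∀ x y : X, deg (x * y) = deg x * deg y := fun x y => hdeg' _ _ <|
    S.comp_iso _ (m x y).symm <| by
      rw [map_mul]; exact S.comp_tensor (hdeg x) (hdeg y)
  let 𝒳 : FinCrossedModule.{a} :=
    { G := G'
      X := X
      bd := MonoidHom.mk' deg bd_mul
      bd_smul := fun x y => eq_mul_inv_of_mul_eq <| hs.eq_of_iso (m (act (deg x) y) x ≪≫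
        whiskerRightIso (t (deg x) y) (s x) ≪≫ (S.c _ (s x) (hdeg x) (s y)).symm ≪≫ (m x y).symm)
      smul_bd := fun g x => hdeg' _ _ <| S.comp_iso _ (t g x).symm <| by
        rw [map_mul, map_mul, map_inv]; exact S.T_comp (hdeg x) }
  refine ⟨𝒳, exists_framing_of_iso S 𝒳 e s hs (fun {g x} h => ?_) (fun x y => ⟨m x y⟩)
    fun g x => ⟨t (e g) x ≪≫ eqToIso (by rw [e.symm_apply_apply])⟩⟩
  have := hdeg x
  rwa [show deg x = e g from h.symm, e.symm_apply_apply] at this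

end

section

variable (K : Type w) [Field K] [IsAlgClosed K] (C : Type u) [Category.{v} C] [Preadditive C]
  [Linear K C] [MonoidalCategory C] [IsFusion K C]

/-- Representatives of the isomorphism classes of simple objects of a fusion category, indexed by a
type in a prescribed universe. -/
theorem IsFusion.exists_isBrickBasis : ∃ (X : Type a) (_ : Finite X) (s : X → C),
    IsBrickBasis K s ∧ ∀ x, Simple (s x) := by
  have : IsAbelian C := IsFusion.toIsAbelian K
  have : HasKernels C := IsAbelian.toHasKernels
  let r : Setoid {A : C // Simple A} :=
    { r := fun A B => Nonempty (A.1 ≅ B.1)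
      iseqv := ⟨fun A => ⟨Iso.refl _⟩, fun ⟨i⟩ => ⟨i.symm⟩, fun ⟨i⟩ ⟨j⟩ => ⟨i ≪≫ j⟩⟩ }
  have hfin : Finite (Quotient r) := by
    obtain ⟨n, Y, hY⟩ := IsFusion.finite_simple K (C := C)
    choose k hk using fun A : {A : C // Simple A} => hY A.1 A.2
    refine Finite.of_injective (fun q : Quotient r => k q.out) fun p q h => ?_
    rw [← p.out_eq, ← q.out_eq]
    exact Quotient.sound ⟨(hk p.out).some ≪≫ eqToIso (congrArg Y h) ≪≫ (hk q.out).some.symm⟩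
  let e : Quotient r ≃ Shrink.{a} (Quotient r) := equivShrink _
  refine ⟨Shrink.{a} (Quotient r), Finite.of_equiv _ e, fun x => (e.symm x).out.1, ⟨fun x =>
    IsFusion.isBrick K (e.symm x).out.2, fun {x y} hxy φ => ?_, fun A => ?_⟩,
    fun x => (e.symm x).out.2⟩
  · by_contra h0
    have := (e.symm x).out.2
    have := (e.symm y).out.2
    have := isIso_of_hom_simple h0
    refine hxy (e.symm.injective ?_)
    rw [← (e.symm x).out_eq, ← (e.symm y).out_eq]
    exact Quotient.sound ⟨asIso φ⟩
  · obtain ⟨n, Y, hY, b, ⟨hb⟩, ⟨i⟩⟩ := IsFusion.semisimple K A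
    have hx : ∀ j, Nonempty ((Quotient.mk r ⟨Y j, hY j⟩).out.1 ≅ Y j) := fun j =>
      Quotient.mk_out (s := r) ⟨Y j, hY j⟩
    have h : ∀ j, (e.symm (e (Quotient.mk r ⟨Y j, hY j⟩))).out.1 ≅ Y j := fun j =>
      eqToIso (by rw [e.symm_apply_apply]) ≪≫ (hx j).some
    refine ⟨n, fun j => e (Quotient.mk r ⟨Y j, hY j⟩), fun j => (h j).hom ≫ b.ι j ≫ i.inv,
      fun j => i.hom ≫ b.π j ≫ (h j).inv, ?_⟩
    have := congrArg (fun k => i.hom ≫ k ≫ i.inv) (IsBilimit.total hb)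
    simpa [Preadditive.sum_comp, Preadditive.comp_sum] using this

end

/-- Every crossed pointed category has a framing by a crossed module in any given universe. -/
theorem CrossedPointedCategory.exists_framing {K : Type w} [Field K] [IsAlgClosed K]
    (𝒟 : CrossedPointedCategory.{b, w, v, u} K) :
    ∃ (𝒳 : FinCrossedModule.{a}) (ξ : Zqa 𝒳 K), Nonempty (Framing 𝒟.crossed 𝒳 ξ.1) := by
  have : IsFusion K 𝒟.C := 𝒟.fusion
  have : MonoidalPreadditive 𝒟.C := IsFusion.monoidalPreadditive K
  have : MonoidalLinear K 𝒟.C := IsFusion.monoidalLinear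
  obtain ⟨X, _, s, hs, hsimple⟩ := IsFusion.exists_isBrickBasis.{a} K 𝒟.C
  let e : 𝒟.G ≃* Shrink.{a} 𝒟.G := Shrink.mulEquiv.symm
  have : Finite (Shrink.{a} 𝒟.G) := Finite.of_equiv _ e.toEquiv
  obtain ⟨𝒳, ξ, ⟨Θ⟩⟩ := CrossedPointed.exists_framing 𝒟.crossed e hs
    (IsFusion.isBrick K (IsFusion.simple_unit K)) fun x => 𝒟.pointed _ (hsimple x)
  exact ⟨𝒳, ⟨ξ, Θ.isQuasiAbelian⟩, ⟨Θ⟩⟩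

/-! ### Transport of framings along equivalences -/

open Functor.OplaxMonoidal

namespace Framing

universe u₁ v₁ a₁ u₂ v₂ a₂

variable {K : Type w} [Field K]
  {C : Type u₁} [Category.{v₁} C] [Preadditive C] [Linear K C] [MonoidalCategory C]
  {G : Type a₁} [Group G] {S : CrossedStructure K C G}
  {D : Type u₂} [Category.{v₂} D] [Preadditive D] [Linear K D] [MonoidalCategory D]
  {H : Type a₂} [Group H] {S' : CrossedStructure K D H}
  {𝒳 : FinCrossedModule.{a}} {ξ : Cochain 𝒳 K} (Θ : Framing S 𝒳 ξ) (Φ : CrossedFunctor S S')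

/-- The image of `Θ.m` under a crossed functor. -/
def mapM {x y z : 𝒳.X} (h : x * y = z) :
    Φ.F.obj (Θ.s z) ≅ Φ.F.obj (Θ.s x) ⊗ Φ.F.obj (Θ.s y) :=
  Φ.F.mapIso (Θ.m h) ≪≫ (Functor.Monoidal.μIso Φ.F _ _).symm

/-- The image of `Θ.t g` under a crossed functor. -/
def mapT {g : G} {g' : H} (p : Φ.f g = g') {x y : 𝒳.X} (h : Θ.f g • x = y) :
    Φ.F.obj (Θ.s y) ≅ (S'.T g').obj (Φ.F.obj (Θ.s x)) :=
  Φ.F.mapIso (Θ.t g h) ≪≫ (Φ.βOf g p).app _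

theorem mapM_hom {x y z : 𝒳.X} (h : x * y = z) :
    (Θ.mapM Φ h).hom = Φ.F.map (Θ.m h).hom ≫ δ Φ.F (Θ.s x) (Θ.s y) := rfl

theorem mapT_hom {g : G} {g' : H} (p : Φ.f g = g') {x y : 𝒳.X} (h : Θ.f g • x = y) :
    (Θ.mapT Φ p h).hom = Φ.F.map (Θ.t g h).hom ≫ (Φ.βOf g p).hom.app (Θ.s x) := rfl

theorem mapM_assoc {x y z xy yz xyz : 𝒳.X} (h1 : x * y = xy) (h2 : xy * z = xyz)
    (h3 : y * z = yz) (h4 : x * yz = xyz) :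
    (Θ.mapM Φ h2).hom ≫ (Θ.mapM Φ h1).hom ▷ Φ.F.obj (Θ.s z) ≫ (α_ _ _ _).hom =
      (ξ.ω x y z : K) • (Θ.mapM Φ h4).hom ≫ Φ.F.obj (Θ.s x) ◁ (Θ.mapM Φ h3).hom := by
  have h := congrArg (fun k => Φ.F.map k ≫ δ Φ.F _ _ ≫ Φ.F.obj (Θ.s x) ◁ δ Φ.F (Θ.s y) (Θ.s z))
    (Θ.m_assoc h1 h2 h3 h4)
  simp only [Functor.map_comp, Functor.map_smul, Linear.smul_comp, Category.assoc] at h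
  rw [← δ_natural_right_assoc] at h
  simp only [mapM_hom, comp_whiskerRight, MonoidalCategory.whiskerLeft_comp, Category.assoc]
  rw [← h, ← associativity, δ_natural_left_assoc]

theorem mapT_δ {g : G} {g' : H} (p : Φ.f g = g') {x y xy gx gy gxy : 𝒳.X} (h1 : x * y = xy)
    (h2 : Θ.f g • xy = gxy) (h3 : Θ.f g • x = gx) (h4 : Θ.f g • y = gy) (h5 : gx * gy = gxy) :
    (Θ.mapT Φ p h2).hom ≫ (S'.T g').map (Θ.mapM Φ h1).hom ≫ δ (S'.T g') _ _ =
      (ξ.μ (Θ.f g) x y : K) • (Θ.mapM Φ h5).hom ≫ ((Θ.mapT Φ p h3).hom ⊗ₘ (Θ.mapT Φ p h4).hom) := by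
  have h := congrArg (fun k => Φ.F.map k ≫ δ Φ.F _ _ ≫
    ((Φ.βOf g p).hom.app (Θ.s x) ⊗ₘ (Φ.βOf g p).hom.app (Θ.s y))) (Θ.t_δ g h1 h2 h3 h4 h5)
  have hβ := δ_comp_app (Φ.βOf g p).hom (Θ.s x) (Θ.s y)
  have hn := (Φ.βOf g p).hom.naturality (Θ.m h1).hom
  simp only [comp_δ, Functor.comp_map, Functor.comp_obj, Category.assoc] at hβ hn
  simp only [Functor.map_comp, Functor.map_smul, Linear.smul_comp, Category.assoc] at h
  rw [← δ_natural_assoc, tensorHom_comp_tensorHom] at h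
  simp only [mapM_hom, mapT_hom, Functor.map_comp, Category.assoc]
  rw [← h, ← reassoc_of% hn, hβ]

theorem mapT_γ {g h : G} {g' h' : H} (p : Φ.f g = g') (q : Φ.f h = h') (r : Φ.f (g * h) = g' * h')
    {x hx ghx : 𝒳.X} (h1 : Θ.f (g * h) • x = ghx) (h2 : Θ.f h • x = hx) (h3 : Θ.f g • hx = ghx) :
    (Θ.mapT Φ r h1).hom ≫ (S'.γ g' h').hom.app _ =
      (ξ.γ (Θ.f g) (Θ.f h) x : K) •
        (Θ.mapT Φ p h3).hom ≫ (S'.T g').map (Θ.mapT Φ q h2).hom := by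
  have e := congrArg (fun k => Φ.F.map k ≫ (Φ.βOf g p).hom.app _ ≫
    (S'.T g').map ((Φ.βOf h q).hom.app _)) (Θ.t_γ g h h1 h2 h3)
  have hn := (Φ.βOf g p).hom.naturality (Θ.t h h2).hom
  simp only [Functor.comp_map, Functor.comp_obj] at hn
  simp only [Functor.map_comp, Functor.map_smul, Linear.smul_comp, Category.assoc] at e
  simp only [mapT_hom, Functor.map_comp, Category.assoc]
  rw [← Φ.βOf_γ p q r, e, reassoc_of% hn]

theorem mapT_congr {k l : G} {g' : H} (p : Φ.f k = g') (p' : Φ.f l = g') (q : k = l) {x y : 𝒳.X}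
    (h : Θ.f k • x = y) (h' : Θ.f l • x = y) : Θ.mapT Φ p h = Θ.mapT Φ p' h' := by
  subst q; rfl

theorem mapM_c {g : G} {g' : H} (p : Φ.f g = g') {x y xy z : 𝒳.X} (hg : Θ.f g = 𝒳.bd x)
    (hX : S'.comp g' (Φ.F.obj (Θ.s x))) (h1 : x * y = xy) (h2 : Θ.f g • y = z) (h3 : z * x = xy) :
    (Θ.mapM Φ h1).hom ≫ (S'.c g' _ hX (Φ.F.obj (Θ.s y))).hom =
      (ξ.c x y : K) • (Θ.mapM Φ h3).hom ≫ (Θ.mapT Φ p h2).hom ▷ Φ.F.obj (Θ.s x) := by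
  have e := congrArg (fun k => Φ.F.map k ≫ δ Φ.F _ _ ≫ (Φ.βOf g p).hom.app _ ▷ _)
    (Θ.m_c hg h1 h2 h3)
  simp only [Functor.map_comp, Functor.map_smul, Linear.smul_comp, Category.assoc] at e
  rw [← δ_natural_left_assoc] at e
  simp only [mapM_hom, mapT_hom, comp_whiskerRight, Category.assoc]
  rw [← e, Φ.βOf_c p (Θ.comp hg) hX]

/-- The image of a framing under an equivalence of crossed categories. -/
def map [Φ.F.IsEquivalence] (e : G ≃* H) (he : ∀ g, Φ.f g = e g) : Framing S' 𝒳 ξ :=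
  have p (g' : H) : Φ.f (e.symm g') = g' := by rw [he, e.apply_symm_apply]
  { f := e.symm.trans Θ.f
    s := fun x => Φ.F.obj (Θ.s x)
    basis := Θ.basis.map Φ.F
    comp := fun {g'} x h => by
      have := Φ.F_comp (Θ.comp (g := e.symm g') h)
      rwa [p] at this
    m := Θ.mapM Φ
    t := fun g' {_ _} h => Θ.mapT Φ (p g') h
    m_assoc := Θ.mapM_assoc Φ
    t_δ := fun g' {_ _ _ _ _ _} => Θ.mapT_δ Φ (p g')
    t_γ := fun g' h' {x hx ghx} h1 h2 h3 => by
      have q : e.symm (g' * h') = e.symm g' * e.symm h' := map_mul _ _ _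
      have h1' : Θ.f (e.symm g' * e.symm h') • x = ghx := q ▸ h1
      rw [Θ.mapT_congr Φ (p _) (by rw [map_mul, p, p]) q h1 h1']
      exact Θ.mapT_γ Φ (p g') (p h') _ h1' h2 h3
    m_c := fun {g' _ _ _} => fun hg => Θ.mapM_c Φ (p g') hg _ }

end Framing

/-! ### Classification -/

section Classification

variable {K : Type w} [Field K]

/-- Two orbits correspond under an isomorphism if and only if their representatives do so up to a
coboundary, possibly under another isomorphism. -/
theorem exists_iso_of_pullOrbits {𝒳 𝒴 : FinCrossedModule.{a}} {ξ : Zqa 𝒳 K} {ξ' : Zqa 𝒴 K} :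
    (∃ φ : 𝒳.Iso 𝒴, pullOrbits K φ (orbitOf ξ') = orbitOf ξ) ↔
      ∃ (φ : 𝒳.Iso 𝒴) (p : _), ξ.1 = pullCochain K φ ξ'.1 * coboundary 𝒳 K p := by
  constructor
  · rintro ⟨φ, h⟩
    obtain ⟨ψ, hψ⟩ := Quotient.exact h
    refine ⟨FinCrossedModule.Iso.trans ψ φ, ?_⟩
    have h1 : (QuotientGroup.mk ξ : Hqa 𝒳 K) = pullH K (ψ.trans φ) (QuotientGroup.mk ξ') := by
      rw [pullH_trans, ← show ψ • (QuotientGroup.mk ξ : Hqa 𝒳 K) = _ from hψ]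
      exact (inv_smul_smul ψ _).symm
    obtain ⟨p, hp⟩ := QuotientGroup.eq.1 h1.symm
    refine ⟨p, ?_⟩
    rw [show coboundary 𝒳 K p = (pullCochain K (ψ.trans φ) ξ'.1)⁻¹ * ξ.1 from hp,
      mul_inv_cancel_left]
  · rintro ⟨φ, p, h⟩
    refine ⟨φ, congrArg (Quotient.mk _) ?_⟩
    exact QuotientGroup.eq.2 ⟨p, by
      change _ = (pullCochain K φ ξ'.1)⁻¹ * ξ.1
      rw [h, inv_mul_cancel_left]⟩

/-- Automorphisms act trivially on orbits. -/
theorem pullOrbits_aut {𝒳 : FinCrossedModule.{a}} (φ : 𝒳.Aut) (o : Orbits 𝒳 K) :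
    pullOrbits K φ o = o := by
  induction o using Quotient.inductionOn with
  | h h => exact Quotient.sound ⟨φ⁻¹, rfl⟩

variable [IsAlgClosed K]

/-- The framing of `C(ξ)` by lines, pushed along an equivalence to `C(ξ')`, can be compared with the
framing of `C(ξ')` by lines; conversely, a change of the latter yields an equivalence. -/
theorem catOf_crossedEquivalent_iff {𝒳 𝒴 : FinCrossedModule.{a}} {ξ : Zqa 𝒳 K} {ξ' : Zqa 𝒴 K} :
    CrossedEquivalent (catOf ξ) (catOf ξ') ↔
      ∃ φ : 𝒳.Iso 𝒴, pullOrbits K φ (orbitOf ξ') = orbitOf ξ := by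
  rw [exists_iso_of_pullOrbits]
  have : MonoidalPreadditive (catOf ξ').C := (catOf ξ').fusion.monoidalPreadditive
  have : MonoidalLinear K (catOf ξ').C := (catOf ξ').fusion.monoidalLinear
  let Θ : Framing (catOf ξ').crossed 𝒴 ξ'.1 := lineFraming ξ'
  constructor
  · rintro ⟨Φ, hf, hF⟩
    let Ψ : Framing (catOf ξ).crossed 𝒳 ξ.1 := lineFraming ξ
    let Θ' : Framing (catOf ξ').crossed 𝒳 ξ.1 := Ψ.map Φ (.ofBijective Φ.f hf) fun _ => rfl
    exact Θ'.exists_eq_pullCochain_mul_coboundary Θ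
  · rintro ⟨φ, p, h⟩
    have Θ' : Framing (catOf ξ').crossed 𝒳 ξ.1 := h ▸ Θ.change φ p
    exact Θ'.crossedEquivalent.symm

theorem CrossedPointedCategory.exists_crossedEquivalent_catOf
    (𝒟 : CrossedPointedCategory.{b, w, v, u} K) :
    ∃ (𝒳 : FinCrossedModule.{a}) (ξ : Zqa 𝒳 K), CrossedEquivalent 𝒟 (catOf ξ) := by
  obtain ⟨𝒳, ξ, ⟨Θ⟩⟩ := 𝒟.exists_framing
  exact ⟨𝒳, ξ, Θ.crossedEquivalent⟩

/-- Reflexivity follows from symmetry and transitivity, as every category is equivalent to some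
`C(ξ)`. -/
theorem CrossedEquivalent.refl (𝒟 : CrossedPointedCategory.{b, w, v, u} K) :
    CrossedEquivalent 𝒟 𝒟 := by
  obtain ⟨_, _, h⟩ := CrossedPointedCategory.exists_crossedEquivalent_catOf.{0} 𝒟
  exact h.trans h.symm

end Classification

end

end CrossedPointed

theorem mainTheorem1 (K : Type w) [Field K] [IsAlgClosed K] [CharZero K] :
    -- equivalence of crossed pointed categories is an equivalence relation
    Equivalence (fun 𝒞 𝒟 : CrossedPointedCategory.{a, w, w, max a (w + 1)} K =>
      CrossedEquivalent 𝒞 𝒟) ∧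
    -- pairs of a finite crossed module and an orbit correspond to equivalence classes
    (∃ Φ : Quotient (pairSetoid.{a, w} K) ≃
        Quot (fun 𝒞 𝒟 : CrossedPointedCategory.{a, w, w, max a (w + 1)} K =>
          CrossedEquivalent 𝒞 𝒟),
      ∀ (𝒳 : FinCrossedModule.{a}) (ξ : Zqa 𝒳 K),
        Φ (Quotient.mk _ ⟨𝒳, orbitOf ξ⟩) = Quot.mk _ (catOf ξ)) ∧
    -- on a fixed crossed module, equivalence classes correspond to orbits
    (∀ (𝒳 : FinCrossedModule.{a}) (ξ ξ' : Zqa 𝒳 K),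
      CrossedEquivalent (catOf ξ) (catOf ξ') ↔ orbitOf ξ = orbitOf ξ') ∧
    -- every crossed pointed category, in any universe, is of the form `C(ξ)`
    ∀ 𝒟 : CrossedPointedCategory.{b, w, v, u} K,
      ∃ (𝒳 : FinCrossedModule.{a}) (ξ : Zqa 𝒳 K), CrossedEquivalent 𝒟 (catOf ξ) := by
  have hE : Equivalence (fun 𝒞 𝒟 : CrossedPointedCategory.{a, w, w, max a (w + 1)} K =>
      CrossedEquivalent 𝒞 𝒟) := ⟨.refl, .symm, .trans⟩
  refine ⟨hE, ?_, fun 𝒳 ξ ξ' => catOf_crossedEquivalent_iff.trans ⟨fun ⟨φ, h⟩ => ?_,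
    fun h => ⟨.refl 𝒳, (pullOrbits_refl K _).trans h.symm⟩⟩,
    fun 𝒟 => 𝒟.exists_crossedEquivalent_catOf⟩
  · -- the bijection is defined by a choice of representatives
    have hrep : ∀ q : Σ 𝒳 : FinCrossedModule.{a}, Orbits 𝒳 K,
        ∃ ξ : Zqa q.1 K, orbitOf ξ = q.2 := by
      rintro ⟨𝒳, o⟩
      induction o using Quotient.inductionOn with
      | h h => induction h using QuotientGroup.induction_on with | H ξ => exact ⟨ξ, rfl⟩
    choose rep hrep using hrep
    have hsound : ∀ p q : Σ 𝒳 : FinCrossedModule.{a}, Orbits 𝒳 K, p ≈ q ↔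
        CrossedEquivalent (catOf (rep p)) (catOf (rep q)) := fun p q => by
      rw [catOf_crossedEquivalent_iff, hrep, hrep]
      rfl
    refine ⟨.ofBijective (Quotient.lift (fun q => Quot.mk _ (catOf (rep q)))
      fun p q h => Quot.sound ((hsound p q).1 h)) ⟨?_, ?_⟩, fun 𝒳 ξ => ?_⟩
    · rintro ⟨p⟩ ⟨q⟩ h
      exact Quotient.sound ((hsound p q).2 (hE.quot_mk_eq_iff _ _ |>.1 h))
    · rintro ⟨𝒟⟩
      obtain ⟨𝒳, ξ, h⟩ := 𝒟.exists_crossedEquivalent_catOf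
      refine ⟨Quotient.mk _ ⟨𝒳, orbitOf ξ⟩, Quot.sound (CrossedEquivalent.trans ?_ h.symm)⟩
      exact catOf_crossedEquivalent_iff.2
        ⟨.refl 𝒳, (pullOrbits_refl K _).trans (hrep ⟨𝒳, orbitOf ξ⟩).symm⟩
    · exact Quot.sound (catOf_crossedEquivalent_iff.2
        ⟨.refl 𝒳, (pullOrbits_refl K _).trans (hrep ⟨𝒳, orbitOf ξ⟩).symm⟩)
  · rw [← h, pullOrbits_aut]
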